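/- Let $n\ge 1$ and let $(X,\omega,J,\Omega)$ be a Calabi--Yau manifold of complex dimension $n$: a complex manifold with a Kähler form $\omega$ and a holomorphic $n$-form $\Omega$ satisfying $$(-1)^{\frac{n(n-1)}{2}}\left(\tfrac{\sqrt{-1}}{2}\right)^n\Omega\wedge\overline\Omega=\tfrac1{n!}\,\omega^n$$ (so that the Kähler metric is Ricci flat). Let $L$ be a smooth compact $n$-dimensional manifold with smooth (possibly empty) boundary, let $C_1,\dots,C_d$ be the connected components of $\partial L$, and let $\Lambda_1,\dots,\Lambda_d\subset X$ be pairwise disjoint embedded Lagrangian submanifolds. Let $\mathrm{Diff}(L)$ be the group of diffeomorphisms of $L$ that map each component of $\partial L$ to itself. An immersion $f:L\to X$ is free if $f\circ\psi=f$, $\psi\in\mathrm{Diff}(L)$, implies $\psi=\mathrm{id}$; it is special Lagrangian if $f^*\omega=0$ and $f^*\operatorname{Im}\Omega=0$; it has boundary condition $\Lambda=(\Lambda_1,\dots,\Lambda_d)$ if $f(C_i)\subset\Lambda_i$ and $df(T_pL)\not\subset T_{f(p)}\Lambda_i$ for all $p\in C_i$ and all $i$. Let $\mathcal{SL}(X,L;\Lambda)$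 be the set of classes, modulo reparametrization by $\mathrm{Diff}(L)$, of free special Lagrangian immersions $L\to X$ with boundary condition $\Lambda$. For $Y=[0,1]$ or $Y=[0,1]^2$, a smooth lifting of a map $\mathcal Z:Y\to\mathcal{SL}(X,L;\Lambda)$ is a smooth map $f:Y\times L\to X$ such that, for every $y\in Y$, $f_y=f(y,\cdot)$ is a free special Lagrangian immersion with boundary condition $\Lambda$ representing $\mathcal Z(y)$; $\mathcal Z$ is smooth if it has a smooth lifting. (1) For every smooth path $\mathcal Z:[0,1]\to\mathcal{SL}(X,L;\Lambda)$ and every smooth lifting $f$ of it, the integral $\int_0^1 f_t^*\big(i_{\frac{df_t}{dt}}\operatorname{Im}\Omega\big)\,dt$ exists and is a smooth closed $(n-1)$-form on $L$, so that $$SF(f):=\left[\int_0^1 f_t^*\,i_{\frac{df_t}{dt}}\operatorname{Im}\Omega\;dt\right]\in H^{n-1}(L;\mathbb R)$$ is a well-defined de Rham cohomology class. (2) $SF(f)$ depends only on $f_0$ and on the end-point preserving homotopy class of $\mathcal Z$ in $\mathcal{SL}(X,L;\Lambda)$: if $f$ and $\bar f$ are smooth liftings of smooth paths $\mathcal Z$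 and $\bar{\mathcal Z}$ with $f_0=\bar f_0$, and there is a smooth map $\mathcal H:[0,1]^2\to\mathcal{SL}(X,L;\Lambda)$ with $\mathcal H(0,t)=\mathcal Z_t$, $\mathcal H(1,t)=\bar{\mathcal Z}_t$, $\mathcal H(u,0)=\mathcal Z_0=\bar{\mathcal Z}_0$ and $\mathcal H(u,1)=\mathcal Z_1=\bar{\mathcal Z}_1$ for all $t,u\in[0,1]$, then $SF(f)=SF(\bar f)$. -/

import Mathlib

open scoped Manifold ContDiff Topology

namespace SLFlux

noncomputable section

/-! ### Differential forms on manifolds with boundary and de Rham cohomology -/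

section Forms

variable {𝕜 : Type*} [NontriviallyNormedField 𝕜]
  {E : Type*} [NormedAddCommGroup E] [NormedSpace 𝕜 E]
  {H : Type*} [TopologicalSpace H] (I : ModelWithCorners 𝕜 E H)
  {E' : Type*} [NormedAddCommGroup E'] [NormedSpace 𝕜 E']
  {H' : Type*} [TopologicalSpace H'] (I' : ModelWithCorners 𝕜 E' H')
  (M : Type*) [TopologicalSpace M] [ChartedSpace H M]
  {M' : Type*} [TopologicalSpace M'] [ChartedSpace H' M']
  (k : ℕ) (F : Type*) [NormedAddCommGroup F] [NormedSpace 𝕜 F]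

/-- Differential `k`-forms with values in `F` (no regularity imposed). -/
abbrev DiffForm : Type _ := (x : M) → TangentSpace I x [⋀^Fin k]→L[𝕜] F

variable {M k F}

/-- The expression of a form in the preferred chart `φ` at `x₀`: the pullback `(φ⁻¹)^* α`,
a form on the subset `φ.target` of the model vector space. -/
def formInChart (α : DiffForm I M k F) (x₀ : M) (y : E) : E [⋀^Fin k]→L[𝕜] F :=
  ContinuousAlternatingMap.compContinuousLinearMap (α ((extChartAt I x₀).symm y))
    (mfderivWithin 𝓘(𝕜, E) I (extChartAt I x₀).symm (Set.range I) y)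

/-- A form is of class `C^r` (up to the boundary) if its expression in each chart is. Over `ℂ`,
with `r = ω`, these are the holomorphic forms. -/
def IsSmoothForm (r : WithTop ℕ∞) (α : DiffForm I M k F) : Prop :=
  ∀ x₀ : M, ContDiffOn 𝕜 r (formInChart I α x₀) (extChartAt I x₀).target

/-- `dα = β`, for the exterior derivative computed in charts. -/
def HasExtDeriv (α : DiffForm I M k F) (β : DiffForm I M (k + 1) F) : Prop :=
  ∀ x₀ : M, ∀ y ∈ (extChartAt I x₀).target,
    extDerivWithin (formInChart I α x₀) (extChartAt I x₀).target y = formInChart I β x₀ y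

/-- The pullback `f^* α`. -/
def pullback (f : M → M') (α : DiffForm I' M' k F) : DiffForm I M k F :=
  fun x => (α (f x)).compContinuousLinearMap (mfderiv I I' f x)

/-- A smooth map with injective derivative at each point. -/
def IsSmoothImmersion (f : M → M') : Prop :=
  ContMDiff I I' ∞ f ∧ ∀ p : M, Function.Injective (mfderiv I I' f p)

variable {I}

theorem formInChart_add (α β : DiffForm I M k F) (x₀ : M) :
    formInChart I (α + β) x₀ = formInChart I α x₀ + formInChart I β x₀ := by
  ext y v; rfl

theorem formInChart_smul (c : 𝕜) (α : DiffForm I M k F) (x₀ : M) :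
    formInChart I (c • α) x₀ = c • formInChart I α x₀ := by
  ext y v; rfl

theorem formInChart_zero (x₀ : M) :
    formInChart I (0 : DiffForm I M k F) x₀ = 0 := by
  ext y v; rfl

theorem IsSmoothForm.zero {r : WithTop ℕ∞} : IsSmoothForm I r (0 : DiffForm I M k F) := by
  intro x₀
  rw [formInChart_zero]
  exact contDiffOn_const

theorem IsSmoothForm.add {r : WithTop ℕ∞} {α β : DiffForm I M k F}
    (hα : IsSmoothForm I r α) (hβ : IsSmoothForm I r β) : IsSmoothForm I r (α + β) := by
  intro x₀
  rw [formInChart_add]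
  exact (hα x₀).add (hβ x₀)

theorem IsSmoothForm.smul {r : WithTop ℕ∞} (c : 𝕜) {α : DiffForm I M k F}
    (hα : IsSmoothForm I r α) : IsSmoothForm I r (c • α) := by
  intro x₀
  rw [formInChart_smul]
  exact (hα x₀).const_smul c

theorem HasExtDeriv.zero :
    HasExtDeriv I (0 : DiffForm I M k F) (0 : DiffForm I M (k + 1) F) := by
  intro x₀ y hy
  have h := extDerivWithin_smul (0 : 𝕜) (fun _ : E => (0 : E [⋀^Fin k]→L[𝕜] F))
    (uniqueDiffOn_extChartAt_target (I := I) x₀ y hy)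
  rw [formInChart_zero, formInChart_zero]
  simpa using h

theorem HasExtDeriv.add {α β : DiffForm I M k F} {α' β' : DiffForm I M (k + 1) F}
    (sα : IsSmoothForm I ∞ α) (sβ : IsSmoothForm I ∞ β)
    (hα : HasExtDeriv I α α') (hβ : HasExtDeriv I β β') : HasExtDeriv I (α + β) (α' + β') := by
  intro x₀ y hy
  rw [formInChart_add, formInChart_add,
    extDerivWithin_add (uniqueDiffOn_extChartAt_target x₀ y hy)
      ((sα x₀).differentiableOn (by simp) y hy) ((sβ x₀).differentiableOn (by simp) y hy),
    hα x₀ y hy, hβ x₀ y hy]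
  rfl

theorem HasExtDeriv.smul (c : 𝕜) {α : DiffForm I M k F} {α' : DiffForm I M (k + 1) F}
    (hα : HasExtDeriv I α α') : HasExtDeriv I (c • α) (c • α') := by
  intro x₀ y hy
  rw [formInChart_smul, formInChart_smul,
    extDerivWithin_smul c _ (uniqueDiffOn_extChartAt_target x₀ y hy), hα x₀ y hy]
  rfl

end Forms

section DeRham

variable {E : Type*} [NormedAddCommGroup E] [NormedSpace ℝ E]
  {H : Type*} [TopologicalSpace H] (I : ModelWithCorners ℝ E H)
  (M : Type*) [TopologicalSpace M] [ChartedSpace H M]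

/-- Smooth closed real `k`-forms. -/
def closedForms (k : ℕ) : Submodule ℝ (DiffForm I M k ℝ) where
  carrier := {α | IsSmoothForm I ∞ α ∧ HasExtDeriv I α 0}
  zero_mem' := ⟨.zero, .zero⟩
  add_mem' := fun {α β} hα hβ => ⟨hα.1.add hβ.1, by
    simpa using HasExtDeriv.add hα.1 hβ.1 hα.2 hβ.2⟩
  smul_mem' := fun c α hα => ⟨hα.1.smul c, by simpa using HasExtDeriv.smul c hα.2⟩

/-- Exact real `k`-forms: the exterior derivatives of smooth `(k-1)`-forms; only `0` if `k = 0`. -/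
def exactForms : (k : ℕ) → Submodule ℝ (DiffForm I M k ℝ)
  | 0 => ⊥
  | k + 1 =>
    { carrier := {α | ∃ β : DiffForm I M k ℝ, IsSmoothForm I ∞ β ∧ HasExtDeriv I β α}
      zero_mem' := ⟨0, .zero, .zero⟩
      add_mem' := fun ⟨β, sβ, hβ⟩ ⟨γ, sγ, hγ⟩ => ⟨β + γ, sβ.add sγ, .add sβ sγ hβ hγ⟩
      smul_mem' := fun c _ ⟨β, sβ, hβ⟩ => ⟨c • β, sβ.smul c, .smul c hβ⟩ }

/-- The de Rham cohomology `H^k(M; ℝ)`: closed forms modulo exact forms. -/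
abbrev DeRham (k : ℕ) : Type _ :=
  closedForms I M k ⧸ (exactForms I M k).comap (closedForms I M k).subtype

/-- The cohomology class of a closed form. -/
def deRhamClass {k : ℕ} (α : DiffForm I M k ℝ) (h : α ∈ closedForms I M k) : DeRham I M k :=
  Submodule.Quotient.mk ⟨α, h⟩

end DeRham

/-! ### Calabi–Yau manifolds -/

section Wedge

variable {V : Type*}

/-- `(α ∧ β)(v₁, …, v_{p+q})
  = (1 / (p! q!)) ∑_σ sgn(σ) α(v_{σ(1)}, …, v_{σ(p)}) β(v_{σ(p+1)}, …, v_{σ(p+q)})`. -/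
def wedge {p q : ℕ} (α : (Fin p → V) → ℂ) (β : (Fin q → V) → ℂ) (v : Fin (p + q) → V) : ℂ :=
  ((p.factorial : ℂ) * (q.factorial : ℂ))⁻¹ * ∑ σ : Equiv.Perm (Fin (p + q)),
    ((Equiv.Perm.sign σ : ℤ) : ℂ) *
      (α (fun i => v (σ (Fin.castAdd q i))) * β (fun j => v (σ (Fin.natAdd p j))))

/-- The `k`-fold wedge power of a `2`-form. -/
def wedgePow (α : (Fin 2 → V) → ℂ) : (k : ℕ) → (Fin (2 * k) → V) → ℂ
  | 0 => fun _ => 1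
  | k + 1 => wedge (wedgePow α k) α

end Wedge

section CY

variable (E : Type*) [NormedAddCommGroup E] [NormedSpace ℂ E]

/-- The complex structure `J` of a complex manifold modelled on `E`. -/
def complexStructure {X : Type*} [TopologicalSpace X] [ChartedSpace E X] (x : X) :
    TangentSpace 𝓘(ℝ, E) x →L[ℝ] TangentSpace 𝓘(ℝ, E) x :=
  (Complex.I • ContinuousLinearMap.id ℝ E : E →L[ℝ] E)

/-- The imaginary part of a complex `k`-form, a real `k`-form. -/
def imForm {X : Type*} [TopologicalSpace X] [ChartedSpace E X] {k : ℕ}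
    (Ω : DiffForm 𝓘(ℂ, E) X k ℂ) : DiffForm 𝓘(ℝ, E) X k ℝ :=
  fun x =>
    let Ωx : E [⋀^Fin k]→L[ℂ] ℂ := Ω x
    (Complex.imCLM.compContinuousAlternatingMap (Ωx.restrictScalars ℝ) : E [⋀^Fin k]→L[ℝ] ℝ)

/-- A Calabi–Yau structure on a complex manifold `X` of complex dimension `n`: a Kähler form and
a holomorphic top-degree form `Ω` of constant length, with
`(-1)^(n(n-1)/2) (i/2)^n Ω ∧ conj Ω = ω^n / n!`. The last equation makes the Kähler metric
`ω(·, J ·)` Ricci flat. -/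
structure CalabiYau (n : ℕ) (X : Type*) [TopologicalSpace X] [ChartedSpace E X] where
  /-- the Kähler form `ω` -/
  kahler : DiffForm 𝓘(ℝ, E) X 2 ℝ
  /-- the holomorphic volume form `Ω` -/
  vol : DiffForm 𝓘(ℂ, E) X n ℂ
  finrank_eq : Module.finrank ℂ E = n
  kahler_smooth : IsSmoothForm 𝓘(ℝ, E) ∞ kahler
  kahler_closed : HasExtDeriv 𝓘(ℝ, E) kahler 0
  kahler_invariant : ∀ (x : X) (u v : TangentSpace 𝓘(ℝ, E) x),
    kahler x ![complexStructure E x u, complexStructure E x v] = kahler x ![u, v]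
  kahler_pos : ∀ (x : X) (v : TangentSpace 𝓘(ℝ, E) x), v ≠ 0 →
    0 < kahler x ![v, complexStructure E x v]
  vol_holomorphic : IsSmoothForm 𝓘(ℂ, E) ω vol
  vol_length : ∀ (x : X) (v : Fin (2 * n) → E),
    (-1 : ℂ) ^ (n * (n - 1) / 2) * (Complex.I / 2) ^ n *
        wedge (fun w : Fin n → E => vol x w) (fun w : Fin n → E => starRingEnd ℂ (vol x w))
          (fun i => v (Fin.cast (two_mul n).symm i)) =
      (n.factorial : ℂ)⁻¹ * wedgePow (fun w : Fin 2 → E => ((kahler x w : ℝ) : ℂ)) n v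

end CY

/-! ### Special Lagrangian immersions with boundary conditions and their moduli space -/

section Moduli

variable {m d : ℕ} {E : Type*} [NormedAddCommGroup E] [NormedSpace ℂ E]
  {X : Type*} [TopologicalSpace X] [ChartedSpace E X]
  {L : Type*} [TopologicalSpace L] [ChartedSpace (EuclideanHalfSpace (m + 1)) L]
  {N : Fin d → Type*} [∀ i, TopologicalSpace (N i)]
  [∀ i, ChartedSpace (EuclideanSpace ℝ (Fin (m + 1))) (N i)]

/-- `C₁, …, C_d` is an ordering without repetition of the connected components of `∂L`. -/
def IsBoundaryOrdering (m : ℕ) {L : Type*} [TopologicalSpace L]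
    [ChartedSpace (EuclideanHalfSpace (m + 1)) L] (C : Fin d → Set L) : Prop :=
  Function.Injective C ∧
    Set.range C = {S | ∃ x ∈ (𝓡∂ (m + 1)).boundary L,
      S = connectedComponentIn ((𝓡∂ (m + 1)).boundary L) x}

/-- The map `j : N → X` parametrizes an embedded Lagrangian submanifold `j(N)` of `X`. -/
def IsEmbeddedLagrangian (Y : CalabiYau E (m + 1) X) {N : Type*} [TopologicalSpace N]
    [ChartedSpace (EuclideanSpace ℝ (Fin (m + 1))) N] (j : N → X) : Prop :=
  IsSmoothImmersion (𝓡 (m + 1)) 𝓘(ℝ, E) j ∧ Topology.IsEmbedding j ∧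
    pullback (𝓡 (m + 1)) 𝓘(ℝ, E) j Y.kahler = 0

/-- Membership in `Diff(L)`: a diffeomorphism mapping each boundary component into itself. -/
def PreservesBoundaryComponents (ψ : L ≃ₘ^∞⟮𝓡∂ (m + 1), 𝓡∂ (m + 1)⟯ L) : Prop :=
  ∀ x ∈ (𝓡∂ (m + 1)).boundary L,
    Set.MapsTo ψ (connectedComponentIn ((𝓡∂ (m + 1)).boundary L) x)
      (connectedComponentIn ((𝓡∂ (m + 1)).boundary L) x)

theorem PreservesBoundaryComponents.symm [IsManifold (𝓡∂ (m + 1)) ∞ L]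
    {ψ : L ≃ₘ^∞⟮𝓡∂ (m + 1), 𝓡∂ (m + 1)⟯ L} (h : PreservesBoundaryComponents ψ) :
    PreservesBoundaryComponents ψ.symm := by
  intro x _ y hy
  have hyb : y ∈ (𝓡∂ (m + 1)).boundary L := connectedComponentIn_subset _ _ hy
  have hz : ψ.symm y ∈ (𝓡∂ (m + 1)).boundary L := by
    have := ψ.symm.image_boundary (I := 𝓡∂ (m + 1)) (I' := 𝓡∂ (m + 1)) (by simp)
    rw [← this]
    exact ⟨y, hyb, rfl⟩
  have h1 := h _ hz (mem_connectedComponentIn hz)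
  rw [ψ.apply_symm_apply] at h1
  rw [connectedComponentIn_eq hy, ← connectedComponentIn_eq h1]
  exact mem_connectedComponentIn hz

/-- A map `f` is free if only the identity of `Diff(L)` fixes it. -/
def IsFree (m : ℕ) {L : Type*} [TopologicalSpace L]
    [ChartedSpace (EuclideanHalfSpace (m + 1)) L] (f : L → X) : Prop :=
  ∀ ψ : L ≃ₘ^∞⟮𝓡∂ (m + 1), 𝓡∂ (m + 1)⟯ L,
    PreservesBoundaryComponents ψ → f ∘ ψ = f → ∀ x, ψ x = x

/-- The boundary condition `Λ₁, …, Λ_d`, `Λᵢ = jᵢ(Nᵢ)`: `f(Cᵢ) ⊆ Λᵢ`, and `df(T_p L)` is not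
contained in `T_{f(p)} Λᵢ` for `p ∈ Cᵢ`. -/
def HasBoundaryCondition (C : Fin d → Set L) (j : ∀ i, N i → X) (f : L → X) : Prop :=
  ∀ i, ∀ p ∈ C i, f p ∈ Set.range (j i) ∧
    ∀ q : N i, j i q = f p →
      ¬ (Set.range (fun v : EuclideanSpace ℝ (Fin (m + 1)) =>
            (mfderiv (𝓡∂ (m + 1)) 𝓘(ℝ, E) f p v : E)) ⊆
          Set.range (fun w : EuclideanSpace ℝ (Fin (m + 1)) =>
            (mfderiv (𝓡 (m + 1)) 𝓘(ℝ, E) (j i) q w : E)))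

/-- Free special Lagrangian immersions `f : L → X` with the boundary condition. -/
structure IsFreeSpecialLagrangian (Y : CalabiYau E (m + 1) X) (C : Fin d → Set L)
    (j : ∀ i, N i → X) (f : L → X) : Prop where
  immersion : IsSmoothImmersion (𝓡∂ (m + 1)) 𝓘(ℝ, E) f
  free : IsFree m f
  lagrangian : pullback (𝓡∂ (m + 1)) 𝓘(ℝ, E) f Y.kahler = 0
  special : pullback (𝓡∂ (m + 1)) 𝓘(ℝ, E) f (imForm E Y.vol) = 0
  boundary : HasBoundaryCondition (m := m) (E := E) C j f

variable [IsManifold (𝓡∂ (m + 1)) ∞ L]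

/-- The reparametrization relation: `g = f ∘ ψ` for some `ψ ∈ Diff(L)`. -/
def reparamSetoid (Y : CalabiYau E (m + 1) X) (C : Fin d → Set L) (j : ∀ i, N i → X) :
    Setoid {f : L → X // IsFreeSpecialLagrangian Y C j f} where
  r f g := ∃ ψ : L ≃ₘ^∞⟮𝓡∂ (m + 1), 𝓡∂ (m + 1)⟯ L,
    PreservesBoundaryComponents ψ ∧ g.1 = f.1 ∘ ψ
  iseqv :=
    { refl := fun f => ⟨Diffeomorph.refl _ L ∞, fun _ _ _ hy => hy, rfl⟩
      symm := by
        rintro f g ⟨ψ, hψ, h⟩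
        refine ⟨ψ.symm, hψ.symm, ?_⟩
        funext x
        rw [h]
        simp
      trans := by
        rintro f g k ⟨ψ, hψ, h⟩ ⟨χ, hχ, h'⟩
        refine ⟨χ.trans ψ, fun x hx y hy => hψ x hx (hχ x hx hy), ?_⟩
        rw [h', h]
        rfl }

/-- The moduli space of free immersed special Lagrangian submanifolds of type `L` with boundary
condition. -/
abbrev SLModuli (Y : CalabiYau E (m + 1) X) (C : Fin d → Set L) (j : ∀ i, N i → X) : Type _ :=
  Quotient (reparamSetoid Y C j)

/-- `f` is a smooth lifting over the parameter domain `S` of the map `Z` from `S` to the moduli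
space: `f` is smooth on `S × L`, and `f_y` represents `Z y` for each `y ∈ S`. Values of `Z` and `f`
at parameters outside `S` are irrelevant. -/
def IsSmoothLift {P : Type*} [NormedAddCommGroup P] [NormedSpace ℝ P] (S : Set P)
    {Y : CalabiYau E (m + 1) X} {C : Fin d → Set L} {j : ∀ i, N i → X}
    (Z : P → SLModuli Y C j) (f : P → L → X) : Prop :=
  ContMDiffOn (𝓘(ℝ, P).prod (𝓡∂ (m + 1))) 𝓘(ℝ, E) ∞ (fun z : P × L => f z.1 z.2)
      (S ×ˢ (Set.univ : Set L)) ∧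
    ∀ y ∈ S, ∃ h : IsFreeSpecialLagrangian Y C j (f y), Z y = Quotient.mk _ ⟨f y, h⟩

/-- A map from the parameter domain `S` to the moduli space is smooth if it has a smooth
lifting. -/
def IsSmoothMap {P : Type*} [NormedAddCommGroup P] [NormedSpace ℝ P] (S : Set P)
    {Y : CalabiYau E (m + 1) X} {C : Fin d → Set L} {j : ∀ i, N i → X}
    (Z : P → SLModuli Y C j) : Prop :=
  ∃ f : P → L → X, IsSmoothLift S Z f

/-- The paths `Z` and `Z'`, parametrized by `[0,1]`, are smoothly homotopic in the moduli space
with fixed end points. -/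
def SmoothHomotopicRelEnds {Y : CalabiYau E (m + 1) X} {C : Fin d → Set L} {j : ∀ i, N i → X}
    (Z Z' : ℝ → SLModuli Y C j) : Prop :=
  ∃ h : ℝ × ℝ → SLModuli Y C j,
    IsSmoothMap (Set.Icc (0 : ℝ) 1 ×ˢ Set.Icc (0 : ℝ) 1) h ∧
    (∀ t ∈ Set.Icc (0 : ℝ) 1, h (0, t) = Z t ∧ h (1, t) = Z' t) ∧
    (∀ u ∈ Set.Icc (0 : ℝ) 1, h (u, 0) = Z 0 ∧ h (u, 0) = Z' 0 ∧ h (u, 1) = Z 1 ∧ h (u, 1) = Z' 1)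

end Moduli

/-! ### The special Lagrangian flux -/

section Flux

variable {m : ℕ} {E : Type*} [NormedAddCommGroup E] [NormedSpace ℂ E]
  {X : Type*} [TopologicalSpace X] [ChartedSpace E X]
  {L : Type*} [TopologicalSpace L] [ChartedSpace (EuclideanHalfSpace (m + 1)) L]

/-- The velocity `(d f_t / dt)(x)`, one-sided at the ends of `[0,1]`. -/
def velocity (f : ℝ → L → X) (t : ℝ) (x : L) : E :=
  mfderivWithin 𝓘(ℝ, ℝ) 𝓘(ℝ, E) (fun s => f s x) (Set.Icc (0 : ℝ) 1) t (1 : ℝ)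

/-- The value at `x` of `φ_t = f_t^* (i_{d f_t / dt} Im Ω)`: the `(n-1)`-form
`(v₁, …, v_{n-1}) ↦ Im Ω (d f_t / dt, d f_t v₁, …, d f_t v_{n-1})`. -/
def fluxIntegrand (Y : CalabiYau E (m + 1) X) (f : ℝ → L → X) (t : ℝ) (x : L) :
    EuclideanSpace ℝ (Fin (m + 1)) [⋀^Fin m]→L[ℝ] ℝ :=
  (ContinuousAlternatingMap.curryLeft (E := E) (imForm E Y.vol (f t x))
      (velocity (E := E) f t x)).compContinuousLinearMap
    (mfderiv (𝓡∂ (m + 1)) 𝓘(ℝ, E) (f t) x)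

/-- The `(n-1)`-form `∫₀¹ f_t^* (i_{d f_t / dt} Im Ω) dt` on `L`. -/
def fluxForm (Y : CalabiYau E (m + 1) X) (f : ℝ → L → X) : DiffForm (𝓡∂ (m + 1)) L m ℝ :=
  fun x => (∫ t in (0 : ℝ)..1, fluxIntegrand Y f t x :
    EuclideanSpace ℝ (Fin (m + 1)) [⋀^Fin m]→L[ℝ] ℝ)

/-- The special Lagrangian flux `SF(f) ∈ H^{n-1}(L; ℝ)`, `n = m + 1`, of a path whose flux form is
closed. -/
def specialFlux (Y : CalabiYau E (m + 1) X) (f : ℝ → L → X)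
    (h : fluxForm Y f ∈ closedForms (𝓡∂ (m + 1)) L m) : DeRham (𝓡∂ (m + 1)) L m :=
  deRhamClass (𝓡∂ (m + 1)) L (fluxForm Y f) h

end Flux

end

end SLFlux

/-! Write α for Im Ω. Only three facts about α matter: it is smooth, it is closed, and it pulls back
to zero under every special Lagrangian immersion. Closedness holds because dΩ is a complex
alternating form of degree n + 1 on an n-dimensional complex space (`hasExtDeriv_imForm`).

Closed flux form. In a chart of L with target U, a lifting becomes a map F on [0,1] × U, and θ =
F^*α is closed and vanishes on every slice {t} × U. Evaluating dθ = 0 on ∂_t and vectors of U leaves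
only the exterior derivative along U of the contraction of θ with ∂_t. Hence each integrand is
closed, and differentiation under the integral sign does the rest (`pathForm_mem_closedForms`).

Homotopy invariance for maps. For a family over the square with coordinates (u,t), evaluating dθ = 0
on ∂_u, ∂_t and vectors of U gives ∂_u(i_t θ) - ∂_t(i_u θ) + d(i_t i_u θ) = 0. Integrated over the
square, this makes the flux forms of the edges u = 0 and u = 1 cohomologous once i_u θ vanishes at t
= 0 and t = 1. It does so if the family moves there by reparametrization only: the velocity is then
tangent to an image on which α vanishes (`pathForm_sub_mem_exactForms`). For n = 1 there are no
forms of degree n - 2, and the two flux functions agree outright.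

Passing to the moduli space. A lifting h of the homotopy agrees with the given data only up to
diffeomorphisms, chosen separately for each parameter. Freeness makes them unique. Uniqueness gives
continuity in the parameter: every ultrafilter limit of the diffeomorphisms is again in Diff(L) and
solves the same equation. Continuity gives smoothness, since an immersion has local smooth left
inverses (`IsSmoothFamily.contMDiffOn_diffeomorph`).

Conclusion. Choose χ_u with h(u,0) ∘ χ_u = f_0. The square h(u,t) ∘ χ_u has a constant edge t = 0
and an edge t = 1 that moves by reparametrization, so its vertical edges have equal flux. These
edges differ from f and from the second lifting by reparametrizations that start at the identity,
and such reparametrizations preserve the flux by one more square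
(`pathForm_comp_diffeo_sub_mem_exactForms`). -/

namespace SLFlux

noncomputable section

/-! ### Calculus in normed spaces -/

section AlternatingCalculus

variable {E F G : Type*} [NormedAddCommGroup E] [NormedSpace ℝ E] [NormedAddCommGroup F]
  [NormedSpace ℝ F] [NormedAddCommGroup G] [NormedSpace ℝ G] {k : ℕ}

/-- The projection of multilinear maps onto alternating maps. -/
def alternatingProjection :
    ContinuousMultilinearMap ℝ (fun _ : Fin k => E) G →L[ℝ] E [⋀^Fin k]→L[ℝ] G :=
  ContinuousAlternatingMap.liftCLM
    ((k.factorial : ℝ)⁻¹ • ∑ σ : Equiv.Perm (Fin k), (Equiv.Perm.sign σ : ℤ) •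
      ((ContinuousMultilinearMap.domDomCongrₗᵢ ℝ E G σ).toContinuousLinearEquiv :
        ContinuousMultilinearMap ℝ (fun _ : Fin k => E) G →L[ℝ] _))
    (by
      intro f v i j hv hij
      have h := (ContinuousMultilinearMap.alternatization f).map_eq_zero_of_eq v hv hij
      rw [ContinuousMultilinearMap.alternatization_apply_apply] at h
      simp only [smul_apply, sum_apply]
      exact (congrArg ((k.factorial : ℝ)⁻¹ • ·) h).trans (smul_zero _))

theorem alternatingProjection_toContinuousMultilinearMap (c : E [⋀^Fin k]→L[ℝ] G) :
    alternatingProjection c.toContinuousMultilinearMap = c := by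
  ext v
  have h : ∀ σ : Equiv.Perm (Fin k), (Equiv.Perm.sign σ : ℤ) • c (v ∘ σ) = c v := by
    intro σ
    rw [show c (v ∘ σ) = Equiv.Perm.sign σ • c v from c.toAlternatingMap.map_perm v σ,
      ← Units.smul_def, smul_smul, Int.units_mul_self, one_smul]
  have : alternatingProjection c.toContinuousMultilinearMap v =
      (k.factorial : ℝ)⁻¹ • ∑ σ : Equiv.Perm (Fin k), (Equiv.Perm.sign σ : ℤ) • c (v ∘ σ) := by
    simp only [alternatingProjection, ContinuousAlternatingMap.liftCLM_apply, smul_apply,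
      sum_apply]
    rfl
  rw [this, Finset.sum_congr rfl fun σ _ => h σ, Finset.sum_const, Finset.card_univ,
    Fintype.card_perm, Fintype.card_fin, ← Nat.cast_smul_eq_nsmul ℝ, smul_smul,
    inv_mul_cancel₀ (by exact_mod_cast k.factorial_ne_zero), one_smul]

/-- Pullback is polynomial in the linear map and linear in the form, which gives smoothness into
multilinear maps. Projecting onto alternating maps changes nothing and gives the right target. -/
theorem contDiff_compContinuousLinearMap {n : WithTop ℕ∞} :
    ContDiff ℝ n (fun p : (F [⋀^Fin k]→L[ℝ] G) × (E →L[ℝ] F) =>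
      p.1.compContinuousLinearMap p.2) := by
  have h : ContDiff ℝ n (fun p : (F [⋀^Fin k]→L[ℝ] G) × (E →L[ℝ] F) =>
      ContinuousMultilinearMap.compContinuousLinearMapContinuousMultilinear ℝ
        (fun _ : Fin k => E) (fun _ => F) G (fun _ => p.2)
        (ContinuousAlternatingMap.toContinuousMultilinearMapCLM ℝ p.1)) :=
    ((ContinuousMultilinearMap.contDiff _).comp (contDiff_pi.2 fun _ => contDiff_snd)).clm_apply
      ((ContinuousLinearMap.contDiff _).comp contDiff_fst)
  convert (alternatingProjection (E := E) (G := G) (k := k)).contDiff.comp h using 2 with p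
  exact (alternatingProjection_toContinuousMultilinearMap (p.1.compContinuousLinearMap p.2)).symm

end AlternatingCalculus

/-! ### Differentiation under the integral sign on domains with corners. -/

section ParametricIntegral

/-- Each point of `s` has a convex neighbourhood within `s`. -/
def LocallyConvexSet {W : Type*} [NormedAddCommGroup W] [NormedSpace ℝ W] (s : Set W) : Prop :=
  ∀ x ∈ s, ∃ u ∈ 𝓝[s] x, u ⊆ s ∧ Convex ℝ u

theorem LocallyConvexSet.prod {V W : Type*} [NormedAddCommGroup V] [NormedSpace ℝ V]
    [NormedAddCommGroup W] [NormedSpace ℝ W] {s : Set V} {t : Set W} (hs : LocallyConvexSet s)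
    (ht : LocallyConvexSet t) : LocallyConvexSet (s ×ˢ t) := by
  rintro ⟨x, y⟩ ⟨hx, hy⟩
  obtain ⟨u, hu, hus, hcu⟩ := hs x hx
  obtain ⟨v, hv, hvt, hcv⟩ := ht y hy
  refine ⟨u ×ˢ v, ?_, Set.prod_mono hus hvt, hcu.prod hcv⟩
  rw [nhdsWithin_prod_eq]
  exact Filter.prod_mem_prod hu hv

theorem Convex.locallyConvexSet {W : Type*} [NormedAddCommGroup W] [NormedSpace ℝ W] {s : Set W}
    (hs : Convex ℝ s) : LocallyConvexSet s :=
  fun _ _ => ⟨s, self_mem_nhdsWithin, subset_rfl, hs⟩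

/-- Compactness of [0,1] makes κ'(t,x) close to κ'(t,x₀) uniformly in t. The mean value inequality
on a convex neighbourhood within s then bounds the remainder uniformly in t, and this bound is
integrated. -/
theorem hasFDerivWithinAt_intervalIntegral {W G : Type*} [NormedAddCommGroup W] [NormedSpace ℝ W]
    [NormedAddCommGroup G] [NormedSpace ℝ G] [CompleteSpace G] {s : Set W}
    (hs : LocallyConvexSet s) {κ : ℝ × W → G} {κ' : ℝ × W → W →L[ℝ] G}
    (hκ : ContinuousOn κ (Set.Icc 0 1 ×ˢ s)) (hκ' : ContinuousOn κ' (Set.Icc 0 1 ×ˢ s))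
    (hd : ∀ t ∈ Set.Icc (0 : ℝ) 1, ∀ x ∈ s, HasFDerivWithinAt (fun y => κ (t, y)) (κ' (t, x)) s x)
    {x₀ : W} (hx₀ : x₀ ∈ s) :
    HasFDerivWithinAt (fun x => ∫ t in (0 : ℝ)..1, κ (t, x)) (∫ t in (0 : ℝ)..1, κ' (t, x₀))
      s x₀ := by
  have hslice : ∀ x ∈ s, ContinuousOn (fun t => κ (t, x)) (Set.uIcc 0 1) := fun x hx => by
    rw [Set.uIcc_of_le zero_le_one]
    exact hκ.comp (by fun_prop) fun t ht => ⟨ht, hx⟩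
  have hslice' : ContinuousOn (fun t => κ' (t, x₀)) (Set.uIcc 0 1) := by
    rw [Set.uIcc_of_le zero_le_one]
    exact hκ'.comp (by fun_prop) fun t ht => ⟨ht, hx₀⟩
  rw [hasFDerivWithinAt_iff_isLittleO, Asymptotics.isLittleO_iff]
  intro ε hε
  have hev : ∀ᶠ x in 𝓝 x₀, ∀ t ∈ Set.Icc (0 : ℝ) 1,
      x ∈ s → ‖κ' (t, x) - κ' (t, x₀)‖ ≤ ε := by
    have : ∀ᶠ x in 𝓝 x₀, ∀ t ∈ Set.Icc (0 : ℝ) 1,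
        t ∈ Set.Icc (0 : ℝ) 1 → x ∈ s → ‖κ' (t, x) - κ' (t, x₀)‖ ≤ ε := by
      refine isCompact_Icc.eventually_forall_of_forall_eventually fun t ht => ?_
      have h1 : ContinuousWithinAt (fun z : W × ℝ => κ' (z.2, z.1) - κ' (z.2, x₀))
          (s ×ˢ Set.Icc 0 1) (x₀, t) := by
        refine ContinuousWithinAt.sub ?_ ?_
        · exact (hκ' (t, x₀) ⟨ht, hx₀⟩).comp (t := Set.Icc 0 1 ×ˢ s)
            (f := fun z : W × ℝ => (z.2, z.1)) (x := (x₀, t))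
            (by fun_prop) fun z hz => ⟨hz.2, hz.1⟩
        · exact (hκ' (t, x₀) ⟨ht, hx₀⟩).comp (t := Set.Icc 0 1 ×ˢ s)
            (f := fun z : W × ℝ => (z.2, x₀)) (x := (x₀, t))
            (by fun_prop) fun z hz => ⟨hz.2, hx₀⟩
      have h2 := Filter.Tendsto.eventually_le_const (u := ε) (by simpa using hε) h1.norm
      rw [eventually_nhdsWithin_iff] at h2
      filter_upwards [h2] with z hz h3 h4 using hz ⟨h4, h3⟩
    filter_upwards [this] with x hx t ht using hx t ht ht
  obtain ⟨u, hu, hus, hcu⟩ := hs x₀ hx₀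
  obtain ⟨δ, hδ, hball⟩ := Metric.eventually_nhds_iff_ball.1 hev
  obtain ⟨δ', hδ', hball'⟩ := Metric.mem_nhdsWithin_iff.1 hu
  rw [eventually_nhdsWithin_iff]
  filter_upwards [Metric.ball_mem_nhds x₀ (lt_min hδ hδ')] with x hx hxs
  have hxu : x ∈ u := hball' ⟨Metric.ball_subset_ball (min_le_right _ _) hx, hxs⟩
  have hx₀u : x₀ ∈ u := mem_of_mem_nhdsWithin hx₀ hu
  have hbound : ∀ t ∈ Set.Icc (0 : ℝ) 1,
      ‖κ (t, x) - κ (t, x₀) - κ' (t, x₀) (x - x₀)‖ ≤ ε * ‖x - x₀‖ := by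
    intro t ht
    refine (hcu.inter (convex_ball x₀ δ)).norm_image_sub_le_of_norm_hasFDerivWithin_le'
      (f := fun y => κ (t, y)) (f' := fun y => κ' (t, y)) (φ := κ' (t, x₀))
      (fun y hy => (hd t ht y (hus hy.1)).mono fun z hz => hus hz.1)
      (fun y hy => hball y hy.2 t ht (hus hy.1)) ⟨hx₀u, Metric.mem_ball_self hδ⟩
      ⟨hxu, Metric.ball_subset_ball (min_le_left _ _) hx⟩
  have i1 := (hslice x hxs).intervalIntegrable (μ := MeasureTheory.volume)
  have i2 := (hslice x₀ hx₀).intervalIntegrable (μ := MeasureTheory.volume)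
  have i3 := hslice'.intervalIntegrable (μ := MeasureTheory.volume)
  have i4 : IntervalIntegrable (fun t => κ' (t, x₀) (x - x₀)) MeasureTheory.volume 0 1 :=
    (hslice'.clm_apply continuousOn_const).intervalIntegrable
  rw [ContinuousLinearMap.intervalIntegral_apply i3, ← intervalIntegral.integral_sub i1 i2,
    ← intervalIntegral.integral_sub (i1.sub i2) i4]
  refine (intervalIntegral.norm_integral_le_of_norm_le_const
    (C := ε * ‖x - x₀‖) fun t ht => ?_).trans_eq (by simp)
  rw [Set.uIoc_of_le zero_le_one] at ht
  exact hbound t ⟨ht.1.le, ht.2⟩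

universe u

variable {W G : Type u} [NormedAddCommGroup W] [NormedSpace ℝ W]
    [NormedAddCommGroup G] [NormedSpace ℝ G]

theorem hasFDerivWithinAt_slice {s : Set W} {κ : ℝ × W → G}
    (hκ : DifferentiableOn ℝ κ (Set.Icc 0 1 ×ˢ s)) {t : ℝ} (ht : t ∈ Set.Icc (0 : ℝ) 1)
    {x : W} (hx : x ∈ s) :
    HasFDerivWithinAt (fun y => κ (t, y))
      ((fderivWithin ℝ κ (Set.Icc 0 1 ×ˢ s) (t, x)).comp (ContinuousLinearMap.inr ℝ ℝ W)) s x := by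
  exact (hκ (t, x) ⟨ht, hx⟩).hasFDerivWithinAt.comp x
    (hasFDerivAt_prodMk_right t x).hasFDerivWithinAt fun y hy => ⟨ht, hy⟩

theorem hasFDerivWithinAt_intervalIntegral_of_contDiffOn [CompleteSpace G] {s : Set W}
    (hs : LocallyConvexSet s) (hu : UniqueDiffOn ℝ s) {κ : ℝ × W → G}
    (hκ : ContDiffOn ℝ 1 κ (Set.Icc 0 1 ×ˢ s)) {x : W} (hx : x ∈ s) :
    HasFDerivWithinAt (fun x => ∫ t in (0 : ℝ)..1, κ (t, x))
      (∫ t in (0 : ℝ)..1, (fderivWithin ℝ κ (Set.Icc 0 1 ×ˢ s) (t, x)).comp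
        (ContinuousLinearMap.inr ℝ ℝ W)) s x := by
  have hU : UniqueDiffOn ℝ (Set.Icc (0 : ℝ) 1 ×ˢ s) := (uniqueDiffOn_Icc zero_lt_one).prod hu
  refine hasFDerivWithinAt_intervalIntegral hs
    (κ' := fun z => (fderivWithin ℝ κ (Set.Icc 0 1 ×ˢ s) z).comp (ContinuousLinearMap.inr ℝ ℝ W))
    hκ.continuousOn ?_ (fun t ht y hy => hasFDerivWithinAt_slice (hκ.differentiableOn (by simp))
      ht hy) hx
  exact (hκ.continuousOn_fderivWithin hU (by simp)).clm_comp continuousOn_const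

/-- One derivative is given away, which is harmless for smooth integrands and keeps the induction
short. The induction replaces `G` by `W →L[ℝ] G`, so `G` is generalized and shares a universe with
`W`. -/
theorem contDiffOn_intervalIntegral_nat {s : Set W} (hs : LocallyConvexSet s)
    (hu : UniqueDiffOn ℝ s) (n : ℕ) : ∀ {G : Type u} [NormedAddCommGroup G] [NormedSpace ℝ G]
    [CompleteSpace G] {κ : ℝ × W → G}, ContDiffOn ℝ (n + 1) κ (Set.Icc 0 1 ×ˢ s) →
    ContDiffOn ℝ n (fun x => ∫ t in (0 : ℝ)..1, κ (t, x)) s := by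
  have hU : UniqueDiffOn ℝ (Set.Icc (0 : ℝ) 1 ×ˢ s) := (uniqueDiffOn_Icc zero_lt_one).prod hu
  induction n with
  | zero =>
    intro G _ _ _ κ hκ
    rw [Nat.cast_zero, contDiffOn_zero]
    intro x hx
    exact (hasFDerivWithinAt_intervalIntegral_of_contDiffOn hs hu
      (hκ.of_le (by simp)) hx).continuousWithinAt
  | succ n ih =>
    intro G _ _ _ κ hκ
    have hd : ∀ x ∈ s, _ := fun x hx => hasFDerivWithinAt_intervalIntegral_of_contDiffOn hs hu
      (hκ.of_le (by simp)) hx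
    rw [Nat.cast_add, Nat.cast_one, contDiffOn_succ_iff_fderivWithin hu]
    refine ⟨fun x hx => (hd x hx).differentiableWithinAt, by simp, ?_⟩
    refine ContDiffOn.congr (ih (κ := fun z => (fderivWithin ℝ κ (Set.Icc 0 1 ×ˢ s) z).comp
      (ContinuousLinearMap.inr ℝ ℝ W)) ?_) fun x hx => (hd x hx).fderivWithin (hu x hx)
    exact (hκ.fderivWithin hU (by norm_cast)).clm_comp contDiffOn_const

theorem contDiffOn_intervalIntegral [CompleteSpace G] {s : Set W} (hs : LocallyConvexSet s)
    (hu : UniqueDiffOn ℝ s) {κ : ℝ × W → G} (hκ : ContDiffOn ℝ ∞ κ (Set.Icc 0 1 ×ˢ s)) :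
    ContDiffOn ℝ ∞ (fun x => ∫ t in (0 : ℝ)..1, κ (t, x)) s :=
  contDiffOn_infty.2 fun n => contDiffOn_intervalIntegral_nat hs hu n
    (hκ.of_le (by exact_mod_cast le_top))

end ParametricIntegral

/-! ### Regularity of maps into the source of an immersion. -/

section Immersion

variable {Q R E : Type*} [NormedAddCommGroup Q] [NormedSpace ℝ Q] [NormedAddCommGroup R]
  [NormedSpace ℝ R] [FiniteDimensional ℝ R] [NormedAddCommGroup E] [NormedSpace ℝ E]
  [FiniteDimensional ℝ E]

/-- A continuous map whose composition with an immersion is smooth is smooth. -/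
theorem contDiffWithinAt_of_immersion_comp {F : R → E} {T : Set R} {Ψ : Q → R} {D : Set Q}
    {q₀ : Q} (hT : UniqueDiffOn ℝ T) (hD : UniqueDiffOn ℝ D) (hF : ContDiffOn ℝ ∞ F T)
    (hFΨ : ContDiffOn ℝ ∞ (F ∘ Ψ) D) (hΨ : ContinuousOn Ψ D) (hmaps : Set.MapsTo Ψ D T)
    (hq₀ : q₀ ∈ D) (hinj : Function.Injective (fderivWithin ℝ F T (Ψ q₀))) :
    ContDiffWithinAt ℝ ∞ Ψ D q₀ := by
  -- Composing F with a left inverse of its derivative at Ψ(q₀) gives a map from R to itself with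
  -- derivative the identity there. Its derivative A along Ψ stays invertible near q₀, and the chain
  -- rule can be solved for dΨ without an inverse function theorem at corners.
  obtain ⟨B, hB⟩ := LinearMap.exists_leftInverse_of_injective
    (fderivWithin ℝ F T (Ψ q₀) : R →ₗ[ℝ] E) (LinearMap.ker_eq_bot.2 hinj)
  set B' : E →L[ℝ] R := LinearMap.toContinuousLinearMap B
  have hF₁ : ContDiffOn ℝ ∞ (B' ∘ F) T := B'.contDiff.comp_contDiffOn hF
  have hG₁ : ContDiffOn ℝ ∞ ((B' ∘ F) ∘ Ψ) D := B'.contDiff.comp_contDiffOn hFΨ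
  set A : Q → R →L[ℝ] R := fun q => fderivWithin ℝ (B' ∘ F) T (Ψ q) with hA
  have hA₀ : A q₀ = ContinuousLinearMap.id ℝ R := by
    have h1 : HasFDerivWithinAt (B' ∘ F) (B'.comp (fderivWithin ℝ F T (Ψ q₀))) T (Ψ q₀) :=
      B'.hasFDerivAt.comp_hasFDerivWithinAt _
        ((hF.differentiableOn (by simp)) _ (hmaps hq₀)).hasFDerivWithinAt
    refine (h1.fderivWithin (hT _ (hmaps hq₀))).trans ?_
    ext v
    exact LinearMap.congr_fun hB v
  have hAc : ContinuousOn A D :=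
    (hF₁.continuousOn_fderivWithin hT (by simp)).comp hΨ hmaps
  have hopen : IsOpen {L : R →L[ℝ] R | L.IsInvertible} := by
    convert ContinuousLinearEquiv.isOpen (𝕜 := ℝ) (E := R) (F := R) using 1
    ext L
    rfl
  obtain ⟨o, ho, hoD⟩ := continuousOn_iff'.1 hAc _ hopen
  have hmem : ∀ q, q ∈ D ∩ o → (A q).IsInvertible := fun q hq => by
    have : q ∈ A ⁻¹' {L : R →L[ℝ] R | L.IsInvertible} ∩ D := hoD ▸ ⟨hq.2, hq.1⟩
    exact this.1
  have hq₀o : q₀ ∈ o := by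
    have : q₀ ∈ A ⁻¹' {L : R →L[ℝ] R | L.IsInvertible} ∩ D :=
      ⟨by rw [Set.mem_preimage, hA₀]; exact ⟨ContinuousLinearEquiv.refl ℝ R, rfl⟩, hq₀⟩
    exact (hoD ▸ this : q₀ ∈ o ∩ D).1
  have hD' : UniqueDiffOn ℝ (D ∩ o) := hD.inter ho
  have hG₂ : ContDiffOn ℝ ∞ ((B' ∘ F) ∘ Ψ) (D ∩ o) := hG₁.mono Set.inter_subset_left
  have hder : ∀ q ∈ D ∩ o, HasFDerivWithinAt Ψ ((A q).inverse.comp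
      (fderivWithin ℝ ((B' ∘ F) ∘ Ψ) (D ∩ o) q)) (D ∩ o) q := by
    intro q hq
    refine HasFDerivWithinAt.of_comp_of_leftInverse (f := B' ∘ F) (f' := A q) (t := T) ?_
      ((hF₁.differentiableOn (by simp)) _ (hmaps hq.1)).hasFDerivWithinAt
      ((hG₂.differentiableOn (by simp)) q hq).hasFDerivWithinAt Filter.EventuallyEq.rfl ?_ hq
    · exact tendsto_nhdsWithin_iff.2 ⟨(hΨ q hq.1).mono Set.inter_subset_left,
        eventually_nhdsWithin_of_forall fun x hx => hmaps hx.1⟩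
    · obtain ⟨e, he⟩ := hmem q hq
      intro v
      rw [← he, ContinuousLinearMap.inverse_equiv]
      simp
  -- Bootstrapping: in dΨ = A⁻¹ ∘ d(B' ∘ F ∘ Ψ), the factor A is as regular as Ψ and the other
  -- factor is smooth, so each pass gains one derivative.
  have key : ∀ n : ℕ, ContDiffOn ℝ n Ψ (D ∩ o) := by
    intro n
    induction n with
    | zero => exact contDiffOn_zero.2 (hΨ.mono Set.inter_subset_left)
    | succ n ih =>
      rw [Nat.cast_add, Nat.cast_one, contDiffOn_succ_iff_fderivWithin hD']
      refine ⟨fun q hq => (hder q hq).differentiableWithinAt, by simp, ?_⟩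
      refine ContDiffOn.congr ?_ fun q hq => (hder q hq).fderivWithin (hD' q hq)
      refine ContDiffOn.clm_comp ?_ (hG₂.fderivWithin hD' (by exact_mod_cast le_top))
      have hAn : ContDiffOn ℝ n A (D ∩ o) :=
        (hF₁.fderivWithin (m := n) hT (by exact_mod_cast le_top)).comp ih
          fun q hq => hmaps hq.1
      intro q hq
      exact (hmem q hq).contDiffAt_map_inverse.comp_contDiffWithinAt q (hAn q hq)
  have := contDiffOn_infty.2 key q₀ ⟨hq₀, hq₀o⟩
  exact (contDiffWithinAt_inter (ho.mem_nhds hq₀o)).1 this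

end Immersion

/-! ### Closed forms on products of vector spaces -/

section Contraction

open ContinuousAlternatingMap

variable {P V : Type*} [NormedAddCommGroup P] [NormedSpace ℝ P] [NormedAddCommGroup V]
  [NormedSpace ℝ V] {k : ℕ}

/-- Contraction with a vector of the first factor, followed by restriction to the second factor. -/
def contractInr (a : P) :
    ((P × V) [⋀^Fin (k + 1)]→L[ℝ] ℝ) →L[ℝ] V [⋀^Fin k]→L[ℝ] ℝ :=
  (compContinuousLinearMapCLM (ContinuousLinearMap.inr ℝ P V)).comp
    ((ContinuousLinearMap.apply ℝ ((P × V) [⋀^Fin k]→L[ℝ] ℝ) ((a, 0) : P × V)).comp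
      (curryLeftLI (𝕜 := ℝ) (E := P × V) (F := ℝ) (n := k)).toContinuousLinearMap)

/-- Contraction with two vectors of the first factor, followed by restriction to the second
factor. -/
def contractInr₂ (a b : P) :
    ((P × V) [⋀^Fin (k + 2)]→L[ℝ] ℝ) →L[ℝ] V [⋀^Fin k]→L[ℝ] ℝ :=
  (contractInr b).comp
    ((ContinuousLinearMap.apply ℝ ((P × V) [⋀^Fin (k + 1)]→L[ℝ] ℝ) ((a, 0) : P × V)).comp
      (curryLeftLI (𝕜 := ℝ) (E := P × V) (F := ℝ) (n := k + 1)).toContinuousLinearMap)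

theorem removeNth_succ_vecCons {W : Type*} {n : ℕ} (a : W) (w : Fin (n + 1) → W)
    (i : Fin (n + 1)) :
    i.succ.removeNth (Matrix.vecCons a w) = Matrix.vecCons a (i.removeNth w) := by
  funext l
  refine Fin.cases ?_ (fun l => ?_) l
  · simp [Fin.removeNth]
  · simp [Fin.removeNth]

theorem removeNth_zero_vecCons {W : Type*} {n : ℕ} (a : W) (w : Fin n → W) :
    (0 : Fin (n + 1)).removeNth (Matrix.vecCons a w) = w := by
  funext l
  simp [Fin.removeNth]

variable {T : (P × V) →L[ℝ] (P × V) [⋀^Fin (k + 1)]→L[ℝ] ℝ}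

/-- Here T plays the derivative of a form θ and `hT` says dθ = 0. In dθ(a, v₀, …, v_k) the term
differentiating along a vanishes by `ha`; the others sum to minus the exterior derivative along V of
the contraction with a. -/
theorem alternatizeUncurryFin_contractInr (hT : alternatizeUncurryFin T = 0) (a : P)
    (ha : (T (a, 0)).compContinuousLinearMap (ContinuousLinearMap.inr ℝ P V) = 0) :
    alternatizeUncurryFin (((contractInr a).comp T).comp (ContinuousLinearMap.inr ℝ P V)) = 0 := by
  ext v
  have h : alternatizeUncurryFin T (Matrix.vecCons (a, 0) fun i => ((0, v i) : P × V)) = 0 := by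
    rw [hT]
    rfl
  rw [alternatizeUncurryFin_apply, Fin.sum_univ_succ] at h
  have h0 : T (a, 0) (fun i => ((0, v i) : P × V)) = 0 := DFunLike.congr_fun ha v
  simp only [Fin.val_zero, pow_zero, one_smul, Matrix.cons_val_zero, removeNth_zero_vecCons,
    Fin.val_succ, Matrix.cons_val_succ, removeNth_succ_vecCons, h0, zero_add] at h
  refine Eq.trans ?_ (neg_eq_zero.2 h)
  rw [alternatizeUncurryFin_apply, ← Finset.sum_neg_distrib]
  refine Finset.sum_congr rfl fun i _ => ?_
  rw [pow_succ, mul_neg_one, neg_smul, neg_neg]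
  rfl

/-- This is dθ(a, b, v₀, …) = 0 with the derivatives along a, along b, and along the vᵢ collected
separately. The sign of the last group is positive because vᵢ sits two places further along. -/
theorem contractInr_sub_add_alternatizeUncurryFin
    {T : (P × V) →L[ℝ] (P × V) [⋀^Fin (k + 2)]→L[ℝ] ℝ} (hT : alternatizeUncurryFin T = 0)
    (a b : P) :
    contractInr b (T (a, 0)) - contractInr a (T (b, 0)) +
      alternatizeUncurryFin (((contractInr₂ a b).comp T).comp (ContinuousLinearMap.inr ℝ P V))
        = 0 := by
  ext v
  have h : alternatizeUncurryFin T
      (Matrix.vecCons (a, 0) (Matrix.vecCons (b, 0) fun i => ((0, v i) : P × V))) = 0 := by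
    rw [hT]
    rfl
  rw [alternatizeUncurryFin_apply, Fin.sum_univ_succ, Fin.sum_univ_succ] at h
  simp only [Fin.val_zero, pow_zero, one_smul, Matrix.cons_val_zero, removeNth_zero_vecCons,
    Fin.val_succ, Matrix.cons_val_succ, removeNth_succ_vecCons, zero_add, pow_one,
    neg_smul] at h
  refine Eq.trans ?_ h
  rw [ContinuousAlternatingMap.add_apply, ContinuousAlternatingMap.sub_apply,
    alternatizeUncurryFin_apply, sub_eq_add_neg, add_assoc]
  refine congrArg₂ (· + ·) rfl (congrArg₂ (· + ·) rfl (Finset.sum_congr rfl fun i _ => ?_))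
  rw [pow_succ, pow_succ, mul_assoc, neg_one_mul, neg_neg, mul_one]
  rfl

/-- The analogue for 1-forms, where no slot is left for a double contraction and the last group of
terms is absent. -/
theorem contractInr_comm_of_alternatizeUncurryFin_eq_zero
    {T : (P × V) →L[ℝ] (P × V) [⋀^Fin 1]→L[ℝ] ℝ} (hT : alternatizeUncurryFin T = 0)
    (a b : P) : contractInr b (T (a, 0)) = contractInr a (T (b, 0)) := by
  ext v
  have h : alternatizeUncurryFin T
      (Matrix.vecCons (a, 0) (Matrix.vecCons (b, 0) fun i => ((0, v i) : P × V))) = 0 := by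
    rw [hT]
    rfl
  rw [alternatizeUncurryFin_apply, Fin.sum_univ_succ, Fin.sum_univ_succ] at h
  simp only [Fin.val_zero, pow_zero, one_smul, Matrix.cons_val_zero, removeNth_zero_vecCons,
    Fin.val_succ, Matrix.cons_val_succ, removeNth_succ_vecCons, zero_add, pow_one,
    neg_smul, Finset.univ_eq_empty, Finset.sum_empty, add_zero] at h
  exact eq_of_sub_eq_zero (by rw [sub_eq_add_neg]; exact h)

end Contraction

section Integrals

open ContinuousAlternatingMap

theorem integral_eq_sub_of_hasDerivWithinAt_Icc {G : Type*} [NormedAddCommGroup G]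
    [NormedSpace ℝ G] [CompleteSpace G] {f f' : ℝ → G}
    (hf : ∀ t ∈ Set.Icc (0 : ℝ) 1, HasDerivWithinAt f (f' t) (Set.Icc 0 1) t)
    (hf' : ContinuousOn f' (Set.Icc 0 1)) : ∫ t in (0 : ℝ)..1, f' t = f 1 - f 0 := by
  refine intervalIntegral.integral_eq_sub_of_hasDerivAt_of_le zero_le_one
    (fun t ht => (hf t ht).continuousWithinAt)
    (fun t ht => (hf t (Set.Ioo_subset_Icc_self ht)).hasDerivAt (Icc_mem_nhds ht.1 ht.2)) ?_
  exact ContinuousOn.intervalIntegrable (by rwa [Set.uIcc_of_le zero_le_one])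

variable {V : Type} [NormedAddCommGroup V] [NormedSpace ℝ V] {U : Set V} {k : ℕ}

/-- Stated for a continuous linear function `A` of the derivative because the exterior derivative is
one, namely alternation. -/
theorem map_fderivWithin_intervalIntegral {G H : Type} [NormedAddCommGroup G] [NormedSpace ℝ G]
    [CompleteSpace G] [NormedAddCommGroup H] [NormedSpace ℝ H] [CompleteSpace H]
    (hc : LocallyConvexSet U) (hU : UniqueDiffOn ℝ U)
    {κ : ℝ × V → G} (hκ : ContDiffOn ℝ ∞ κ (Set.Icc 0 1 ×ˢ U)) (A : (V →L[ℝ] G) →L[ℝ] H) {y : V}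
    (hy : y ∈ U) :
    A (fderivWithin ℝ (fun y => ∫ t in (0 : ℝ)..1, κ (t, y)) U y) =
      ∫ t in (0 : ℝ)..1, A (fderivWithin ℝ (fun y => κ (t, y)) U y) := by
  have hU' : UniqueDiffOn ℝ (Set.Icc (0 : ℝ) 1 ×ˢ U) := (uniqueDiffOn_Icc zero_lt_one).prod hU
  rw [(hasFDerivWithinAt_intervalIntegral_of_contDiffOn hc hU
    (hκ.of_le (by exact_mod_cast le_top)) hy).fderivWithin (hU y hy)]
  have hi : IntervalIntegrable (fun t => (fderivWithin ℝ κ (Set.Icc 0 1 ×ˢ U) (t, y)).comp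
        (ContinuousLinearMap.inr ℝ ℝ V)) MeasureTheory.volume 0 1 := by
    refine ContinuousOn.intervalIntegrable ?_
    rw [Set.uIcc_of_le zero_le_one]
    refine ContinuousOn.clm_comp ?_ continuousOn_const
    exact (hκ.continuousOn_fderivWithin hU' (by simp)).comp (by fun_prop) fun t ht => ⟨ht, hy⟩
  rw [← A.intervalIntegral_comp_comm hi]
  refine intervalIntegral.integral_congr fun t ht => ?_
  rw [Set.uIcc_of_le zero_le_one] at ht
  rw [(hasFDerivWithinAt_slice (hκ.differentiableOn (by simp)) ht hy).fderivWithin (hU y hy)]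

theorem extDerivWithin_intervalIntegral (hc : LocallyConvexSet U) (hU : UniqueDiffOn ℝ U)
    {κ : ℝ × V → V [⋀^Fin k]→L[ℝ] ℝ} (hκ : ContDiffOn ℝ ∞ κ (Set.Icc 0 1 ×ˢ U)) {y : V}
    (hy : y ∈ U) :
    extDerivWithin (fun y => ∫ t in (0 : ℝ)..1, κ (t, y)) U y =
      ∫ t in (0 : ℝ)..1, extDerivWithin (fun y => κ (t, y)) U y :=
  map_fderivWithin_intervalIntegral hc hU hκ (alternatizeUncurryFinCLM ℝ V ℝ (n := k)) hy

end Integrals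

/-! ### Closed forms over a parameter domain, contracted with a parameter direction. -/

section PathForms

open ContinuousAlternatingMap

variable {P : Type*} [NormedAddCommGroup P] [NormedSpace ℝ P] {S : Set P}
  {V : Type*} [NormedAddCommGroup V] [NormedSpace ℝ V] {U : Set V} {k : ℕ}

theorem fderivWithin_comp_slice {G : Type*} [NormedAddCommGroup G] [NormedSpace ℝ G]
    {H : Type*} [NormedAddCommGroup H] [NormedSpace ℝ H]
    (hU : UniqueDiffOn ℝ U) {θ : P × V → G} (hθ : DifferentiableOn ℝ θ (S ×ˢ U)) (A : G →L[ℝ] H)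
    {p : P} (hp : p ∈ S) {y : V} (hy : y ∈ U) :
    fderivWithin ℝ (fun y => A (θ (p, y))) U y =
      (A.comp (fderivWithin ℝ θ (S ×ˢ U) (p, y))).comp (ContinuousLinearMap.inr ℝ P V) := by
  have h := (hθ (p, y) ⟨hp, hy⟩).hasFDerivWithinAt.comp y
    (hasFDerivAt_prodMk_right p y).hasFDerivWithinAt
    (t := S ×ˢ U) (s := U) fun z hz => ⟨hp, hz⟩
  exact (A.hasFDerivAt.comp_hasFDerivWithinAt y h).fderivWithin (hU y hy)

/-- The restriction of θ to the slices is identically zero, so its derivative is zero in every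
direction, including those that change the slice. This supplies `ha` in
`alternatizeUncurryFin_contractInr`. -/
theorem compContinuousLinearMap_inr_fderivWithin (hS : UniqueDiffOn ℝ S) (hU : UniqueDiffOn ℝ U)
    {θ : P × V → (P × V) [⋀^Fin k]→L[ℝ] ℝ} (hθ : DifferentiableOn ℝ θ (S ×ˢ U))
    (h0 : ∀ z ∈ S ×ˢ U, (θ z).compContinuousLinearMap (ContinuousLinearMap.inr ℝ P V) = 0)
    {z : P × V} (hz : z ∈ S ×ˢ U) (w : P × V) :
    (fderivWithin ℝ θ (S ×ˢ U) z w).compContinuousLinearMap (ContinuousLinearMap.inr ℝ P V)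
      = 0 := by
  set A : ((P × V) [⋀^Fin k]→L[ℝ] ℝ) →L[ℝ] (V [⋀^Fin k]→L[ℝ] ℝ) :=
    compContinuousLinearMapCLM (ContinuousLinearMap.inr ℝ P V)
  have h1 : HasFDerivWithinAt (fun z => A (θ z)) (A.comp (fderivWithin ℝ θ (S ×ˢ U) z))
      (S ×ˢ U) z := A.hasFDerivAt.comp_hasFDerivWithinAt z (hθ z hz).hasFDerivWithinAt
  have h2 : HasFDerivWithinAt (fun z => A (θ z)) (0 : (P × V) →L[ℝ] (V [⋀^Fin k]→L[ℝ] ℝ))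
      (S ×ˢ U) z := (hasFDerivWithinAt_const 0 z _).congr (fun z hz => h0 z hz) (h0 z hz)
  exact DFunLike.congr_fun ((hS.prod hU z hz).eq h1 h2) w

theorem extDerivWithin_contractInr (hS : UniqueDiffOn ℝ S) (hU : UniqueDiffOn ℝ U)
    {θ : P × V → (P × V) [⋀^Fin (k + 1)]→L[ℝ] ℝ} (hθ : DifferentiableOn ℝ θ (S ×ˢ U))
    (hd : ∀ z ∈ S ×ˢ U, extDerivWithin θ (S ×ˢ U) z = 0)
    (h0 : ∀ z ∈ S ×ˢ U, (θ z).compContinuousLinearMap (ContinuousLinearMap.inr ℝ P V) = 0)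
    (a : P) {p : P} (hp : p ∈ S) {y : V} (hy : y ∈ U) :
    extDerivWithin (fun y => contractInr a (θ (p, y))) U y = 0 := by
  rw [extDerivWithin, fderivWithin_comp_slice hU hθ _ hp hy]
  exact alternatizeUncurryFin_contractInr (hd (p, y) ⟨hp, hy⟩) a
    (compContinuousLinearMap_inr_fderivWithin hS hU hθ h0 ⟨hp, hy⟩ _)

end PathForms

/-! ### Closed forms over the unit square and the homotopy formula. -/

section SquareForms

open ContinuousAlternatingMap

variable {V : Type} [NormedAddCommGroup V] [NormedSpace ℝ V] {U : Set V} {k : ℕ}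

/-- The unit square. -/
abbrev unitSquare : Set (ℝ × ℝ) := Set.Icc (0 : ℝ) 1 ×ˢ Set.Icc (0 : ℝ) 1

theorem continuousOn_intervalIntegral_of_square {H : Type*} [NormedAddCommGroup H]
    [NormedSpace ℝ H] {g : ℝ × ℝ → H} (hg : ContinuousOn g unitSquare) :
    ContinuousOn (fun u => ∫ t in (0 : ℝ)..1, g (u, t)) (Set.Icc 0 1) := by
  -- Clamping both variables to [0,1] extends the integrand continuously to the plane without
  -- changing the integrals.
  set π : ℝ → ℝ := fun t => (Set.projIcc (0 : ℝ) 1 zero_le_one t : ℝ)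
  have hπ : Continuous π := continuous_subtype_val.comp continuous_projIcc
  have hπ' : ∀ t ∈ Set.Icc (0 : ℝ) 1, π t = t := fun t ht => by
    simp [π, Set.projIcc_of_mem zero_le_one ht]
  have hc : Continuous (Function.uncurry fun u t => g (π u, π t)) :=
    hg.comp_continuous (by fun_prop) fun z => ⟨Subtype.coe_prop _, Subtype.coe_prop _⟩
  refine (intervalIntegral.continuous_parametric_intervalIntegral_of_continuous'
    (μ := MeasureTheory.volume) hc 0 1).continuousOn.congr fun u hu => ?_
  refine intervalIntegral.integral_congr fun t ht => ?_
  rw [Set.uIcc_of_le zero_le_one] at ht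
  simp only [hπ' u hu, hπ' t ht]

theorem uniqueDiffOn_square : UniqueDiffOn ℝ unitSquare :=
  (uniqueDiffOn_Icc zero_lt_one).prod (uniqueDiffOn_Icc zero_lt_one)

/-- With Φ(u) = ∫ c₂ θ dt, the relation `hA` gives Φ' = ∫ (∂_t(c₁ θ) - A') dt. The first part
integrates to boundary values, zero by `he`; integrating Φ' over u finishes. Keeping `A'` abstract
covers both the case where it is an exterior derivative and the case of 1-forms, where it is zero.
-/
theorem intervalIntegral_contractInr_sub_eq {G H : Type*} [NormedAddCommGroup G] [NormedSpace ℝ G]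
    [NormedAddCommGroup H] [NormedSpace ℝ H] [CompleteSpace H]
    (hU : UniqueDiffOn ℝ U) {θ : (ℝ × ℝ) × V → G}
    (hθ : ContDiffOn ℝ ∞ θ (unitSquare ×ˢ U)) {y : V} (hy : y ∈ U) (c₁ c₂ : G →L[ℝ] H)
    (he : ∀ u ∈ Set.Icc (0 : ℝ) 1, ∀ t ∈ ({0, 1} : Set ℝ), c₁ (θ ((u, t), y)) = 0)
    {A' : ℝ → ℝ → H} (hA' : ∀ u ∈ Set.Icc (0 : ℝ) 1, ContinuousOn (A' u) (Set.Icc 0 1))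
    (hA : ∀ u ∈ Set.Icc (0 : ℝ) 1, ∀ t ∈ Set.Icc (0 : ℝ) 1,
      c₂ (fderivWithin ℝ θ (unitSquare ×ˢ U) ((u, t), y) ((1, 0), 0)) -
        c₁ (fderivWithin ℝ θ (unitSquare ×ˢ U) ((u, t), y) ((0, 1), 0)) + A' u t = 0) :
    ((∫ t in (0 : ℝ)..1, c₂ (θ ((1, t), y))) - ∫ t in (0 : ℝ)..1, c₂ (θ ((0, t), y))) =
      - ∫ u in (0 : ℝ)..1, ∫ t in (0 : ℝ)..1, A' u t := by
  have hD : UniqueDiffOn ℝ (unitSquare ×ˢ U) := uniqueDiffOn_square.prod hU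
  set T := fun u t => fderivWithin ℝ θ (unitSquare ×ˢ U) ((u, t), y) with hT
  have hTc : ContinuousOn (fun z : ℝ × ℝ => T z.1 z.2) unitSquare :=
    (hθ.continuousOn_fderivWithin hD (by simp)).comp (f := fun z : ℝ × ℝ => (z, y))
      (by fun_prop) fun z hz => ⟨hz, hy⟩
  have hTt : ∀ u ∈ Set.Icc (0 : ℝ) 1, ContinuousOn (T u) (Set.Icc 0 1) := fun u hu =>
    hTc.comp (f := fun t => (u, t)) (by fun_prop) fun t ht => ⟨hu, ht⟩
  have hdt : ∀ u ∈ Set.Icc (0 : ℝ) 1, ∀ t ∈ Set.Icc (0 : ℝ) 1,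
      HasDerivWithinAt (fun t => c₁ (θ ((u, t), y))) (c₁ (T u t ((0, 1), 0))) (Set.Icc 0 1) t := by
    intro u hu t ht
    have h1 : HasDerivWithinAt (fun t : ℝ => ((u, t), y)) (((0, 1), 0) : (ℝ × ℝ) × V)
        (Set.Icc 0 1) t :=
      (((hasDerivWithinAt_const t _ u).prodMk (hasDerivWithinAt_id t _)).prodMk
        (hasDerivWithinAt_const t _ y))
    have h2 := ((hθ.differentiableOn (by simp)) ((u, t), y) ⟨⟨hu, ht⟩, hy⟩).hasFDerivWithinAt
    have h3 : Set.MapsTo (fun t : ℝ => ((u, t), y)) (Set.Icc 0 1) (unitSquare ×ˢ U) :=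
      fun t ht => ⟨⟨hu, ht⟩, hy⟩
    exact c₁.hasFDerivAt.comp_hasDerivWithinAt t (h2.comp_hasDerivWithinAt t h1 h3)
  have hdu : ∀ t ∈ Set.Icc (0 : ℝ) 1, ∀ u ∈ Set.Icc (0 : ℝ) 1,
      HasDerivWithinAt (fun u => c₂ (θ ((u, t), y))) (c₂ (T u t ((1, 0), 0))) (Set.Icc 0 1) u := by
    intro t ht u hu
    have h1 : HasDerivWithinAt (fun u : ℝ => ((u, t), y)) (((1, 0), 0) : (ℝ × ℝ) × V)
        (Set.Icc 0 1) u :=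
      (((hasDerivWithinAt_id u _).prodMk (hasDerivWithinAt_const u _ t)).prodMk
        (hasDerivWithinAt_const u _ y))
    have h2 := ((hθ.differentiableOn (by simp)) ((u, t), y) ⟨⟨hu, ht⟩, hy⟩).hasFDerivWithinAt
    have h3 : Set.MapsTo (fun u : ℝ => ((u, t), y)) (Set.Icc 0 1) (unitSquare ×ˢ U) :=
      fun u hu => ⟨⟨hu, ht⟩, hy⟩
    exact c₂.hasFDerivAt.comp_hasDerivWithinAt u (h2.comp_hasDerivWithinAt u h1 h3)
  have hc₂ : ContinuousOn (fun z : ℝ × ℝ => c₂ (T z.1 z.2 ((1, 0), 0))) unitSquare :=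
    c₂.continuous.comp_continuousOn (hTc.clm_apply continuousOn_const)
  have hΦ : ∀ u ∈ Set.Icc (0 : ℝ) 1,
      HasDerivWithinAt (fun u => ∫ t in (0 : ℝ)..1, c₂ (θ ((u, t), y)))
        (- ∫ t in (0 : ℝ)..1, A' u t) (Set.Icc 0 1) u := by
    intro u hu
    have hswap : ContinuousOn (fun z : ℝ × ℝ => T z.2 z.1) unitSquare :=
      hTc.comp (f := fun z : ℝ × ℝ => (z.2, z.1)) (by fun_prop) fun z hz => ⟨hz.2, hz.1⟩
    have h1 := hasFDerivWithinAt_intervalIntegral (s := Set.Icc (0 : ℝ) 1)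
      (Convex.locallyConvexSet (convex_Icc (0 : ℝ) 1))
      (κ := fun z : ℝ × ℝ => c₂ (θ ((z.2, z.1), y)))
      (κ' := fun z : ℝ × ℝ => ContinuousLinearMap.toSpanSingleton ℝ (c₂ (T z.2 z.1 ((1, 0), 0))))
      (c₂.continuous.comp_continuousOn (hθ.continuousOn.comp (by fun_prop)
        fun z hz => ⟨⟨hz.2, hz.1⟩, hy⟩))
      ((ContinuousLinearMap.toSpanSingletonCLE (𝕜 := ℝ) (E := H)).continuous.comp_continuousOn
        (c₂.continuous.comp_continuousOn (hswap.clm_apply continuousOn_const)))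
      (fun t ht u hu => (hdu t ht u hu).hasFDerivWithinAt) hu
    have h2 := h1.hasDerivWithinAt
    refine h2.congr_deriv ?_
    rw [ContinuousLinearMap.intervalIntegral_apply]
    swap
    · refine ContinuousOn.intervalIntegrable ?_
      rw [Set.uIcc_of_le zero_le_one]
      exact (ContinuousLinearMap.toSpanSingletonCLE (𝕜 := ℝ) (E := H)).continuous.comp_continuousOn
        (c₂.continuous.comp_continuousOn ((hTt u hu).clm_apply continuousOn_const))
    have h3 : ∫ t in (0 : ℝ)..1, c₁ (T u t ((0, 1), 0)) = 0 := by
      rw [integral_eq_sub_of_hasDerivWithinAt_Icc (hdt u hu)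
        (c₁.continuous.comp_continuousOn ((hTt u hu).clm_apply continuousOn_const)),
        he u hu 1 (by simp), he u hu 0 (by simp), sub_zero]
    have i1 : IntervalIntegrable (fun t => c₁ (T u t ((0, 1), 0))) MeasureTheory.volume 0 1 := by
      refine ContinuousOn.intervalIntegrable ?_
      rw [Set.uIcc_of_le zero_le_one]
      exact c₁.continuous.comp_continuousOn ((hTt u hu).clm_apply continuousOn_const)
    have i2 : IntervalIntegrable (A' u) MeasureTheory.volume 0 1 := by
      refine ContinuousOn.intervalIntegrable ?_
      rw [Set.uIcc_of_le zero_le_one]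
      exact hA' u hu
    rw [← zero_sub, ← h3, ← intervalIntegral.integral_sub i1 i2]
    refine intervalIntegral.integral_congr fun t ht => ?_
    rw [Set.uIcc_of_le zero_le_one] at ht
    have := hA u hu t ht
    simp only [ContinuousLinearMap.toSpanSingleton_apply, one_smul]
    rw [eq_sub_iff_add_eq, ← sub_eq_zero, ← this]
    abel
  rw [← intervalIntegral.integral_neg]
  refine (integral_eq_sub_of_hasDerivWithinAt_Icc hΦ ?_).symm
  -- Continuity in u is needed for the outer integral, but `A'` is only assumed continuous in t. The
  -- relation `hA` rewrites it through the jointly continuous derivative T.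
  have hform : Set.EqOn (fun u => - ∫ t in (0 : ℝ)..1, A' u t)
      (fun u => ∫ t in (0 : ℝ)..1, c₂ (T u t ((1, 0), 0)) - c₁ (T u t ((0, 1), 0)))
      (Set.Icc 0 1) := by
    intro u hu
    simp only [← intervalIntegral.integral_neg]
    refine intervalIntegral.integral_congr fun t ht => ?_
    rw [Set.uIcc_of_le zero_le_one] at ht
    exact (eq_neg_of_add_eq_zero_left (hA u hu t ht)).symm
  refine ContinuousOn.congr ?_ hform
  have hcont : ContinuousOn (fun z : ℝ × ℝ => c₂ (T z.1 z.2 ((1, 0), 0)) -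
      c₁ (T z.1 z.2 ((0, 1), 0))) unitSquare :=
    hc₂.sub (c₁.continuous.comp_continuousOn (hTc.clm_apply continuousOn_const))
  exact continuousOn_intervalIntegral_of_square hcont

/-- The primitive obtained by integrating a form over the square. -/
def squarePrimitive (θ : (ℝ × ℝ) × V → ((ℝ × ℝ) × V) [⋀^Fin (k + 2)]→L[ℝ] ℝ) (y : V) :
    V [⋀^Fin k]→L[ℝ] ℝ :=
  ∫ u in (0 : ℝ)..1, ∫ t in (0 : ℝ)..1, contractInr₂ (1, 0) (0, 1) (θ ((u, t), y))

theorem contDiffOn_inner_integral {G : Type} [NormedAddCommGroup G] [NormedSpace ℝ G]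
    [CompleteSpace G] (hc : LocallyConvexSet U) (hU : UniqueDiffOn ℝ U) {A : (ℝ × ℝ) × V → G}
    (hA : ContDiffOn ℝ ∞ A (unitSquare ×ˢ U)) :
    ContDiffOn ℝ ∞ (fun z : ℝ × V => ∫ t in (0 : ℝ)..1, A ((z.1, t), z.2))
      (Set.Icc 0 1 ×ˢ U) :=
  contDiffOn_intervalIntegral
    ((Convex.locallyConvexSet (convex_Icc (0 : ℝ) 1)).prod hc)
    ((uniqueDiffOn_Icc zero_lt_one).prod hU)
    (κ := fun z : ℝ × (ℝ × V) => A ((z.2.1, z.1), z.2.2))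
    (hA.comp (f := fun z : ℝ × (ℝ × V) => ((z.2.1, z.1), z.2.2)) (by fun_prop)
      fun z hz => ⟨⟨hz.2.1, hz.1⟩, hz.2.2⟩)

theorem contDiffOn_squarePrimitive (hc : LocallyConvexSet U) (hU : UniqueDiffOn ℝ U)
    {θ : (ℝ × ℝ) × V → ((ℝ × ℝ) × V) [⋀^Fin (k + 2)]→L[ℝ] ℝ}
    (hθ : ContDiffOn ℝ ∞ θ (unitSquare ×ˢ U)) : ContDiffOn ℝ ∞ (squarePrimitive θ) U :=
  contDiffOn_intervalIntegral hc hU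
    (contDiffOn_inner_integral hc hU
      ((contractInr₂ (k := k) (V := V) ((1, 0) : ℝ × ℝ) (0, 1)).contDiff.comp_contDiffOn hθ))

theorem extDerivWithin_squarePrimitive (hc : LocallyConvexSet U) (hU : UniqueDiffOn ℝ U)
    {θ : (ℝ × ℝ) × V → ((ℝ × ℝ) × V) [⋀^Fin (k + 2)]→L[ℝ] ℝ}
    (hθ : ContDiffOn ℝ ∞ θ (unitSquare ×ˢ U))
    (hd : ∀ z ∈ unitSquare ×ˢ U, extDerivWithin θ (unitSquare ×ˢ U) z = 0) {y : V} (hy : y ∈ U)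
    (he : ∀ u ∈ Set.Icc (0 : ℝ) 1, ∀ t ∈ ({0, 1} : Set ℝ),
      contractInr (1, 0) (θ ((u, t), y)) = 0) :
    ((∫ t in (0 : ℝ)..1, contractInr (0, 1) (θ ((1, t), y))) -
        ∫ t in (0 : ℝ)..1, contractInr (0, 1) (θ ((0, t), y))) =
      - extDerivWithin (squarePrimitive θ) U y := by
  have hA := (contractInr₂ (k := k) (V := V) ((1, 0) : ℝ × ℝ) (0, 1)).contDiff.comp_contDiffOn hθ
  have hdiff := hθ.differentiableOn (by simp)
  have hslice : ∀ u ∈ Set.Icc (0 : ℝ) 1, ContDiffOn ℝ ∞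
      (fun z : ℝ × V => contractInr₂ (1, 0) (0, 1) (θ ((u, z.1), z.2))) (Set.Icc 0 1 ×ˢ U) :=
    fun u hu => hA.comp (f := fun z : ℝ × V => ((u, z.1), z.2)) (by fun_prop)
      fun z hz => ⟨⟨hu, hz.1⟩, hz.2⟩
  have h1 : extDerivWithin (squarePrimitive θ) U y = ∫ u in (0 : ℝ)..1, ∫ t in (0 : ℝ)..1,
      extDerivWithin (fun y => contractInr₂ (1, 0) (0, 1) (θ ((u, t), y))) U y := by
    refine (extDerivWithin_intervalIntegral hc hU
      (contDiffOn_inner_integral hc hU hA) hy).trans ?_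
    refine intervalIntegral.integral_congr fun u hu => ?_
    rw [Set.uIcc_of_le zero_le_one] at hu
    exact extDerivWithin_intervalIntegral hc hU (hslice u hu) hy
  have hext : ∀ u ∈ Set.Icc (0 : ℝ) 1, ∀ t ∈ Set.Icc (0 : ℝ) 1,
      extDerivWithin (fun y => contractInr₂ (1, 0) (0, 1) (θ ((u, t), y))) U y =
      alternatizeUncurryFin (((contractInr₂ (1, 0) (0, 1)).comp
        (fderivWithin ℝ θ (unitSquare ×ˢ U) ((u, t), y))).comp
          (ContinuousLinearMap.inr ℝ (ℝ × ℝ) V)) := fun u hu t ht => by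
    rw [extDerivWithin, fderivWithin_comp_slice hU hdiff _ ⟨hu, ht⟩ hy]
  rw [h1]
  refine intervalIntegral_contractInr_sub_eq hU hθ hy (contractInr (1, 0)) (contractInr (0, 1)) he
    (A' := fun u t => extDerivWithin (fun y => contractInr₂ (1, 0) (0, 1) (θ ((u, t), y))) U y)
    (fun u hu => ?_) fun u hu t ht => ?_
  · have hT : ContinuousOn (fun t => fderivWithin ℝ θ (unitSquare ×ˢ U) ((u, t), y))
        (Set.Icc 0 1) :=
      (hθ.continuousOn_fderivWithin (uniqueDiffOn_square.prod hU) (by simp)).comp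
        (f := fun t : ℝ => ((u, t), y)) (by fun_prop) fun t ht => ⟨⟨hu, ht⟩, hy⟩
    refine ContinuousOn.congr ?_ (hext u hu)
    exact (alternatizeUncurryFinCLM ℝ V ℝ (n := k)).continuous.comp_continuousOn
      ((continuousOn_const.clm_comp hT).clm_comp continuousOn_const)
  · rw [hext u hu t ht]
    exact contractInr_sub_add_alternatizeUncurryFin (hd _ ⟨⟨hu, ht⟩, hy⟩) (1, 0) (0, 1)

theorem intervalIntegral_contractInr_eq (hU : UniqueDiffOn ℝ U)
    {θ : (ℝ × ℝ) × V → ((ℝ × ℝ) × V) [⋀^Fin 1]→L[ℝ] ℝ}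
    (hθ : ContDiffOn ℝ ∞ θ (unitSquare ×ˢ U))
    (hd : ∀ z ∈ unitSquare ×ˢ U, extDerivWithin θ (unitSquare ×ˢ U) z = 0) {y : V} (hy : y ∈ U)
    (he : ∀ u ∈ Set.Icc (0 : ℝ) 1, ∀ t ∈ ({0, 1} : Set ℝ),
      contractInr (1, 0) (θ ((u, t), y)) = 0) :
    (∫ t in (0 : ℝ)..1, contractInr (0, 1) (θ ((1, t), y))) =
        ∫ t in (0 : ℝ)..1, contractInr (0, 1) (θ ((0, t), y)) := by
  rw [← sub_eq_zero]
  refine (intervalIntegral_contractInr_sub_eq hU hθ hy (contractInr (1, 0)) (contractInr (0, 1)) he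
    (A' := fun _ _ => 0) (fun u hu => continuousOn_const) fun u hu t ht => ?_).trans (by simp)
  rw [add_zero, sub_eq_zero]
  exact contractInr_comm_of_alternatizeUncurryFin_eq_zero (hd _ ⟨⟨hu, ht⟩, hy⟩) (1, 0) (0, 1)

end SquareForms

/-! ### Pullbacks of forms to vector spaces -/

section PulledForm

variable {E : Type*} [NormedAddCommGroup E] [NormedSpace ℝ E]
  {X : Type*} [TopologicalSpace X] [ChartedSpace E X]
  {W : Type*} [NormedAddCommGroup W] [NormedSpace ℝ W] {k : ℕ}

/-- The pullback of a form on a manifold by a map defined on a subset of a vector space. -/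
def pulledForm (α : DiffForm 𝓘(ℝ, E) X k ℝ) (F : W → X) (D : Set W) (w : W) :
    W [⋀^Fin k]→L[ℝ] ℝ :=
  ContinuousAlternatingMap.compContinuousLinearMap (M := E) (α (F w))
    (mfderivWithin 𝓘(ℝ, W) 𝓘(ℝ, E) F D w : W →L[ℝ] E)

variable [IsManifold 𝓘(ℝ, E) ∞ X]

/-- Reduces smoothness and closedness of a pullback to forms on vector spaces: the derivatives of
the chart and of its inverse, inserted in the middle, cancel. -/
theorem pulledForm_eq_formInChart (α : DiffForm 𝓘(ℝ, E) X k ℝ) {F : W → X} {D : Set W}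
    {w : W} (hD : UniqueDiffWithinAt ℝ D w)
    (hF : MDifferentiableWithinAt 𝓘(ℝ, W) 𝓘(ℝ, E) F D w) {z₀ : X}
    (hz : F w ∈ (extChartAt 𝓘(ℝ, E) z₀).source) :
    pulledForm α F D w =
      (formInChart 𝓘(ℝ, E) α z₀ (extChartAt 𝓘(ℝ, E) z₀ (F w))).compContinuousLinearMap
        (fderivWithin ℝ (extChartAt 𝓘(ℝ, E) z₀ ∘ F) D w) := by
  have : IsManifold 𝓘(ℝ, E) 1 X := .of_le (n := ∞) (by simp)
  have hchain : fderivWithin ℝ (extChartAt 𝓘(ℝ, E) z₀ ∘ F) D w =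
      (mfderiv 𝓘(ℝ, E) 𝓘(ℝ, E) (extChartAt 𝓘(ℝ, E) z₀) (F w)).comp
        (mfderivWithin 𝓘(ℝ, W) 𝓘(ℝ, E) F D w) := by
    rw [← mfderivWithin_eq_fderivWithin]
    refine mfderiv_comp_mfderivWithin w (mdifferentiableAt_extChartAt ?_) hF
      hD.uniqueMDiffWithinAt
    rwa [extChartAt_source] at hz
  have hinv := mfderivWithin_extChartAt_symm_comp_mfderiv_extChartAt' (I := 𝓘(ℝ, E)) hz
  have hleft : (extChartAt 𝓘(ℝ, E) z₀).symm (extChartAt 𝓘(ℝ, E) z₀ (F w)) = F w :=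
    (extChartAt 𝓘(ℝ, E) z₀).left_inv hz
  ext v
  rw [hchain]
  -- The values of α at equal points have different types; all tangent spaces are E, which allows
  -- the comparison.
  have hα : ∀ {x x' : X} (h : x = x') (u : Fin k → E),
      (show E [⋀^Fin k]→L[ℝ] ℝ from α x) u = (show E [⋀^Fin k]→L[ℝ] ℝ from α x') u := by
    rintro x _ rfl u
    rfl
  refine Eq.trans ?_ (hα hleft _).symm
  refine congrArg (show E [⋀^Fin k]→L[ℝ] ℝ from α (F w)) (funext fun i => ?_)
  exact (DFunLike.congr_fun hinv (mfderivWithin 𝓘(ℝ, W) 𝓘(ℝ, E) F D w (v i))).symm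

theorem eventually_pulledForm_eq (α : DiffForm 𝓘(ℝ, E) X k ℝ) {F : W → X} {D : Set W}
    (hD : UniqueDiffOn ℝ D) (hF : ContMDiffOn 𝓘(ℝ, W) 𝓘(ℝ, E) ∞ F D) {w : W} (hw : w ∈ D) :
    ∃ o : Set W, IsOpen o ∧ w ∈ o ∧ Set.MapsTo F (D ∩ o) (extChartAt 𝓘(ℝ, E) (F w)).source ∧
      ContDiffOn ℝ ∞ (extChartAt 𝓘(ℝ, E) (F w) ∘ F) (D ∩ o) ∧
      Set.EqOn (pulledForm α F D) (fun w' =>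
        (formInChart 𝓘(ℝ, E) α (F w) ((extChartAt 𝓘(ℝ, E) (F w) ∘ F) w')).compContinuousLinearMap
          (fderivWithin ℝ (extChartAt 𝓘(ℝ, E) (F w) ∘ F) (D ∩ o) w')) (D ∩ o) := by
  obtain ⟨o, ho, hoD⟩ := continuousOn_iff'.1 hF.continuousOn _
    (isOpen_extChartAt_source (I := 𝓘(ℝ, E)) (F w))
  have hmaps : Set.MapsTo F (D ∩ o) (extChartAt 𝓘(ℝ, E) (F w)).source := fun w' hw' => by
    have : w' ∈ F ⁻¹' (extChartAt 𝓘(ℝ, E) (F w)).source ∩ D := hoD ▸ ⟨hw'.2, hw'.1⟩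
    exact this.1
  refine ⟨o, ho, ?_, hmaps, ?_, fun w' hw' => ?_⟩
  · have : w ∈ F ⁻¹' (extChartAt 𝓘(ℝ, E) (F w)).source ∩ D := ⟨mem_extChartAt_source _, hw⟩
    exact (hoD ▸ this : w ∈ o ∩ D).1
  · rw [← contMDiffOn_iff_contDiffOn]
    refine (contMDiffOn_extChartAt (I := 𝓘(ℝ, E)) (x := F w) (n := ∞)).comp
      (hF.mono Set.inter_subset_left) fun w' hw' => ?_
    have := hmaps hw'
    rwa [extChartAt_source] at this
  · rw [pulledForm_eq_formInChart α (hD w' hw'.1)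
      ((hF w' hw'.1).mdifferentiableWithinAt (by simp)) (hmaps hw')]
    simp only [fderivWithin_inter (ho.mem_nhds hw'.2), Function.comp_apply]

theorem contDiffOn_pulledForm {α : DiffForm 𝓘(ℝ, E) X k ℝ} (hα : IsSmoothForm 𝓘(ℝ, E) ∞ α)
    {F : W → X} {D : Set W} (hD : UniqueDiffOn ℝ D) (hF : ContMDiffOn 𝓘(ℝ, W) 𝓘(ℝ, E) ∞ F D) :
    ContDiffOn ℝ ∞ (pulledForm α F D) D := by
  intro w hw
  obtain ⟨o, ho, hwo, hmaps, hsm, heq⟩ := eventually_pulledForm_eq α hD hF hw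
  refine (contDiffWithinAt_inter (ho.mem_nhds hwo)).1 (ContDiffOn.congr ?_ heq w ⟨hw, hwo⟩)
  refine contDiff_compContinuousLinearMap.comp_contDiffOn (ContDiffOn.prodMk ?_ ?_)
  · exact (hα (F w)).comp hsm fun w' hw' => (extChartAt 𝓘(ℝ, E) (F w)).map_source (hmaps hw')
  · exact hsm.fderivWithin (hD.inter ho) (by simp)

/-- The exterior derivative commutes with pullback. This rests on symmetry of second derivatives
within D, which `hDc` secures at boundary points. -/
theorem extDerivWithin_pulledForm {α : DiffForm 𝓘(ℝ, E) X k ℝ} (hα : IsSmoothForm 𝓘(ℝ, E) ∞ α)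
    (hα0 : HasExtDeriv 𝓘(ℝ, E) α 0) {F : W → X} {D : Set W} (hD : UniqueDiffOn ℝ D)
    (hDc : D ⊆ closure (interior D)) (hF : ContMDiffOn 𝓘(ℝ, W) 𝓘(ℝ, E) ∞ F D) {w : W}
    (hw : w ∈ D) : extDerivWithin (pulledForm α F D) D w = 0 := by
  obtain ⟨o, ho, hwo, hmaps, hsm, heq⟩ := eventually_pulledForm_eq α hD hF hw
  have h1 : extDerivWithin (pulledForm α F D) D w =
      extDerivWithin (pulledForm α F D) (D ∩ o) w := by
    rw [extDerivWithin, extDerivWithin, fderivWithin_inter (ho.mem_nhds hwo)]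
  rw [h1, extDerivWithin_congr' heq ⟨hw, hwo⟩]
  have hmem : (extChartAt 𝓘(ℝ, E) (F w) ∘ F) w ∈ (extChartAt 𝓘(ℝ, E) (F w)).target :=
    (extChartAt 𝓘(ℝ, E) (F w)).map_source (hmaps ⟨hw, hwo⟩)
  rw [extDerivWithin_pullback (t := (extChartAt 𝓘(ℝ, E) (F w)).target) (r := ∞)
    ((hα (F w)).differentiableOn (by simp) _ hmem) (hsm w ⟨hw, hwo⟩)
    (by rw [minSmoothness_of_isRCLikeNormedField]; exact WithTop.coe_le_coe.2 le_top)
    (hD.inter ho) ?_ ⟨hw, hwo⟩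
    (fun w' hw' => (extChartAt 𝓘(ℝ, E) (F w)).map_source (hmaps hw')),
    hα0 (F w) _ hmem, formInChart_zero]
  · rfl
  · rw [interior_inter, ho.interior_eq]
    rw [Set.inter_comm]
    exact ho.inter_closure ⟨hwo, hDc hw⟩

end PulledForm

/-! ### The imaginary part of a holomorphic top-degree form is smooth and closed. -/

section ImForm

variable {E : Type*} [NormedAddCommGroup E] [NormedSpace ℂ E]
  {X : Type*} [TopologicalSpace X] [ChartedSpace E X]

theorem isManifold_real [IsManifold 𝓘(ℂ, E) ω X] : IsManifold 𝓘(ℝ, E) ∞ X := by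
  refine isManifold_of_contDiffOn 𝓘(ℝ, E) ∞ X fun e e' he he' => ?_
  have h := (contDiffGroupoid ω 𝓘(ℂ, E)).compatible he he'
  rw [contDiffGroupoid, mem_groupoid_of_pregroupoid] at h
  exact (h.1.restrict_scalars ℝ).of_le le_top

/-- Taking the imaginary part of an alternating form. -/
def imFormCLM (k : ℕ) : (E [⋀^Fin k]→L[ℂ] ℂ) →L[ℝ] E [⋀^Fin k]→L[ℝ] ℝ :=
  (ContinuousLinearMap.compContinuousAlternatingMapCLM ℝ E ℂ ℝ (Fin k) Complex.imCLM).comp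
    (ContinuousAlternatingMap.restrictScalarsCLM ℝ)

theorem mfderivWithin_extChartAt_symm_real [IsManifold 𝓘(ℂ, E) ω X] {z₀ : X} {y : E}
    (hy : y ∈ (extChartAt 𝓘(ℂ, E) z₀).target) (v : E) :
    (mfderivWithin 𝓘(ℝ, E) 𝓘(ℝ, E) (extChartAt 𝓘(ℝ, E) z₀).symm (Set.range 𝓘(ℝ, E)) y v : E) =
      (mfderivWithin 𝓘(ℂ, E) 𝓘(ℂ, E) (extChartAt 𝓘(ℂ, E) z₀).symm (Set.range 𝓘(ℂ, E)) y v :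
        E) := by
  have : IsManifold 𝓘(ℂ, E) 1 X := .of_le (n := ω) le_top
  obtain ⟨h1, h2⟩ := (mdifferentiableWithinAt_extChartAt_symm (I := 𝓘(ℂ, E)) hy).hasMFDerivWithinAt
  set D : E →L[ℂ] E :=
    mfderivWithin 𝓘(ℂ, E) 𝓘(ℂ, E) (extChartAt 𝓘(ℂ, E) z₀).symm (Set.range 𝓘(ℂ, E)) y
  have h3 := HasFDerivWithinAt.restrictScalars ℝ (f' := D) h2
  set D' : E →L[ℝ] E := D.restrictScalars ℝ
  have h4 : HasMFDerivWithinAt 𝓘(ℝ, E) 𝓘(ℝ, E) (extChartAt 𝓘(ℝ, E) z₀).symm (Set.range 𝓘(ℝ, E)) y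
      D' := ⟨h1, h3⟩
  rw [h4.mfderivWithin (by simpa using uniqueMDiffWithinAt_univ 𝓘(ℝ, E))]
  rfl

theorem formInChart_imForm [IsManifold 𝓘(ℂ, E) ω X] {k : ℕ} (Ω : DiffForm 𝓘(ℂ, E) X k ℂ) (z₀ : X) :
    Set.EqOn (formInChart 𝓘(ℝ, E) (imForm E Ω) z₀)
      (fun y => imFormCLM k (formInChart 𝓘(ℂ, E) Ω z₀ y)) (extChartAt 𝓘(ℂ, E) z₀).target := by
  intro y hy
  ext v
  refine congrArg (fun u : Fin k → E => Complex.im ((show E [⋀^Fin k]→L[ℂ] ℂ from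
    Ω ((extChartAt 𝓘(ℂ, E) z₀).symm y)) u)) (funext fun i => ?_)
  exact mfderivWithin_extChartAt_symm_real hy (v i)

theorem alternating_eq_zero_of_finrank_lt {k : ℕ} [FiniteDimensional ℂ E]
    (hk : Module.finrank ℂ E < k) (c : E [⋀^Fin k]→L[ℂ] ℂ) : c = 0 := by
  ext v
  refine c.toAlternatingMap.map_linearDependent v fun h => ?_
  have := h.fintype_card_le_finrank
  rw [Fintype.card_fin] at this
  omega

theorem extChartAt_target_real (z₀ : X) :
    (extChartAt 𝓘(ℝ, E) z₀).target = (extChartAt 𝓘(ℂ, E) z₀).target := by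
  simp only [mfld_simps]

theorem isSmoothForm_imForm [IsManifold 𝓘(ℂ, E) ω X] {k : ℕ} {Ω : DiffForm 𝓘(ℂ, E) X k ℂ}
    (hΩ : IsSmoothForm 𝓘(ℂ, E) ω Ω) : IsSmoothForm 𝓘(ℝ, E) ∞ (imForm E Ω) := by
  intro z₀
  rw [extChartAt_target_real]
  refine ContDiffOn.congr ?_ (formInChart_imForm Ω z₀)
  exact (imFormCLM k).contDiff.comp_contDiffOn (((hΩ z₀).restrict_scalars ℝ).of_le le_top)

/-- The real derivative of a holomorphic form is its complex derivative with scalars restricted, so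
the real exterior derivative of Im Ω is the imaginary part of the complex exterior derivative of Ω.
The latter is complex alternating of degree above the dimension, hence zero. -/
theorem hasExtDeriv_imForm [IsManifold 𝓘(ℂ, E) ω X] [FiniteDimensional ℂ E] {k : ℕ}
    (hk : Module.finrank ℂ E = k) {Ω : DiffForm 𝓘(ℂ, E) X k ℂ}
    (hΩ : IsSmoothForm 𝓘(ℂ, E) ω Ω) : HasExtDeriv 𝓘(ℝ, E) (imForm E Ω) 0 := by
  intro z₀ y hy
  rw [extChartAt_target_real] at hy ⊢
  rw [extDerivWithin_congr' (formInChart_imForm Ω z₀) hy, formInChart_zero]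
  have ho : IsOpen (extChartAt 𝓘(ℂ, E) z₀).target := isOpen_extChartAt_target z₀
  have h1 := ((hΩ z₀).differentiableOn (by simp) y hy).hasFDerivWithinAt
  have h2 : HasFDerivWithinAt (fun y => imFormCLM k (formInChart 𝓘(ℂ, E) Ω z₀ y)) _ _ y :=
    (imFormCLM k).hasFDerivAt.comp_hasFDerivWithinAt y (h1.restrictScalars ℝ)
  ext v
  rw [extDerivWithin, h2.fderivWithin (ho.uniqueDiffOn y hy),
    ContinuousAlternatingMap.alternatizeUncurryFin_apply]
  have h3 : ContinuousAlternatingMap.alternatizeUncurryFin (fderivWithin ℂ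
      (formInChart 𝓘(ℂ, E) Ω z₀) (extChartAt 𝓘(ℂ, E) z₀).target y) v = 0 := by
    rw [alternating_eq_zero_of_finrank_lt (by omega) (ContinuousAlternatingMap.alternatizeUncurryFin
      (fderivWithin ℂ (formInChart 𝓘(ℂ, E) Ω z₀) (extChartAt 𝓘(ℂ, E) z₀).target y))]
    rfl
  rw [ContinuousAlternatingMap.alternatizeUncurryFin_apply] at h3
  have h4 := congrArg Complex.imCLM h3
  rw [map_sum, map_zero] at h4
  refine Eq.trans (Finset.sum_congr rfl fun i _ => ?_) h4
  rw [map_zsmul]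
  rfl

end ImForm

/-! ### Families of maps and their contracted pullbacks -/

section ChartTarget

variable {V : Type*} [NormedAddCommGroup V] [NormedSpace ℝ V]
  {H : Type*} [TopologicalSpace H] (I : ModelWithCorners ℝ V H)
  {L : Type*} [TopologicalSpace L] [ChartedSpace H L]

/-- The target is relatively open in the range of the model, which is convex even when there is a
boundary. -/
theorem locallyConvexSet_extChartAt_target (x₀ : L) :
    LocallyConvexSet (extChartAt I x₀).target := by
  intro y hy
  obtain ⟨ε, hε, hball⟩ := Metric.mem_nhdsWithin_iff.1 (extChartAt_target_mem_nhdsWithin_of_mem hy)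
  refine ⟨Metric.ball y ε ∩ Set.range I, ?_, hball, (convex_ball y ε).inter I.convex_range⟩
  exact Filter.mem_of_superset (inter_mem_nhdsWithin _ (Metric.ball_mem_nhds y hε))
    fun z hz => ⟨hz.2, extChartAt_target_subset_range x₀ hz.1⟩

end ChartTarget

theorem prod_subset_closure_interior {P V : Type*} [TopologicalSpace P] [TopologicalSpace V]
    {S : Set P} {U : Set V} (hS : S ⊆ closure (interior S)) (hU : U ⊆ closure (interior U)) :
    S ×ˢ U ⊆ closure (interior (S ×ˢ U)) := by
  rw [interior_prod_eq, closure_prod_eq]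
  exact Set.prod_mono hS hU

theorem Icc_subset_closure_interior : Set.Icc (0 : ℝ) 1 ⊆ closure (interior (Set.Icc 0 1)) := by
  rw [interior_Icc, closure_Ioo zero_ne_one]

section Family

variable {P : Type*} [NormedAddCommGroup P] [NormedSpace ℝ P] {S : Set P}
  {E : Type*} [NormedAddCommGroup E] [NormedSpace ℝ E]
  {X : Type*} [TopologicalSpace X] [ChartedSpace E X]
  {V : Type*} [NormedAddCommGroup V] [NormedSpace ℝ V]
  {H : Type*} [TopologicalSpace H] {I : ModelWithCorners ℝ V H}
  {L : Type*} [TopologicalSpace L] [ChartedSpace H L] {k : ℕ}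

variable (I) in
/-- The derivative of the inverse of a chart. -/
def chartSymmDeriv (x₀ : L) (y : V) : V →L[ℝ] V :=
  mfderivWithin 𝓘(ℝ, V) I (extChartAt I x₀).symm (Set.range I) y

variable (S E I) in
/-- Smooth families of maps `L → X` parametrized by `S`. -/
def IsSmoothFamily (f : P → L → X) : Prop :=
  ContMDiffOn (𝓘(ℝ, P).prod I) 𝓘(ℝ, E) ∞ (fun z : P × L => f z.1 z.2) (S ×ˢ (Set.univ : Set L))

variable (I) in
/-- A family of maps in a chart of the source. -/
def chartFamily (f : P → L → X) (x₀ : L) (z : P × V) : X := f z.1 ((extChartAt I x₀).symm z.2)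

variable (S I) in
/-- The form `(f_p)^* i_w α`, with `w` the derivative of `f` in the direction `a`. -/
def familyForm (α : DiffForm 𝓘(ℝ, E) X (k + 1) ℝ) (f : P → L → X) (a p : P) (x : L) :
    V [⋀^Fin k]→L[ℝ] ℝ :=
  (ContinuousAlternatingMap.curryLeft (E := E) (α (f p x))
    (mfderivWithin 𝓘(ℝ, P) 𝓘(ℝ, E) (fun q => f q x) S p a)).compContinuousLinearMap
      (mfderiv I 𝓘(ℝ, E) (f p) x)

variable (S I) in
/-- The form `(f_p)^* i_{w'} i_w α`, with `w, w'` the derivatives of `f` in the directions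
`a, b`. -/
def familyForm₂ (α : DiffForm 𝓘(ℝ, E) X (k + 2) ℝ) (f : P → L → X) (a b p : P) (x : L) :
    V [⋀^Fin k]→L[ℝ] ℝ :=
  (ContinuousAlternatingMap.curryLeft (E := E) (ContinuousAlternatingMap.curryLeft (E := E)
    (α (f p x)) (mfderivWithin 𝓘(ℝ, P) 𝓘(ℝ, E) (fun q => f q x) S p a))
    (mfderivWithin 𝓘(ℝ, P) 𝓘(ℝ, E) (fun q => f q x) S p b)).compContinuousLinearMap
      (mfderiv I 𝓘(ℝ, E) (f p) x)

theorem IsSmoothFamily.contMDiff {f : P → L → X} (hf : IsSmoothFamily S E I f) {p : P}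
    (hp : p ∈ S) : ContMDiff I 𝓘(ℝ, E) ∞ (f p) := by
  rw [← contMDiffOn_univ]
  exact ContMDiffOn.comp hf (f := fun x : L => (p, x))
    (contMDiff_const.prodMk contMDiff_id).contMDiffOn fun x _ => ⟨hp, trivial⟩

theorem IsSmoothFamily.contMDiffOn_param {f : P → L → X} (hf : IsSmoothFamily S E I f) (x : L) :
    ContMDiffOn 𝓘(ℝ, P) 𝓘(ℝ, E) ∞ (fun p => f p x) S :=
  ContMDiffOn.comp hf (f := fun p : P => (p, x))
    (contMDiff_id.prodMk contMDiff_const).contMDiffOn fun _ hp => ⟨hp, trivial⟩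

theorem IsSmoothFamily.comp_param {Q : Type*} [NormedAddCommGroup Q] [NormedSpace ℝ Q] {T : Set Q}
    {f : P → L → X} (hf : IsSmoothFamily S E I f) {r : Q → P} (hr : ContDiffOn ℝ ∞ r T)
    (hrT : Set.MapsTo r T S) : IsSmoothFamily T E I (fun q => f (r q)) :=
  ContMDiffOn.comp hf (f := fun z : Q × L => (r z.1, z.2))
    ((hr.contMDiffOn.comp contMDiffOn_fst fun _ hz => hz.1).prodMk contMDiffOn_snd)
    fun _ hz => ⟨hrT hz.1, trivial⟩

variable [IsManifold I ∞ L]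

theorem IsSmoothFamily.contMDiffOn_chartFamily {f : P → L → X} (hf : IsSmoothFamily S E I f)
    (x₀ : L) : ContMDiffOn 𝓘(ℝ, P × V) 𝓘(ℝ, E) ∞ (chartFamily I f x₀)
      (S ×ˢ (extChartAt I x₀).target) := by
  refine ContMDiffOn.comp hf (f := fun z : P × V => (z.1, (extChartAt I x₀).symm z.2))
    (ContMDiffOn.prodMk ?_ ?_) fun z hz => ⟨hz.1, trivial⟩
  · exact contDiff_fst.contMDiff.contMDiffOn
  · exact (contMDiffOn_extChartAt_symm x₀).comp (t := (extChartAt I x₀).target)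
      (contDiff_snd (E := P) (F := V)).contMDiff.contMDiffOn fun z hz => hz.2

/-- The derivative on the product splits into partial derivatives. This identifies chart
contractions of the pulled back form with intrinsic forms on L. -/
theorem IsSmoothFamily.mfderivWithin_chartFamily {f : P → L → X} (hf : IsSmoothFamily S E I f)
    (hS : UniqueDiffOn ℝ S) (x₀ : L) {p : P} (hp : p ∈ S) {y : V}
    (hy : y ∈ (extChartAt I x₀).target) (a : P) (v : V) :
    (mfderivWithin 𝓘(ℝ, P × V) 𝓘(ℝ, E) (chartFamily I f x₀) (S ×ˢ (extChartAt I x₀).target) (p, y)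
        ((a, v) : P × V) : E) =
      (mfderivWithin 𝓘(ℝ, P) 𝓘(ℝ, E) (fun q => f q ((extChartAt I x₀).symm y)) S p a : E) +
      (mfderiv I 𝓘(ℝ, E) (f p) ((extChartAt I x₀).symm y)
        (mfderivWithin 𝓘(ℝ, V) I (extChartAt I x₀).symm (Set.range I) y v) : E) := by
  have : IsManifold I 1 L := .of_le (n := ∞) (by simp)
  set U := (extChartAt I x₀).target
  have hU : UniqueDiffOn ℝ U := uniqueDiffOn_extChartAt_target x₀
  set D : P × V →L[ℝ] E :=
    mfderivWithin 𝓘(ℝ, P × V) 𝓘(ℝ, E) (chartFamily I f x₀) (S ×ˢ U) (p, y) with hD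
  have hF : HasMFDerivWithinAt 𝓘(ℝ, P × V) 𝓘(ℝ, E) (chartFamily I f x₀) (S ×ˢ U) (p, y) D :=
    ((hf.contMDiffOn_chartFamily x₀ (p, y) ⟨hp, hy⟩).mdifferentiableWithinAt
      (by simp)).hasMFDerivWithinAt
  have h1 : mfderivWithin 𝓘(ℝ, P) 𝓘(ℝ, E) (fun q => f q ((extChartAt I x₀).symm y)) S p =
      D.comp (ContinuousLinearMap.inl ℝ P V) := by
    have hi : HasMFDerivWithinAt 𝓘(ℝ, P) 𝓘(ℝ, P × V) (fun q : P => (q, y)) S p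
        (ContinuousLinearMap.inl ℝ P V) :=
      (hasFDerivAt_prodMk_left p y).hasFDerivWithinAt.hasMFDerivWithinAt
    have hm : S ⊆ (fun q : P => (q, y)) ⁻¹' (S ×ˢ U) := fun q hq => ⟨hq, hy⟩
    exact (hF.comp p hi hm).mfderivWithin (hS p hp).uniqueMDiffWithinAt
  have h2 : (mfderiv I 𝓘(ℝ, E) (f p) ((extChartAt I x₀).symm y)).comp
      (mfderivWithin 𝓘(ℝ, V) I (extChartAt I x₀).symm (Set.range I) y) =
      D.comp (ContinuousLinearMap.inr ℝ P V) := by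
    have hi : HasMFDerivWithinAt 𝓘(ℝ, V) 𝓘(ℝ, P × V) (fun z : V => (p, z)) U y
        (ContinuousLinearMap.inr ℝ P V) :=
      (hasFDerivAt_prodMk_right p y).hasFDerivWithinAt.hasMFDerivWithinAt
    have hm : U ⊆ (fun z : V => (p, z)) ⁻¹' (S ×ˢ U) := fun z hz => ⟨hp, hz⟩
    have h3 := hF.comp y hi hm
    have h4 : HasMFDerivWithinAt 𝓘(ℝ, V) 𝓘(ℝ, E) (f p ∘ (extChartAt I x₀).symm) U y
        ((mfderiv I 𝓘(ℝ, E) (f p) ((extChartAt I x₀).symm y)).comp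
      (mfderivWithin 𝓘(ℝ, V) I (extChartAt I x₀).symm (Set.range I) y)) :=
      HasMFDerivAt.comp_hasMFDerivWithinAt y
        (((hf.contMDiff hp) _).mdifferentiableAt (by simp)).hasMFDerivAt
        ((mdifferentiableWithinAt_extChartAt_symm hy).hasMFDerivWithinAt.mono
          (extChartAt_target_subset_range x₀))
    exact (hU y hy).uniqueMDiffWithinAt.eq h4 h3
  have h5 : ((a, v) : P × V) = (a, 0) + (0, v) := by simp
  rw [h5]
  refine (D.map_add _ _).trans ?_
  rw [h1]
  exact congrArg₂ (· + ·) rfl (DFunLike.congr_fun h2 v).symm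

/-- The pullback of `α` by a family of maps, in a chart of the source. -/
abbrev familyPulledForm (I : ModelWithCorners ℝ V H) (S : Set P) (α : DiffForm 𝓘(ℝ, E) X k ℝ)
    (f : P → L → X) (x₀ : L) (z : P × V) : (P × V) [⋀^Fin k]→L[ℝ] ℝ :=
  pulledForm α (chartFamily I f x₀) (S ×ˢ (extChartAt I x₀).target) z

theorem IsSmoothFamily.mfderivWithin_chartFamily_inl {f : P → L → X}
    (hf : IsSmoothFamily S E I f)
    (hS : UniqueDiffOn ℝ S) (x₀ : L) {p : P} (hp : p ∈ S) {y : V}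
    (hy : y ∈ (extChartAt I x₀).target) (a : P) :
    (mfderivWithin 𝓘(ℝ, P × V) 𝓘(ℝ, E) (chartFamily I f x₀) (S ×ˢ (extChartAt I x₀).target) (p, y)
        ((a, 0) : P × V) : E) =
      (mfderivWithin 𝓘(ℝ, P) 𝓘(ℝ, E) (fun q => f q ((extChartAt I x₀).symm y)) S p a : E) := by
  rw [hf.mfderivWithin_chartFamily hS x₀ hp hy]
  refine (congrArg₂ (· + ·) rfl ?_).trans (add_zero _)
  exact (congrArg _ (map_zero _)).trans (map_zero _)

theorem IsSmoothFamily.mfderivWithin_chartFamily_inr {f : P → L → X}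
    (hf : IsSmoothFamily S E I f)
    (hS : UniqueDiffOn ℝ S) (x₀ : L) {p : P} (hp : p ∈ S) {y : V}
    (hy : y ∈ (extChartAt I x₀).target) (v : V) :
    (mfderivWithin 𝓘(ℝ, P × V) 𝓘(ℝ, E) (chartFamily I f x₀) (S ×ˢ (extChartAt I x₀).target) (p, y)
        ((0, v) : P × V) : E) =
      (mfderiv I 𝓘(ℝ, E) (f p) ((extChartAt I x₀).symm y)
        (mfderivWithin 𝓘(ℝ, V) I (extChartAt I x₀).symm (Set.range I) y v) : E) := by
  rw [hf.mfderivWithin_chartFamily hS x₀ hp hy]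
  exact (congrArg₂ (· + ·) (map_zero _) rfl).trans (zero_add _)

/-- The dictionary between calculus on P × V and forms on L: the right-hand side is the chart
expression of the intrinsic contracted pullback. -/
theorem IsSmoothFamily.contractInr_familyPulledForm (α : DiffForm 𝓘(ℝ, E) X (k + 1) ℝ)
    {f : P → L → X} (hf : IsSmoothFamily S E I f) (hS : UniqueDiffOn ℝ S) (x₀ : L) {p : P}
    (hp : p ∈ S) {y : V} (hy : y ∈ (extChartAt I x₀).target) (a : P) :
    contractInr a (familyPulledForm I S α f x₀ (p, y)) =
      (familyForm S I α f a p ((extChartAt I x₀).symm y)).compContinuousLinearMap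
        (chartSymmDeriv I x₀ y) := by
  ext v
  refine congrArg (show E [⋀^Fin (k + 1)]→L[ℝ] ℝ from α (f p ((extChartAt I x₀).symm y)))
    (funext fun i => ?_)
  refine Fin.cases ?_ (fun i => ?_) i
  · exact hf.mfderivWithin_chartFamily_inl hS x₀ hp hy a
  · exact hf.mfderivWithin_chartFamily_inr hS x₀ hp hy (v i)

theorem IsSmoothFamily.contractInr₂_familyPulledForm (α : DiffForm 𝓘(ℝ, E) X (k + 2) ℝ)
    {f : P → L → X} (hf : IsSmoothFamily S E I f) (hS : UniqueDiffOn ℝ S) (x₀ : L) {p : P}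
    (hp : p ∈ S) {y : V} (hy : y ∈ (extChartAt I x₀).target) (a b : P) :
    contractInr₂ a b (familyPulledForm I S α f x₀ (p, y)) =
      (familyForm₂ S I α f a b p ((extChartAt I x₀).symm y)).compContinuousLinearMap
        (chartSymmDeriv I x₀ y) := by
  ext v
  refine congrArg (show E [⋀^Fin (k + 2)]→L[ℝ] ℝ from α (f p ((extChartAt I x₀).symm y)))
    (funext fun i => ?_)
  refine Fin.cases ?_ (fun i => Fin.cases ?_ (fun i => ?_) i) i
  · exact hf.mfderivWithin_chartFamily_inl hS x₀ hp hy a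
  · exact hf.mfderivWithin_chartFamily_inl hS x₀ hp hy b
  · exact hf.mfderivWithin_chartFamily_inr hS x₀ hp hy (v i)

theorem IsSmoothFamily.familyPulledForm_comp_inr {α : DiffForm 𝓘(ℝ, E) X k ℝ}
    {f : P → L → X} (hf : IsSmoothFamily S E I f) (hS : UniqueDiffOn ℝ S) (x₀ : L) {p : P}
    (hp : p ∈ S) {y : V} (hy : y ∈ (extChartAt I x₀).target)
    (h0 : pullback I 𝓘(ℝ, E) (f p) α = 0) :
    (familyPulledForm I S α f x₀ (p, y)).compContinuousLinearMap
      (ContinuousLinearMap.inr ℝ P V) = 0 := by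
  ext v
  have h1 := DFunLike.congr_fun (congrFun h0 ((extChartAt I x₀).symm y))
    (fun i => mfderivWithin 𝓘(ℝ, V) I (extChartAt I x₀).symm (Set.range I) y (v i))
  refine Eq.trans ?_ h1
  refine congrArg (show E [⋀^Fin k]→L[ℝ] ℝ from α (f p ((extChartAt I x₀).symm y)))
    (funext fun i => ?_)
  exact hf.mfderivWithin_chartFamily_inr hS x₀ hp hy (v i)

theorem IsSmoothFamily.contDiffOn_familyPulledForm [IsManifold 𝓘(ℝ, E) ∞ X]
    {α : DiffForm 𝓘(ℝ, E) X k ℝ} (hα : IsSmoothForm 𝓘(ℝ, E) ∞ α)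
    {f : P → L → X} (hf : IsSmoothFamily S E I f) (hS : UniqueDiffOn ℝ S) (x₀ : L) :
    ContDiffOn ℝ ∞ (familyPulledForm I S α f x₀) (S ×ˢ (extChartAt I x₀).target) :=
  contDiffOn_pulledForm hα (hS.prod (uniqueDiffOn_extChartAt_target x₀))
    (hf.contMDiffOn_chartFamily x₀)

theorem IsSmoothFamily.extDerivWithin_familyPulledForm [IsManifold 𝓘(ℝ, E) ∞ X]
    {α : DiffForm 𝓘(ℝ, E) X k ℝ} (hα : IsSmoothForm 𝓘(ℝ, E) ∞ α)
    (hα0 : HasExtDeriv 𝓘(ℝ, E) α 0)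
    {f : P → L → X} (hf : IsSmoothFamily S E I f) (hS : UniqueDiffOn ℝ S)
    (hSc : S ⊆ closure (interior S)) (x₀ : L) :
    ∀ z ∈ S ×ˢ (extChartAt I x₀).target,
      extDerivWithin (familyPulledForm I S α f x₀) (S ×ˢ (extChartAt I x₀).target) z = 0 :=
  fun _ hz => extDerivWithin_pulledForm hα hα0 (hS.prod (uniqueDiffOn_extChartAt_target x₀))
    (prod_subset_closure_interior hSc extChartAt_target_subset_closure_interior)
    (hf.contMDiffOn_chartFamily x₀) hz

/-- The derivative of the chart inverts `chartSymmDeriv`, so pulling back along it recovers g. -/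
theorem continuousOn_of_comp_chartSymmDeriv {g : P → V [⋀^Fin k]→L[ℝ] ℝ} (x : L)
    (hg : ContinuousOn (fun p => (g p).compContinuousLinearMap
      (chartSymmDeriv I x (extChartAt I x x))) S) : ContinuousOn g S := by
  have : IsManifold I 1 L := .of_le (n := ∞) (by simp)
  have h := mfderivWithin_extChartAt_symm_comp_mfderiv_extChartAt' (I := I)
    (mem_extChartAt_source (I := I) x)
  have h2 := (ContinuousAlternatingMap.compContinuousLinearMapCLM (F := ℝ) (ι := Fin k)
    (mfderiv I 𝓘(ℝ, V) (extChartAt I x) x : V →L[ℝ] V)).continuous.comp_continuousOn hg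
  refine h2.congr fun p _ => ?_
  ext v
  exact (congrArg (g p) (funext fun i => DFunLike.congr_fun h (v i))).symm

theorem IsSmoothFamily.continuousOn_familyForm [IsManifold 𝓘(ℝ, E) ∞ X]
    {α : DiffForm 𝓘(ℝ, E) X (k + 1) ℝ} (hα : IsSmoothForm 𝓘(ℝ, E) ∞ α)
    {f : P → L → X} (hf : IsSmoothFamily S E I f) (hS : UniqueDiffOn ℝ S) (a : P) (x : L) :
    ContinuousOn (fun p => familyForm S I α f a p x) S := by
  have hy : extChartAt I x x ∈ (extChartAt I x).target := mem_extChartAt_target x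
  have hx : (extChartAt I x).symm (extChartAt I x x) = x := extChartAt_to_inv x
  refine continuousOn_of_comp_chartSymmDeriv (I := I) x (ContinuousOn.congr
    (f := fun p => contractInr a (familyPulledForm I S α f x (p, extChartAt I x x))) ?_ ?_)
  · exact (contractInr (V := V) a).continuous.comp_continuousOn
      ((hf.contDiffOn_familyPulledForm hα hS x).continuousOn.comp (by fun_prop)
        fun p hp => ⟨hp, hy⟩)
  · intro p hp
    have h3 := hf.contractInr_familyPulledForm α hS x hp hy a
    rw [hx] at h3
    exact h3.symm

theorem IsSmoothFamily.continuousOn_familyForm₂ [IsManifold 𝓘(ℝ, E) ∞ X]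
    {α : DiffForm 𝓘(ℝ, E) X (k + 2) ℝ} (hα : IsSmoothForm 𝓘(ℝ, E) ∞ α)
    {f : P → L → X} (hf : IsSmoothFamily S E I f) (hS : UniqueDiffOn ℝ S) (a b : P) (x : L) :
    ContinuousOn (fun p => familyForm₂ S I α f a b p x) S := by
  have hy : extChartAt I x x ∈ (extChartAt I x).target := mem_extChartAt_target x
  have hx : (extChartAt I x).symm (extChartAt I x x) = x := extChartAt_to_inv x
  refine continuousOn_of_comp_chartSymmDeriv (I := I) x (ContinuousOn.congr
    (f := fun p => contractInr₂ a b (familyPulledForm I S α f x (p, extChartAt I x x))) ?_ ?_)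
  · exact (contractInr₂ (V := V) a b).continuous.comp_continuousOn
      ((hf.contDiffOn_familyPulledForm hα hS x).continuousOn.comp (by fun_prop)
        fun p hp => ⟨hp, hy⟩)
  · intro p hp
    have h3 := hf.contractInr₂_familyPulledForm α hS x hp hy a b
    rw [hx] at h3
    exact h3.symm

end Family

/-! ### The flux form of a path and its variation -/

section PathForm

variable {E : Type*} [NormedAddCommGroup E] [NormedSpace ℝ E]
  {X : Type*} [TopologicalSpace X] [ChartedSpace E X]
  {V : Type} [NormedAddCommGroup V] [NormedSpace ℝ V]
  {H : Type*} [TopologicalSpace H] {I : ModelWithCorners ℝ V H}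
  {L : Type*} [TopologicalSpace L] [ChartedSpace H L] {k : ℕ}

variable (I) in
/-- The form `∫₀¹ (f_t)^* i_{d f_t / dt} α dt`. -/
def pathForm (α : DiffForm 𝓘(ℝ, E) X (k + 1) ℝ) (f : ℝ → L → X) : DiffForm I L k ℝ :=
  fun x => (∫ t in (0 : ℝ)..1, familyForm (Set.Icc (0 : ℝ) 1) I α f 1 t x : V [⋀^Fin k]→L[ℝ] ℝ)

variable (I) in
/-- The form `∫₀¹∫₀¹ (f_{u,t})^* i_{∂f/∂t} i_{∂f/∂u} α dt du`. -/
def squareForm (α : DiffForm 𝓘(ℝ, E) X (k + 2) ℝ) (f : ℝ × ℝ → L → X) : DiffForm I L k ℝ :=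
  fun x => (∫ u in (0 : ℝ)..1, ∫ t in (0 : ℝ)..1,
    familyForm₂ unitSquare I α f (1, 0) (0, 1) (u, t) x : V [⋀^Fin k]→L[ℝ] ℝ)

theorem intervalIntegral_compContinuousLinearMap {g : ℝ → V [⋀^Fin k]→L[ℝ] ℝ}
    (hg : ContinuousOn g (Set.Icc 0 1)) (A : V →L[ℝ] V) :
    (∫ t in (0 : ℝ)..1, g t).compContinuousLinearMap A =
      ∫ t in (0 : ℝ)..1, (g t).compContinuousLinearMap A := by
  have hi : IntervalIntegrable g MeasureTheory.volume 0 1 :=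
    ContinuousOn.intervalIntegrable (by rwa [Set.uIcc_of_le zero_le_one])
  exact ((ContinuousAlternatingMap.compContinuousLinearMapCLM (F := ℝ) (ι := Fin k)
    A).intervalIntegral_comp_comm hi).symm

theorem uniqueDiffOn_unitInterval : UniqueDiffOn ℝ (Set.Icc (0 : ℝ) 1) :=
  uniqueDiffOn_Icc zero_lt_one

variable [IsManifold I ∞ L] [IsManifold 𝓘(ℝ, E) ∞ X]

theorem formInChart_pathForm {α : DiffForm 𝓘(ℝ, E) X (k + 1) ℝ} (hα : IsSmoothForm 𝓘(ℝ, E) ∞ α)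
    {f : ℝ → L → X} (hf : IsSmoothFamily (Set.Icc (0 : ℝ) 1) E I f) (x₀ : L) :
    Set.EqOn (formInChart I (pathForm I α f) x₀)
      (fun y => ∫ t in (0 : ℝ)..1, contractInr (1 : ℝ)
        (familyPulledForm I (Set.Icc (0 : ℝ) 1) α f x₀ (t, y))) (extChartAt I x₀).target := by
  intro y hy
  refine (intervalIntegral_compContinuousLinearMap
    (hf.continuousOn_familyForm hα uniqueDiffOn_unitInterval 1 _) (chartSymmDeriv I x₀ y)).trans ?_
  refine intervalIntegral.integral_congr fun t ht => ?_
  rw [Set.uIcc_of_le zero_le_one] at ht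
  exact (hf.contractInr_familyPulledForm α uniqueDiffOn_unitInterval x₀ ht hy 1).symm

theorem contDiffOn_contractInr_familyPulledForm {α : DiffForm 𝓘(ℝ, E) X (k + 1) ℝ}
    (hα : IsSmoothForm 𝓘(ℝ, E) ∞ α) {f : ℝ → L → X}
    (hf : IsSmoothFamily (Set.Icc (0 : ℝ) 1) E I f) (x₀ : L) :
    ContDiffOn ℝ ∞ (fun z => contractInr (1 : ℝ)
      (familyPulledForm I (Set.Icc (0 : ℝ) 1) α f x₀ z))
      (Set.Icc (0 : ℝ) 1 ×ˢ (extChartAt I x₀).target) :=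
  (contractInr (V := V) (1 : ℝ)).contDiff.comp_contDiffOn
    (hf.contDiffOn_familyPulledForm hα uniqueDiffOn_unitInterval x₀)

theorem isSmoothForm_pathForm {α : DiffForm 𝓘(ℝ, E) X (k + 1) ℝ} (hα : IsSmoothForm 𝓘(ℝ, E) ∞ α)
    {f : ℝ → L → X} (hf : IsSmoothFamily (Set.Icc (0 : ℝ) 1) E I f) :
    IsSmoothForm I ∞ (pathForm I α f) := fun x₀ =>
  (contDiffOn_intervalIntegral (locallyConvexSet_extChartAt_target I x₀)
    (uniqueDiffOn_extChartAt_target x₀)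
    (contDiffOn_contractInr_familyPulledForm hα hf x₀)).congr (formInChart_pathForm hα hf x₀)

theorem pathForm_mem_closedForms {α : DiffForm 𝓘(ℝ, E) X (k + 1) ℝ}
    (hα : IsSmoothForm 𝓘(ℝ, E) ∞ α) (hα0 : HasExtDeriv 𝓘(ℝ, E) α 0)
    {f : ℝ → L → X} (hf : IsSmoothFamily (Set.Icc (0 : ℝ) 1) E I f)
    (h0 : ∀ t ∈ Set.Icc (0 : ℝ) 1, pullback I 𝓘(ℝ, E) (f t) α = 0) :
    pathForm I α f ∈ closedForms I L k := by
  refine ⟨isSmoothForm_pathForm hα hf, fun x₀ y hy => ?_⟩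
  have hU := uniqueDiffOn_extChartAt_target (I := I) x₀
  rw [extDerivWithin_congr' (formInChart_pathForm hα hf x₀) hy,
    extDerivWithin_intervalIntegral (locallyConvexSet_extChartAt_target I x₀) hU
      (contDiffOn_contractInr_familyPulledForm hα hf x₀) hy, formInChart_zero]
  refine (intervalIntegral.integral_congr (g := fun _ => 0) fun t ht => ?_).trans (by simp)
  rw [Set.uIcc_of_le zero_le_one] at ht
  exact extDerivWithin_contractInr uniqueDiffOn_unitInterval hU
    ((hf.contDiffOn_familyPulledForm hα uniqueDiffOn_unitInterval x₀).differentiableOn (by simp))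
    (hf.extDerivWithin_familyPulledForm hα hα0 uniqueDiffOn_unitInterval
      Icc_subset_closure_interior x₀)
    (fun z hz => hf.familyPulledForm_comp_inr uniqueDiffOn_unitInterval x₀ hz.1 hz.2
      (h0 z.1 hz.1)) 1 ht hy

theorem formInChart_squareForm {α : DiffForm 𝓘(ℝ, E) X (k + 2) ℝ} (hα : IsSmoothForm 𝓘(ℝ, E) ∞ α)
    {f : ℝ × ℝ → L → X} (hf : IsSmoothFamily unitSquare E I f) (x₀ : L) :
    Set.EqOn (formInChart I (squareForm I α f) x₀)
      (squarePrimitive (familyPulledForm I unitSquare α f x₀)) (extChartAt I x₀).target := by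
  intro y hy
  have hc := hf.continuousOn_familyForm₂ hα uniqueDiffOn_square (1, 0) (0, 1)
    ((extChartAt I x₀).symm y)
  refine (intervalIntegral_compContinuousLinearMap (continuousOn_intervalIntegral_of_square hc)
    (chartSymmDeriv I x₀ y)).trans ?_
  refine intervalIntegral.integral_congr fun u hu => ?_
  rw [Set.uIcc_of_le zero_le_one] at hu
  refine (intervalIntegral_compContinuousLinearMap (g := fun t => familyForm₂ unitSquare I α f
    (1, 0) (0, 1) (u, t) ((extChartAt I x₀).symm y)) (hc.comp (f := fun t => (u, t))
    (by fun_prop) fun t ht => ⟨hu, ht⟩) (chartSymmDeriv I x₀ y)).trans ?_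
  refine intervalIntegral.integral_congr fun t ht => ?_
  rw [Set.uIcc_of_le zero_le_one] at ht
  exact (hf.contractInr₂_familyPulledForm α uniqueDiffOn_square x₀ ⟨hu, ht⟩ hy (1, 0) (0, 1)).symm

theorem isSmoothForm_squareForm {α : DiffForm 𝓘(ℝ, E) X (k + 2) ℝ}
    (hα : IsSmoothForm 𝓘(ℝ, E) ∞ α) {f : ℝ × ℝ → L → X} (hf : IsSmoothFamily unitSquare E I f) :
    IsSmoothForm I ∞ (squareForm I α f) := fun x₀ =>
  (contDiffOn_squarePrimitive (locallyConvexSet_extChartAt_target I x₀)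
    (uniqueDiffOn_extChartAt_target x₀)
    (hf.contDiffOn_familyPulledForm hα uniqueDiffOn_square x₀)).congr
      (formInChart_squareForm hα hf x₀)

/-- The restriction of a family over the square to a line. -/
theorem IsSmoothFamily.mfderivWithin_line {f : ℝ × ℝ → L → X}
    (hf : IsSmoothFamily unitSquare E I f) {r : ℝ → ℝ × ℝ} {r' : ℝ × ℝ} {s : ℝ}
    (hs : s ∈ Set.Icc (0 : ℝ) 1) (hr : HasDerivWithinAt r r' (Set.Icc 0 1) s)
    (hmaps : Set.MapsTo r (Set.Icc 0 1) unitSquare) (x : L) :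
    (mfderivWithin 𝓘(ℝ, ℝ) 𝓘(ℝ, E) (fun q => f (r q) x) (Set.Icc 0 1) s (1 : ℝ) : E) =
      (mfderivWithin 𝓘(ℝ, ℝ × ℝ) 𝓘(ℝ, E) (fun q => f q x) unitSquare (r s) r' : E) := by
  have h1 := ((hf.contMDiffOn_param x (r s) (hmaps hs)).mdifferentiableWithinAt
    (by simp)).hasMFDerivWithinAt
  have h2 := h1.comp s hr.hasFDerivWithinAt.hasMFDerivWithinAt hmaps
  have h3 := h2.mfderivWithin (uniqueDiffOn_unitInterval s hs).uniqueMDiffWithinAt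
  refine (DFunLike.congr_fun h3 (1 : ℝ)).trans ?_
  exact congrArg (mfderivWithin 𝓘(ℝ, ℝ × ℝ) 𝓘(ℝ, E) (fun q => f q x) unitSquare (r s))
    (one_smul ℝ r')

theorem IsSmoothFamily.familyForm_line (α : DiffForm 𝓘(ℝ, E) X (k + 1) ℝ) {f : ℝ × ℝ → L → X}
    (hf : IsSmoothFamily unitSquare E I f) {r : ℝ → ℝ × ℝ} {r' : ℝ × ℝ} {s : ℝ}
    (hs : s ∈ Set.Icc (0 : ℝ) 1) (hr : HasDerivWithinAt r r' (Set.Icc 0 1) s)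
    (hmaps : Set.MapsTo r (Set.Icc 0 1) unitSquare) (x : L) :
    familyForm (Set.Icc 0 1) I α (fun q => f (r q)) 1 s x =
      familyForm unitSquare I α f r' (r s) x := by
  unfold familyForm
  rw [hf.mfderivWithin_line hs hr hmaps x]

theorem hasDerivWithinAt_vertical (u t : ℝ) (s : Set ℝ) :
    HasDerivWithinAt (fun t : ℝ => (u, t)) ((0, 1) : ℝ × ℝ) s t :=
  (hasDerivWithinAt_const t s u).prodMk (hasDerivWithinAt_id t s)

theorem hasDerivWithinAt_horizontal (u t : ℝ) (s : Set ℝ) :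
    HasDerivWithinAt (fun u : ℝ => (u, t)) ((1, 0) : ℝ × ℝ) s u :=
  (hasDerivWithinAt_id u s).prodMk (hasDerivWithinAt_const u s t)

/-- If the velocity is df(w), contracting α with it and pulling back amounts to contracting f^*α = 0
with w. -/
theorem familyForm_eq_zero_of_tangent {P : Type*} [NormedAddCommGroup P] [NormedSpace ℝ P]
    {S : Set P} {α : DiffForm 𝓘(ℝ, E) X (k + 1) ℝ} {f : P → L → X} {a p : P} {x : L}
    (h0 : pullback I 𝓘(ℝ, E) (f p) α = 0)
    (ht : ∃ w : V, (mfderiv I 𝓘(ℝ, E) (f p) x w : E) =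
      (mfderivWithin 𝓘(ℝ, P) 𝓘(ℝ, E) (fun q => f q x) S p a : E)) :
    familyForm S I α f a p x = 0 := by
  obtain ⟨w, hw⟩ := ht
  ext v
  have h1 := DFunLike.congr_fun (congrFun h0 x) (Matrix.vecCons (w : V) v)
  refine Eq.trans ?_ h1
  refine congrArg (show E [⋀^Fin (k + 1)]→L[ℝ] ℝ from α (f p x)) (funext fun i => ?_)
  refine Fin.cases ?_ (fun i => rfl) i
  exact hw.symm

variable (I E) in
/-- The velocity of the path is everywhere tangent to the images of its members. -/
def IsTangentPath (f : ℝ → L → X) : Prop :=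
  ∀ s ∈ Set.Icc (0 : ℝ) 1, ∀ x : L, ∃ w : V, (mfderiv I 𝓘(ℝ, E) (f s) x w : E) =
    (mfderivWithin 𝓘(ℝ, ℝ) 𝓘(ℝ, E) (fun q => f q x) (Set.Icc 0 1) s (1 : ℝ) : E)

/-- Invariance of the flux: if a square of maps annihilates a closed form and its horizontal edges
move tangentially, then the flux forms of its vertical edges are cohomologous. -/
theorem pathForm_sub_mem_exactForms {α : DiffForm 𝓘(ℝ, E) X (k + 1) ℝ}
    (hα : IsSmoothForm 𝓘(ℝ, E) ∞ α) (hα0 : HasExtDeriv 𝓘(ℝ, E) α 0)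
    {f : ℝ × ℝ → L → X} (hf : IsSmoothFamily unitSquare E I f)
    (h0 : ∀ p ∈ unitSquare, pullback I 𝓘(ℝ, E) (f p) α = 0)
    (hbot : IsTangentPath E I fun u => f (u, 0)) (htop : IsTangentPath E I fun u => f (u, 1)) :
    pathForm I α (fun t => f (1, t)) - pathForm I α (fun t => f (0, t)) ∈ exactForms I L k := by
  have hvert : ∀ u ∈ Set.Icc (0 : ℝ) 1,
      Set.MapsTo (fun t : ℝ => (u, t)) (Set.Icc 0 1) unitSquare := fun u hu t ht => ⟨hu, ht⟩
  have hhor : ∀ t ∈ Set.Icc (0 : ℝ) 1,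
      Set.MapsTo (fun u : ℝ => (u, t)) (Set.Icc 0 1) unitSquare := fun t ht u hu => ⟨hu, ht⟩
  have hfv : ∀ u ∈ Set.Icc (0 : ℝ) 1, IsSmoothFamily (Set.Icc (0 : ℝ) 1) E I fun t => f (u, t) :=
    fun u hu => hf.comp_param (by fun_prop) (hvert u hu)
  have hzero : ∀ t ∈ ({0, 1} : Set ℝ), ∀ u ∈ Set.Icc (0 : ℝ) 1, ∀ x : L,
      familyForm unitSquare I α f (1, 0) (u, t) x = 0 := by
    intro t ht u hu x
    have htI : t ∈ Set.Icc (0 : ℝ) 1 := by rcases ht with rfl | rfl <;> simp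
    have htan : IsTangentPath E I fun u => f (u, t) := by
      rcases ht with rfl | rfl
      exacts [hbot, htop]
    rw [← hf.familyForm_line α hu (hasDerivWithinAt_horizontal u t _) (hhor t htI) x]
    exact familyForm_eq_zero_of_tangent (h0 _ ⟨hu, htI⟩) (htan u hu x)
  have hchart : ∀ u ∈ Set.Icc (0 : ℝ) 1, ∀ x₀ : L, ∀ y ∈ (extChartAt I x₀).target,
      formInChart I (pathForm I α fun t => f (u, t)) x₀ y = ∫ t in (0 : ℝ)..1,
        contractInr ((0, 1) : ℝ × ℝ) (familyPulledForm I unitSquare α f x₀ ((u, t), y)) := by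
    intro u hu x₀ y hy
    rw [formInChart_pathForm hα (hfv u hu) x₀ hy]
    refine intervalIntegral.integral_congr fun t ht => ?_
    rw [Set.uIcc_of_le zero_le_one] at ht
    refine ((hfv u hu).contractInr_familyPulledForm α uniqueDiffOn_unitInterval x₀ ht hy 1).trans ?_
    rw [hf.familyForm_line α ht (hasDerivWithinAt_vertical u t _) (hvert u hu)]
    exact (hf.contractInr_familyPulledForm α uniqueDiffOn_square x₀ ⟨hu, ht⟩ hy (0, 1)).symm
  have hedge : ∀ x₀ : L, ∀ y ∈ (extChartAt I x₀).target, ∀ u ∈ Set.Icc (0 : ℝ) 1,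
      ∀ t ∈ ({0, 1} : Set ℝ),
      contractInr ((1, 0) : ℝ × ℝ) (familyPulledForm I unitSquare α f x₀ ((u, t), y)) = 0 := by
    intro x₀ y hy u hu t ht
    have htI : t ∈ Set.Icc (0 : ℝ) 1 := by rcases ht with rfl | rfl <;> simp
    rw [hf.contractInr_familyPulledForm α uniqueDiffOn_square x₀ ⟨hu, htI⟩ hy,
      hzero t ht u hu]
    rfl
  have hclosed := hf.extDerivWithin_familyPulledForm hα hα0 uniqueDiffOn_square
    (prod_subset_closure_interior Icc_subset_closure_interior Icc_subset_closure_interior)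
  have hsm := hf.contDiffOn_familyPulledForm hα uniqueDiffOn_square
  -- In degree zero only the zero form is exact, so there the two flux functions must coincide.
  cases k with
  | zero =>
    have heq : ∀ x : L, ∀ v : Fin 0 → V,
        (pathForm I α (fun t => f (1, t)) x : V [⋀^Fin 0]→L[ℝ] ℝ) v =
        (pathForm I α (fun t => f (0, t)) x : V [⋀^Fin 0]→L[ℝ] ℝ) v := by
      intro x v
      have hy := mem_extChartAt_target (I := I) x
      have h1 := intervalIntegral_contractInr_eq (uniqueDiffOn_extChartAt_target x) (hsm x)
        (hclosed x) hy (hedge x _ hy)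
      rw [← hchart 1 (by simp) x _ hy, ← hchart 0 (by simp) x _ hy] at h1
      have h2 := DFunLike.congr_fun h1 v
      have hx : (extChartAt I x).symm (extChartAt I x x) = x := extChartAt_to_inv x
      -- A 0-form takes no vectors, so its chart expression is simply its value at the point.
      have h3 : ∀ g : ℝ → L → X, formInChart I (pathForm I α g) x (extChartAt I x x) v =
          (pathForm I α g x : V [⋀^Fin 0]→L[ℝ] ℝ) v := by
        intro g
        refine Eq.trans (b := (show V [⋀^Fin 0]→L[ℝ] ℝ from
          pathForm I α g ((extChartAt I x).symm (extChartAt I x x))) v) ?_ ?_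
        · exact congrArg (show V [⋀^Fin 0]→L[ℝ] ℝ from
            pathForm I α g ((extChartAt I x).symm (extChartAt I x x)))
            (Subsingleton.elim (α := Fin 0 → V) _ _)
        · exact congrArg (fun z : L => (show V [⋀^Fin 0]→L[ℝ] ℝ from pathForm I α g z) v) hx
      rwa [h3, h3] at h2
    refine (Submodule.mem_bot ℝ).2 (sub_eq_zero.2 (funext fun x => ?_))
    ext v
    exact heq x v
  | succ k =>
    -- The sign is that of the exterior derivative in `extDerivWithin_squarePrimitive`.
    refine ⟨-squareForm I α f, ?_, fun x₀ y hy => ?_⟩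
    · have := (isSmoothForm_squareForm hα hf).smul (-1 : ℝ)
      simpa using this
    · have hU := uniqueDiffOn_extChartAt_target (I := I) x₀
      have hneg : ∀ β : DiffForm I L k ℝ, formInChart I (-β) x₀ = -formInChart I β x₀ :=
        fun β => rfl
      have hsub : ∀ β γ : DiffForm I L (k + 1) ℝ, formInChart I (β - γ) x₀ y =
          formInChart I β x₀ y - formInChart I γ x₀ y := fun β γ => rfl
      rw [hsub, hchart 1 (by simp) x₀ y hy, hchart 0 (by simp) x₀ y hy,
        extDerivWithin_squarePrimitive (locallyConvexSet_extChartAt_target I x₀) hU (hsm x₀)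
          (hclosed x₀) hy (hedge x₀ y hy), hneg]
      have h1 := extDerivWithin_smul (-1 : ℝ) (formInChart I (squareForm I α f) x₀) (hU y hy)
      rw [neg_one_smul, neg_one_smul] at h1
      rw [h1, extDerivWithin_congr' (formInChart_squareForm hα hf x₀) hy]

end PathForm

/-! ### Continuity of reparametrizations -/

section Equicontinuity

open Filter

variable {P L X : Type*} [TopologicalSpace P] [TopologicalSpace L] [CompactSpace L] [T2Space L]
  [LocallyConnectedSpace L] [TopologicalSpace X] [T2Space X] {S : Set P} {f g : P → L → X}
  {ψ η : P → L → L} {p₀ : P}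

/-- Continuous solutions of `f_p ∘ ψ_p = g_p`, with `f_{p₀}` locally injective, that converge at a
point converge locally uniformly. -/
theorem tendsto_prod_of_tendsto_apply
    (hf : ContinuousOn (fun z : P × L => f z.1 z.2) (S ×ˢ Set.univ))
    (hg : ContinuousOn (fun z : P × L => g z.1 z.2) (S ×ˢ Set.univ)) (hp₀ : p₀ ∈ S)
    (hψ : ∀ p ∈ S, Continuous (ψ p)) (hfg : ∀ p ∈ S, ∀ x, f p (ψ p x) = g p x)
    (hinj : ∀ y, ∃ N ∈ 𝓝 y, Set.InjOn (f p₀) N)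
    {l : Filter P} (hl : l ≤ 𝓝[S] p₀) {x₀ y₀ : L} (hy₀ : f p₀ y₀ = g p₀ x₀)
    (hlim : Tendsto (fun p => ψ p x₀) l (𝓝 y₀)) :
    Tendsto (fun z : P × L => ψ z.1 z.2) (l ×ˢ 𝓝 x₀) (𝓝 y₀) := by
  intro N hN
  obtain ⟨N₀, hN₀, hinj₀⟩ := hinj y₀
  obtain ⟨K, hK, hKc, hKN⟩ := exists_mem_nhds_isClosed_subset (inter_mem hN hN₀)
  have hcomp : IsCompact (frontier K) := isClosed_frontier.isCompact
  -- By injectivity of f_{p₀} near y₀, no point of the compact frontier of K solves f_{p₀}(y) =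
  -- g_{p₀}(x₀). This persists for nearby (p,x).
  have hev : ∀ᶠ z : P × L in 𝓝 (p₀, x₀), ∀ y ∈ frontier K, z.1 ∈ S → f z.1 y ≠ g z.1 z.2 := by
    refine hcomp.eventually_forall_of_forall_eventually fun y hy => ?_
    have hne : f p₀ y ≠ g p₀ x₀ := by
      rw [← hy₀]
      intro h
      have hyK : y ∈ K := hKc.frontier_subset hy
      have : y = y₀ := hinj₀ (hKN hyK).2 (mem_of_mem_nhds hN₀) h
      subst this
      exact hy.2 (mem_interior_iff_mem_nhds.2 hK)
    have h1 : ContinuousWithinAt (fun w : (P × L) × L => f w.1.1 w.2)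
        ((S ×ˢ Set.univ) ×ˢ Set.univ) ((p₀, x₀), y) :=
      (hf (p₀, y) ⟨hp₀, trivial⟩).comp (f := fun w : (P × L) × L => (w.1.1, w.2))
        (x := ((p₀, x₀), y)) (by fun_prop) fun w hw => ⟨hw.1.1, trivial⟩
    have h2 : ContinuousWithinAt (fun w : (P × L) × L => g w.1.1 w.1.2)
        ((S ×ˢ Set.univ) ×ˢ Set.univ) ((p₀, x₀), y) :=
      (hg (p₀, x₀) ⟨hp₀, trivial⟩).comp (f := fun w : (P × L) × L => w.1)
        (x := ((p₀, x₀), y)) (by fun_prop) fun w hw => hw.1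
    have h3 : ∀ᶠ w in 𝓝[(S ×ˢ Set.univ) ×ˢ Set.univ] ((p₀, x₀), y), f w.1.1 w.2 ≠ g w.1.1 w.1.2 :=
      (h1.tendsto.prodMk_nhds h2.tendsto) (isClosed_diagonal.isOpen_compl.mem_nhds hne)
    rw [eventually_nhdsWithin_iff] at h3
    filter_upwards [h3] with w hw hwS using hw ⟨⟨hwS, trivial⟩, trivial⟩
  rw [nhds_prod_eq] at hev
  obtain ⟨M, hM, A, hA, hMA⟩ := eventually_prod_iff.1 hev
  obtain ⟨A', hA', hA'c, hA'A⟩ := locallyConnectedSpace_iff_connected_subsets.1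
    (inferInstanceAs (LocallyConnectedSpace L)) x₀ _ hA
  have h1 : ∀ᶠ p in l, M p := (hl.trans nhdsWithin_le_nhds) hM
  have h2 : ∀ᶠ p in l, p ∈ S := hl self_mem_nhdsWithin
  have h3 : ∀ᶠ p in l, ψ p x₀ ∈ interior K := hlim (interior_mem_nhds.2 hK)
  have h4 : ∀ᶠ z : P × L in l ×ˢ 𝓝 x₀, ψ z.1 z.2 ∈ N := by
    filter_upwards [(h1.and (h2.and h3)).prod_mk hA'] with z hz
    obtain ⟨⟨hMz, hSz, hKz⟩, hAz⟩ := hz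
    -- The image of the connected neighbourhood A' under ψ_p meets the interior of K at ψ_p(x₀) and
    -- cannot cross the frontier, so it is trapped in K.
    have hconn : IsPreconnected (ψ z.1 '' A') := hA'c.image _ (hψ _ hSz).continuousOn
    have hsub : ψ z.1 '' A' ⊆ interior K := by
      refine hconn.subset_of_closure_inter_subset isOpen_interior
        ⟨ψ z.1 x₀, Set.mem_image_of_mem _ (mem_of_mem_nhds hA'), hKz⟩ ?_
      rintro _ ⟨hcl, x, hx, rfl⟩
      by_contra hnot
      refine hMA hMz (hA'A hx) (ψ z.1 x) ⟨?_, hnot⟩ hSz (hfg _ hSz x)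
      exact closure_mono interior_subset hcl
    exact (hKN (interior_subset (hsub (Set.mem_image_of_mem _ hAz)))).1
  exact h4

/-- Limits along an ultrafilter of homeomorphisms `ψ_p` with `f_p ∘ ψ_p = g_p`. -/
theorem exists_limit_homeomorph
    (hf : ContinuousOn (fun z : P × L => f z.1 z.2) (S ×ˢ Set.univ))
    (hg : ContinuousOn (fun z : P × L => g z.1 z.2) (S ×ˢ Set.univ)) (hp₀ : p₀ ∈ S)
    (hψ : ∀ p ∈ S, Continuous (ψ p)) (hη : ∀ p ∈ S, Continuous (η p))
    (hψη : ∀ p ∈ S, ∀ x, ψ p (η p x) = x) (hηψ : ∀ p ∈ S, ∀ x, η p (ψ p x) = x)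
    (hfg : ∀ p ∈ S, ∀ x, f p (ψ p x) = g p x)
    (hfinj : ∀ y, ∃ N ∈ 𝓝 y, Set.InjOn (f p₀) N) (hginj : ∀ y, ∃ N ∈ 𝓝 y, Set.InjOn (g p₀) N)
    (l : Ultrafilter P) (hl : (l : Filter P) ≤ 𝓝[S] p₀) :
    ∃ ψ' η' : L → L, Continuous ψ' ∧ Continuous η' ∧ (∀ x, ψ' (η' x) = x) ∧
      (∀ x, η' (ψ' x) = x) ∧ (∀ x, f p₀ (ψ' x) = g p₀ x) ∧ (∀ x, g p₀ (η' x) = f p₀ x) ∧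
      ∀ x, Tendsto (fun p => ψ p x) l (𝓝 (ψ' x)) := by
  have hS : ∀ᶠ p in (l : Filter P), p ∈ S := hl self_mem_nhdsWithin
  have hgf : ∀ p ∈ S, ∀ x, g p (η p x) = f p x := fun p hp x => by
    rw [← hfg p hp, hψη p hp]
  -- Compactness of L gives pointwise limits along an ultrafilter. Continuity of the limits, and the
  -- fact that those of ψ and η are mutually inverse, come from the locally uniform convergence in
  -- `tendsto_prod_of_tendsto_apply`.
  have hex : ∀ (φ : P → L → L) (x : L), ∃ y, Tendsto (fun p => φ p x) l (𝓝 y) := fun φ x => by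
    obtain ⟨y, -, hy⟩ := isCompact_univ.ultrafilter_le_nhds (l.map fun p => φ p x) (by simp)
    exact ⟨y, hy⟩
  have hval : ∀ {a b : P → L → X} {φ : P → L → L},
      ContinuousOn (fun z : P × L => a z.1 z.2) (S ×ˢ Set.univ) →
      ContinuousOn (fun z : P × L => b z.1 z.2) (S ×ˢ Set.univ) →
      (∀ p ∈ S, ∀ x, a p (φ p x) = b p x) → ∀ {x y : L}, Tendsto (fun p => φ p x) l (𝓝 y) →
      a p₀ y = b p₀ x := by
    intro a b φ ha hb hab x y hy
    have hS' : Tendsto (fun p => p) (l : Filter P) (𝓝 p₀) := hl.trans nhdsWithin_le_nhds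
    have h1 : Tendsto (fun p => a p (φ p x)) l (𝓝 (a p₀ y)) :=
      (ha (p₀, y) ⟨hp₀, trivial⟩).tendsto.comp (tendsto_nhdsWithin_iff.2
        ⟨hS'.prodMk_nhds hy, hS.mono fun p hp => ⟨hp, trivial⟩⟩)
    have h2 : Tendsto (fun p => b p x) l (𝓝 (b p₀ x)) :=
      (hb (p₀, x) ⟨hp₀, trivial⟩).tendsto.comp (tendsto_nhdsWithin_iff.2
        ⟨hS'.prodMk_nhds tendsto_const_nhds, hS.mono fun p hp => ⟨hp, trivial⟩⟩)
    exact tendsto_nhds_unique (h1.congr' (hS.mono fun p hp => hab p hp x)) h2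
  have hcont : ∀ {φ : P → L → L} {φ' : L → L},
      (∀ x, Tendsto (fun p => φ p x) l (𝓝 (φ' x))) →
      (∀ x, Tendsto (fun z : P × L => φ z.1 z.2) (l ×ˢ 𝓝 x) (𝓝 (φ' x))) → Continuous φ' := by
    intro φ φ' h1 h2
    rw [continuous_iff_continuousAt]
    intro x
    rw [ContinuousAt, (closed_nhds_basis (φ' x)).tendsto_right_iff]
    rintro K ⟨hK, hKc⟩
    obtain ⟨M, hM, A, hA, hMA⟩ := eventually_prod_iff.1 (h2 x hK)
    filter_upwards [hA] with x' hx'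
    exact hKc.mem_of_tendsto (h1 x') (hM.mono fun p hp => hMA hp hx')
  choose ψ' hψ' using hex ψ
  choose η' hη' using hex η
  have hfv : ∀ x, f p₀ (ψ' x) = g p₀ x := fun x => hval hf hg hfg (hψ' x)
  have hgv : ∀ x, g p₀ (η' x) = f p₀ x := fun x => hval hg hf hgf (hη' x)
  have hψ₂ : ∀ x, Tendsto (fun z : P × L => ψ z.1 z.2) (l ×ˢ 𝓝 x) (𝓝 (ψ' x)) := fun x =>
    tendsto_prod_of_tendsto_apply hf hg hp₀ hψ hfg hfinj hl (hfv x) (hψ' x)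
  have hη₂ : ∀ x, Tendsto (fun z : P × L => η z.1 z.2) (l ×ˢ 𝓝 x) (𝓝 (η' x)) := fun x =>
    tendsto_prod_of_tendsto_apply hg hf hp₀ hη hgf hginj hl (hgv x) (hη' x)
  have hinv : ∀ {φ χ : P → L → L} {φ' χ' : L → L},
      (∀ x, Tendsto (fun z : P × L => φ z.1 z.2) (l ×ˢ 𝓝 x) (𝓝 (φ' x))) →
      (∀ x, Tendsto (fun p => χ p x) l (𝓝 (χ' x))) → (∀ p ∈ S, ∀ x, φ p (χ p x) = x) →
      ∀ x, φ' (χ' x) = x := by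
    intro φ χ φ' χ' h1 h2 h3 x
    have h4 : Tendsto (fun p => φ p (χ p x)) l (𝓝 (φ' (χ' x))) :=
      (h1 (χ' x)).comp (tendsto_id.prodMk (h2 x))
    exact tendsto_nhds_unique h4
      (tendsto_const_nhds.congr' (hS.mono fun p hp => (h3 p hp x).symm))
  exact ⟨ψ', η', hcont hψ' hψ₂, hcont hη' hη₂, hinv hψ₂ hη' hψη, hinv hη₂ hψ' hηψ, hfv, hgv, hψ'⟩

end Equicontinuity

theorem locallyConnectedSpace_of_modelWithCorners {V : Type*} [NormedAddCommGroup V]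
    [NormedSpace ℝ V] {H : Type*} [TopologicalSpace H] (I : ModelWithCorners ℝ V H)
    (L : Type*) [TopologicalSpace L] [ChartedSpace H L] : LocallyConnectedSpace L := by
  refine locallyConnectedSpace_iff_connected_subsets.2 fun x N hN => ?_
  have hx : extChartAt I x x ∈ (extChartAt I x).target := mem_extChartAt_target x
  have h1 : (extChartAt I x).symm ⁻¹' N ∈ 𝓝 (extChartAt I x x) :=
    (continuousAt_extChartAt_symm x).preimage_mem_nhds (by rwa [extChartAt_to_inv])
  obtain ⟨ε, hε, hball⟩ := Metric.mem_nhdsWithin_iff.1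
    (Filter.inter_mem (mem_nhdsWithin_of_mem_nhds h1) (extChartAt_target_mem_nhdsWithin (I := I) x))
  refine ⟨(extChartAt I x).symm '' (Metric.ball (extChartAt I x x) ε ∩ Set.range I), ?_, ?_, ?_⟩
  · filter_upwards [extChartAt_source_mem_nhds (I := I) x,
      (continuousAt_extChartAt (I := I) x).preimage_mem_nhds (Metric.ball_mem_nhds _ hε)]
      with z hz hzb
    exact ⟨extChartAt I x z, ⟨hzb, extChartAt_target_subset_range x
      ((extChartAt I x).map_source hz)⟩, (extChartAt I x).left_inv hz⟩
  · refine ((convex_ball _ ε).inter I.convex_range).isPreconnected.image _ ?_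
    exact (continuousOn_extChartAt_symm x).mono fun z hz => (hball hz).2
  · rintro _ ⟨z, hz, rfl⟩
    exact (hball hz).1

/-! ### Smoothness of reparametrizations -/

theorem LocallyConvexSet.inter_isOpen {W : Type*} [NormedAddCommGroup W] [NormedSpace ℝ W]
    {s o : Set W} (hs : LocallyConvexSet s) (ho : IsOpen o) : LocallyConvexSet (s ∩ o) := by
  intro y hy
  obtain ⟨c, hc, hcs, hcc⟩ := hs y hy.1
  obtain ⟨ε, hε, hball⟩ := Metric.isOpen_iff.1 ho y hy.2
  refine ⟨c ∩ Metric.ball y ε, Filter.inter_mem (nhdsWithin_mono y Set.inter_subset_left hc)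
    (mem_nhdsWithin_of_mem_nhds (Metric.ball_mem_nhds y hε)),
    Set.inter_subset_inter hcs hball, hcc.inter (convex_ball y ε)⟩

/-- With B' a left inverse of the derivative at w, the map B' ∘ F - id has derivative zero at w, so
it is 1/2-Lipschitz on a small convex neighbourhood. Then F a = F b forces ‖b - a‖ ≤ ‖b - a‖ / 2. -/
theorem exists_injOn_of_injective_fderivWithin {R E : Type*} [NormedAddCommGroup R]
    [NormedSpace ℝ R] [FiniteDimensional ℝ R] [NormedAddCommGroup E] [NormedSpace ℝ E]
    [FiniteDimensional ℝ E] {F : R → E} {T : Set R} (hT : UniqueDiffOn ℝ T)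
    (hTc : LocallyConvexSet T) (hF : ContDiffOn ℝ ∞ F T) {w : R} (hw : w ∈ T)
    (hinj : Function.Injective (fderivWithin ℝ F T w)) : ∃ N ∈ 𝓝[T] w, Set.InjOn F N := by
  obtain ⟨B, hB⟩ := LinearMap.exists_leftInverse_of_injective
    (fderivWithin ℝ F T w : R →ₗ[ℝ] E) (LinearMap.ker_eq_bot.2 hinj)
  set B' : E →L[ℝ] R := LinearMap.toContinuousLinearMap B
  have hd : ∀ z ∈ T, HasFDerivWithinAt (fun z => B' (F z) - z)
      (B'.comp (fderivWithin ℝ F T z) - ContinuousLinearMap.id ℝ R) T z := fun z hz =>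
    (B'.hasFDerivAt.comp_hasFDerivWithinAt _
      ((hF.differentiableOn (by simp)) _ hz).hasFDerivWithinAt).sub (hasFDerivWithinAt_id z T)
  have hc : ContinuousOn
      (fun z => B'.comp (fderivWithin ℝ F T z) - ContinuousLinearMap.id ℝ R) T :=
    (continuousOn_const.clm_comp (hF.continuousOn_fderivWithin hT (by simp))).sub
      continuousOn_const
  have h0 : B'.comp (fderivWithin ℝ F T w) - ContinuousLinearMap.id ℝ R = 0 := by
    rw [sub_eq_zero]
    ext v
    exact LinearMap.congr_fun hB v
  have hsmall : ∀ᶠ z in 𝓝[T] w,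
      ‖B'.comp (fderivWithin ℝ F T z) - ContinuousLinearMap.id ℝ R‖ < 1 / 2 := by
    have := (hc w hw).norm
    rw [ContinuousWithinAt, h0, norm_zero] at this
    exact this.eventually (gt_mem_nhds (by norm_num))
  obtain ⟨c, hcw, hcT, hcc⟩ := hTc w hw
  obtain ⟨ε, hε, hball⟩ := Metric.mem_nhdsWithin_iff.1 (Filter.inter_mem hcw hsmall)
  refine ⟨c ∩ Metric.ball w ε, Filter.inter_mem hcw
    (mem_nhdsWithin_of_mem_nhds (Metric.ball_mem_nhds w hε)), fun a ha b hb hab => ?_⟩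
  have h1 := (hcc.inter (convex_ball w ε)).norm_image_sub_le_of_norm_hasFDerivWithin_le
    (C := 1 / 2) (fun z hz => (hd z (hcT hz.1)).mono fun z' hz' => hcT hz'.1)
    (fun z hz => (hball ⟨hz.2, hcT hz.1⟩).2.le) ha hb
  have h2 : B' (F b) - b - (B' (F a) - a) = -(b - a) := by rw [hab]; abel
  rw [h2, norm_neg] at h1
  have h3 : ‖b - a‖ = 0 := by linarith [norm_nonneg (b - a)]
  exact (sub_eq_zero.1 (norm_eq_zero.1 h3)).symm

/-! ### Families of immersions, through their graphs in charts. -/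

section Immersions

variable {E : Type*} [NormedAddCommGroup E] [NormedSpace ℝ E]
  {X : Type*} [TopologicalSpace X] [ChartedSpace E X] [IsManifold 𝓘(ℝ, E) ∞ X]
  {V : Type*} [NormedAddCommGroup V] [NormedSpace ℝ V]
  {H : Type*} [TopologicalSpace H] {I : ModelWithCorners ℝ V H}
  {L : Type*} [TopologicalSpace L] [ChartedSpace H L] [IsManifold I ∞ L]
  {P : Type*} [NormedAddCommGroup P] [NormedSpace ℝ P] {S : Set P}

variable (I) in
/-- The map `(p, y) ↦ (p, f_p(y))` in charts. -/
def graphInCharts (f : P → L → X) (y₀ : L) (z₀ : X) (w : P × V) : P × E :=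
  (w.1, extChartAt 𝓘(ℝ, E) z₀ (chartFamily I f y₀ w))

/-- Keeping the parameter as a coordinate turns a family of immersions into one immersion: a vector
(a,v) in the kernel has a = 0, and then v is killed by the derivative of f_{p₀}. -/
theorem IsSmoothFamily.exists_graphInCharts {f : P → L → X} (hf : IsSmoothFamily S E I f)
    (hS : UniqueDiffOn ℝ S) {p₀ : P} (hp₀ : p₀ ∈ S)
    (hinj : ∀ y, Function.Injective (mfderiv I 𝓘(ℝ, E) (f p₀) y)) (y₀ : L) :
    ∃ (z₀ : X) (o : Set (P × V)), IsOpen o ∧ (p₀, extChartAt I y₀ y₀) ∈ o ∧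
      Set.MapsTo (chartFamily I f y₀) (S ×ˢ (extChartAt I y₀).target ∩ o)
        (extChartAt 𝓘(ℝ, E) z₀).source ∧
      ContDiffOn ℝ ∞ (graphInCharts (E := E) I f y₀ z₀) (S ×ˢ (extChartAt I y₀).target ∩ o) ∧
      Function.Injective (fderivWithin ℝ (graphInCharts (E := E) I f y₀ z₀)
        (S ×ˢ (extChartAt I y₀).target ∩ o) (p₀, extChartAt I y₀ y₀)) := by
  have : IsManifold I 1 L := .of_le (n := ∞) (by simp)
  have : IsManifold 𝓘(ℝ, E) 1 X := .of_le (n := ∞) (by simp)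
  set w : P × V := (p₀, extChartAt I y₀ y₀)
  set D := S ×ˢ (extChartAt I y₀).target
  set G := chartFamily I f y₀ with hGdef
  have hy : extChartAt I y₀ y₀ ∈ (extChartAt I y₀).target := mem_extChartAt_target y₀
  have hw : w ∈ D := ⟨hp₀, hy⟩
  have hG : ContMDiffOn 𝓘(ℝ, P × V) 𝓘(ℝ, E) ∞ G D := hf.contMDiffOn_chartFamily y₀
  have hD : UniqueDiffOn ℝ D := hS.prod (uniqueDiffOn_extChartAt_target y₀)
  obtain ⟨o, ho, hoD⟩ := continuousOn_iff'.1 hG.continuousOn _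
    (isOpen_extChartAt_source (I := 𝓘(ℝ, E)) (G w))
  have hmaps : Set.MapsTo G (D ∩ o) (extChartAt 𝓘(ℝ, E) (G w)).source := fun w' hw' => by
    have : w' ∈ G ⁻¹' (extChartAt 𝓘(ℝ, E) (G w)).source ∩ D := hoD ▸ ⟨hw'.2, hw'.1⟩
    exact this.1
  have hwo : w ∈ o := by
    have : w ∈ G ⁻¹' (extChartAt 𝓘(ℝ, E) (G w)).source ∩ D := ⟨mem_extChartAt_source _, hw⟩
    exact (hoD ▸ this : w ∈ o ∩ D).1
  refine ⟨G w, o, ho, hwo, hmaps, ?_, ?_⟩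
  · refine ContDiffOn.prodMk contDiffOn_fst ?_
    rw [← contMDiffOn_iff_contDiffOn]
    refine (contMDiffOn_extChartAt (I := 𝓘(ℝ, E)) (x := G w) (n := ∞)).comp
      (hG.mono Set.inter_subset_left) fun w' hw' => ?_
    have := hmaps hw'
    rwa [extChartAt_source] at this
  · set D₁ : P × V →L[ℝ] E := mfderivWithin 𝓘(ℝ, P × V) 𝓘(ℝ, E) G D w with hD₁
    set D₂ : E →L[ℝ] E := mfderiv 𝓘(ℝ, E) 𝓘(ℝ, E) (extChartAt 𝓘(ℝ, E) (G w)) (G w)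
    have h1 : HasMFDerivWithinAt 𝓘(ℝ, P × V) 𝓘(ℝ, E) G (D ∩ o) w D₁ :=
      (((hG w hw).mdifferentiableWithinAt (by simp)).hasMFDerivWithinAt).mono
        Set.inter_subset_left
    have h2 : HasMFDerivAt 𝓘(ℝ, E) 𝓘(ℝ, E) (extChartAt 𝓘(ℝ, E) (G w)) (G w) D₂ :=
      (mdifferentiableAt_extChartAt (I := 𝓘(ℝ, E)) (mem_chart_source E (G w))).hasMFDerivAt
    have h3 : HasFDerivWithinAt (extChartAt 𝓘(ℝ, E) (G w) ∘ G) (D₂.comp D₁) (D ∩ o) w :=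
      (h2.comp_hasMFDerivWithinAt w h1).hasFDerivWithinAt
    have h4 : fderivWithin ℝ (graphInCharts (E := E) I f y₀ (G w)) (D ∩ o) w =
        (ContinuousLinearMap.fst ℝ P V).prod (D₂.comp D₁) :=
      (HasFDerivWithinAt.prodMk hasFDerivWithinAt_fst h3).fderivWithin
        ((hD.inter ho) w ⟨hw, hwo⟩)
    rw [h4, injective_iff_map_eq_zero]
    rintro ⟨a, v⟩ hav
    obtain ⟨rfl, hav⟩ : a = 0 ∧ D₂ (D₁ (a, v)) = 0 := Prod.mk_eq_zero.1 hav
    have h5 : D₁ (0, v) = 0 := by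
      have h6 := DFunLike.congr_fun (mfderivWithin_extChartAt_symm_comp_mfderiv_extChartAt'
        (I := 𝓘(ℝ, E)) (mem_extChartAt_source (I := 𝓘(ℝ, E)) (G w))) (D₁ (0, v))
      refine h6.symm.trans ?_
      exact (congrArg _ hav).trans (ContinuousLinearMap.map_zero _)
    have h7 := (hf.mfderivWithin_chartFamily_inr hS y₀ hp₀ hy v).symm.trans h5
    have h8 := (injective_iff_map_eq_zero _).1 (hinj _) _ h7
    have h9 := DFunLike.congr_fun (mfderiv_extChartAt_comp_mfderivWithin_extChartAt_symm
      (I := I) hy) v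
    have h10 : v = 0 := by
      refine h9.symm.trans ?_
      exact (congrArg _ h8).trans (ContinuousLinearMap.map_zero _)
    rw [h10]
    rfl

theorem exists_injOn_of_immersion [FiniteDimensional ℝ E] [FiniteDimensional ℝ V] {f : L → X}
    (hf : IsSmoothImmersion I 𝓘(ℝ, E) f) (y : L) : ∃ N ∈ 𝓝 y, Set.InjOn f N := by
  have hF : IsSmoothFamily (Set.univ : Set ℝ) E I fun _ => f :=
    (hf.1.comp contMDiff_snd).contMDiffOn
  obtain ⟨z₀, o, ho, hyo, hmaps, hsm, hinj⟩ :=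
    hF.exists_graphInCharts uniqueDiffOn_univ (p₀ := 0) trivial hf.2 y
  have hU : UniqueDiffOn ℝ ((Set.univ : Set ℝ) ×ˢ (extChartAt I y).target) :=
    uniqueDiffOn_univ.prod (uniqueDiffOn_extChartAt_target y)
  have hy : ((0 : ℝ), extChartAt I y y) ∈ (Set.univ : Set ℝ) ×ˢ (extChartAt I y).target :=
    ⟨trivial, mem_extChartAt_target y⟩
  have hc : LocallyConvexSet ((Set.univ : Set ℝ) ×ˢ (extChartAt I y).target ∩ o) := by
    exact ((Convex.locallyConvexSet convex_univ).prod
      (locallyConvexSet_extChartAt_target I y)).inter_isOpen ho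
  obtain ⟨N, hN, hNi⟩ := exists_injOn_of_injective_fderivWithin (hU.inter ho) hc hsm
    ⟨hy, hyo⟩ hinj
  rw [nhdsWithin_inter_of_mem' (mem_nhdsWithin_of_mem_nhds (ho.mem_nhds hyo))] at hN
  have h1 : ContinuousWithinAt (fun x : L => ((0 : ℝ), extChartAt I y x))
      (extChartAt I y).source y :=
    continuousWithinAt_const.prodMk (continuousAt_extChartAt y).continuousWithinAt
  have h2 := tendsto_nhdsWithin_iff.2 ⟨h1.tendsto, eventually_nhdsWithin_of_forall
    (p := fun x : L => ((0 : ℝ), extChartAt I y x) ∈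
      (Set.univ : Set ℝ) ×ˢ (extChartAt I y).target)
    fun x hx => ⟨trivial, (extChartAt I y).map_source hx⟩⟩ hN
  rw [nhdsWithin_eq_nhds.2 (extChartAt_source_mem_nhds y)] at h2
  refine ⟨_, Filter.inter_mem h2 (extChartAt_source_mem_nhds (I := I) y), fun a ha b hb hab => ?_⟩
  have h3 := hNi ha.1 hb.1 (by
    simp only [graphInCharts, chartFamily, (extChartAt I y).left_inv ha.2,
      (extChartAt I y).left_inv hb.2, hab])
  exact (extChartAt I y).injOn ha.2 hb.2 (congrArg Prod.snd h3)

/-- A continuous family `ψ_p` with `f_p ∘ ψ_p = g_p`, for smooth families `f` of immersions and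
`g`, is smooth. -/
theorem IsSmoothFamily.contMDiffOn_of_comp_eq [FiniteDimensional ℝ E] [FiniteDimensional ℝ V]
    [FiniteDimensional ℝ P] {f g : P → L → X} {ψ : P → L → L} (hf : IsSmoothFamily S E I f)
    (hg : IsSmoothFamily S E I g) (hS : UniqueDiffOn ℝ S)
    (hinj : ∀ p ∈ S, ∀ y, Function.Injective (mfderiv I 𝓘(ℝ, E) (f p) y))
    (hψ : ContinuousOn (fun z : P × L => ψ z.1 z.2) (S ×ˢ Set.univ))
    (hfg : ∀ p ∈ S, ∀ x, f p (ψ p x) = g p x) :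
    ContMDiffOn (𝓘(ℝ, P).prod I) I ∞ (fun z : P × L => ψ z.1 z.2) (S ×ˢ Set.univ) := by
  rintro ⟨p₀, x₀⟩ ⟨hp₀ : p₀ ∈ S, -⟩
  set y₀ := ψ p₀ x₀ with hy₀
  obtain ⟨z₀, o, ho, hyo, hmaps, hsm, hDinj⟩ := hf.exists_graphInCharts hS hp₀ (hinj p₀ hp₀) y₀
  set D := S ×ˢ (extChartAt I x₀).target with hDdef
  have hD : UniqueDiffOn ℝ D := hS.prod (uniqueDiffOn_extChartAt_target x₀)
  have hT : UniqueDiffOn ℝ (S ×ˢ (extChartAt I y₀).target ∩ o) :=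
    (hS.prod (uniqueDiffOn_extChartAt_target y₀)).inter ho
  set q₀ : P × V := (p₀, extChartAt I x₀ x₀)
  have hq₀ : q₀ ∈ D := ⟨hp₀, mem_extChartAt_target x₀⟩
  set ψ₁ : P × V → L := fun q => ψ q.1 ((extChartAt I x₀).symm q.2) with hψ₁
  have hψ₁q : ψ₁ q₀ = y₀ := by simp [hψ₁, q₀, hy₀]
  have hψ₁c : ContinuousOn ψ₁ D := by
    refine hψ.comp (f := fun q : P × V => (q.1, (extChartAt I x₀).symm q.2)) ?_
      fun q hq => ⟨hq.1, trivial⟩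
    exact continuousOn_fst.prodMk ((continuousOn_extChartAt_symm x₀).comp continuousOn_snd
      fun q hq => hq.2)
  obtain ⟨o₁, ho₁, ho₁D⟩ := continuousOn_iff'.1 hψ₁c _ (isOpen_extChartAt_source (I := I) y₀)
  have hmaps₁ : ∀ q ∈ D ∩ o₁, ψ₁ q ∈ (extChartAt I y₀).source := fun q hq =>
    (ho₁D ▸ (⟨hq.2, hq.1⟩ : q ∈ o₁ ∩ D) : q ∈ ψ₁ ⁻¹' (extChartAt I y₀).source ∩ D).1
  have hq₀₁ : q₀ ∈ o₁ := by
    have : q₀ ∈ ψ₁ ⁻¹' (extChartAt I y₀).source ∩ D :=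
      ⟨by rw [Set.mem_preimage, hψ₁q]; exact mem_extChartAt_source y₀, hq₀⟩
    exact (ho₁D ▸ this : q₀ ∈ o₁ ∩ D).1
  -- The graph of f composed with Ψ is the graph of g, which is smooth, so
  -- `contDiffWithinAt_of_immersion_comp` applies to Ψ. The open sets o₁ and o₂ keep everything
  -- inside the charts.
  set Ψ : P × V → P × V := fun q => (q.1, extChartAt I y₀ (ψ₁ q)) with hΨ
  have hΨc : ContinuousOn Ψ (D ∩ o₁) :=
    continuousOn_fst.prodMk ((continuousOn_extChartAt y₀).comp
      (hψ₁c.mono Set.inter_subset_left) hmaps₁)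
  have hΨq : Ψ q₀ = (p₀, extChartAt I y₀ y₀) := by simp only [hΨ, hψ₁q]; rfl
  obtain ⟨o₂, ho₂, ho₂D⟩ := continuousOn_iff'.1 hΨc _ ho
  have hq₀₂ : q₀ ∈ o₂ := by
    have : q₀ ∈ Ψ ⁻¹' o ∩ (D ∩ o₁) := ⟨by rw [Set.mem_preimage, hΨq]; exact hyo, hq₀, hq₀₁⟩
    exact (ho₂D ▸ this : q₀ ∈ o₂ ∩ (D ∩ o₁)).1
  set D' := D ∩ o₁ ∩ o₂ with hD'def
  have hD' : UniqueDiffOn ℝ D' := (hD.inter ho₁).inter ho₂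
  have hΨm : Set.MapsTo Ψ D' (S ×ˢ (extChartAt I y₀).target ∩ o) := fun q hq =>
    ⟨⟨hq.1.1.1, (extChartAt I y₀).map_source (hmaps₁ q hq.1)⟩,
      (ho₂D ▸ (⟨hq.2, hq.1⟩ : q ∈ o₂ ∩ (D ∩ o₁)) : q ∈ Ψ ⁻¹' o ∩ (D ∩ o₁)).1⟩
  have hcomp : ∀ q ∈ D', chartFamily I f y₀ (Ψ q) = chartFamily I g x₀ q := fun q hq => by
    simp only [chartFamily, hΨ, (extChartAt I y₀).left_inv (hmaps₁ q hq.1)]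
    exact hfg q.1 hq.1.1.1 _
  have hFΨ : ContDiffOn ℝ ∞ (graphInCharts (E := E) I f y₀ z₀ ∘ Ψ) D' := by
    refine ContDiffOn.prodMk (contDiffOn_fst (E := P) (F := V)) ?_
    refine ContDiffOn.congr (f := extChartAt 𝓘(ℝ, E) z₀ ∘ chartFamily I g x₀) ?_
      fun q hq => congrArg (extChartAt 𝓘(ℝ, E) z₀) (hcomp q hq)
    rw [← contMDiffOn_iff_contDiffOn]
    refine (contMDiffOn_extChartAt (I := 𝓘(ℝ, E)) (x := z₀) (n := ∞)).comp
      ((hg.contMDiffOn_chartFamily x₀).mono fun q hq => hq.1.1) fun q hq => ?_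
    have := hmaps (hΨm hq)
    rw [hcomp q hq, extChartAt_source] at this
    exact this
  have hmain : ContDiffWithinAt ℝ ∞ Ψ D' q₀ :=
    contDiffWithinAt_of_immersion_comp hT hD' hsm hFΨ (hΨc.mono Set.inter_subset_left) hΨm
      ⟨⟨hq₀, hq₀₁⟩, hq₀₂⟩ (by rw [hΨq]; exact hDinj)
  set r : P × L → P × V := fun z => (z.1, extChartAt I x₀ z.2) with hr
  have hrm : ContMDiffAt (𝓘(ℝ, P).prod I) 𝓘(ℝ, P × V) ∞ r (p₀, x₀) :=
    contMDiffAt_fst.prodMk_space (contMDiffAt_extChartAt.comp (p₀, x₀) contMDiffAt_snd)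
  set A : Set (P × L) := S ×ˢ Set.univ ∩ (Prod.snd ⁻¹' (extChartAt I x₀).source ∩
    r ⁻¹' (o₁ ∩ o₂)) with hA
  have hAmem : A ∈ 𝓝[S ×ˢ Set.univ] (p₀, x₀) := by
    refine Filter.inter_mem self_mem_nhdsWithin (mem_nhdsWithin_of_mem_nhds (Filter.inter_mem ?_ ?_))
    · exact continuousAt_snd.preimage_mem_nhds (extChartAt_source_mem_nhds x₀)
    · exact hrm.continuousAt.preimage_mem_nhds ((ho₁.inter ho₂).mem_nhds ⟨hq₀₁, hq₀₂⟩)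
  have hrA : Set.MapsTo r A D' := fun z hz =>
    ⟨⟨⟨hz.1.1, (extChartAt I x₀).map_source hz.2.1⟩, hz.2.2.1⟩, hz.2.2.2⟩
  have hA₀ : (p₀, x₀) ∈ A := ⟨⟨hp₀, trivial⟩, mem_extChartAt_source x₀, hq₀₁, hq₀₂⟩
  refine ContMDiffWithinAt.mono_of_mem_nhdsWithin (s := A) ?_ hAmem
  have h1 : ContMDiffWithinAt (𝓘(ℝ, P).prod I) 𝓘(ℝ, P × V) ∞ (Ψ ∘ r) A (p₀, x₀) :=
    hmain.contMDiffWithinAt.comp (p₀, x₀) hrm.contMDiffWithinAt hrA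
  have h2 : ContMDiffWithinAt (𝓘(ℝ, P).prod I) 𝓘(ℝ, V) ∞ (fun z => (Ψ (r z)).2) A (p₀, x₀) :=
    (contDiff_snd (E := P) (F := V)).contMDiff.contMDiffAt.comp_contMDiffWithinAt (p₀, x₀) h1
  have h3 : ContMDiffWithinAt (𝓘(ℝ, P).prod I) I ∞
      (fun z => (extChartAt I y₀).symm (Ψ (r z)).2) A (p₀, x₀) := by
    refine ContMDiffWithinAt.comp (p₀, x₀) (g := (extChartAt I y₀).symm)
      (t := (extChartAt I y₀).target) ?_ h2 fun z hz => (hΨm (hrA hz)).1.2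
    exact contMDiffOn_extChartAt_symm y₀ _ (hΨm (hrA hA₀)).1.2
  refine h3.congr_of_mem (fun z hz => ?_) hA₀
  simp only [hΨ]
  rw [(extChartAt I y₀).left_inv (hmaps₁ (r z) (hrA hz).1)]
  simp only [hψ₁, hr, (extChartAt I x₀).left_inv hz.2.1]

end Immersions

/-- The case of constant families over ℝ; it makes limits of diffeomorphisms smooth. -/
theorem contMDiff_of_immersion_comp_eq {E : Type*} [NormedAddCommGroup E] [NormedSpace ℝ E]
    [FiniteDimensional ℝ E] {X : Type*} [TopologicalSpace X] [ChartedSpace E X]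
    [IsManifold 𝓘(ℝ, E) ∞ X] {V : Type*} [NormedAddCommGroup V] [NormedSpace ℝ V]
    [FiniteDimensional ℝ V] {H : Type*} [TopologicalSpace H] {I : ModelWithCorners ℝ V H}
    {L : Type*} [TopologicalSpace L] [ChartedSpace H L] [IsManifold I ∞ L] {f g : L → X}
    {ψ : L → L} (hf : IsSmoothImmersion I 𝓘(ℝ, E) f) (hg : ContMDiff I 𝓘(ℝ, E) ∞ g)
    (hψ : Continuous ψ) (hfg : ∀ x, f (ψ x) = g x) : ContMDiff I I ∞ ψ := by
  have hF : ∀ {a : L → X}, ContMDiff I 𝓘(ℝ, E) ∞ a →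
      IsSmoothFamily (Set.univ : Set ℝ) E I fun _ => a :=
    fun ha => (ha.comp contMDiff_snd).contMDiffOn
  have h := (hF hf.1).contMDiffOn_of_comp_eq (hF hg) (ψ := fun _ => ψ) uniqueDiffOn_univ
    (fun _ _ => hf.2) (hψ.comp continuous_snd).continuousOn fun _ _ => hfg
  rw [← contMDiffOn_univ]
  exact h.comp (f := fun x : L => ((0 : ℝ), x))
    (contMDiff_const.prodMk contMDiff_id).contMDiffOn fun x _ => ⟨trivial, trivial⟩

/-! ### Freeness makes reparametrizations unique, hence smooth in the parameter. -/

section Reparametrization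

variable {m : ℕ} {E : Type*} [NormedAddCommGroup E] [NormedSpace ℝ E] [FiniteDimensional ℝ E]
  {X : Type*} [TopologicalSpace X] [T2Space X] [ChartedSpace E X] [IsManifold 𝓘(ℝ, E) ∞ X]
  {L : Type*} [TopologicalSpace L] [T2Space L] [CompactSpace L]
  [ChartedSpace (EuclideanHalfSpace (m + 1)) L] [IsManifold (𝓡∂ (m + 1)) ∞ L]
  {P : Type*} [NormedAddCommGroup P] [NormedSpace ℝ P] {S : Set P}

/-- The diffeomorphism ψ ∘ φ⁻¹ fixes f, so it is the identity. -/
theorem IsFree.eq_of_comp_eq {X : Type*} {f : L → X} (hf : IsFree m f)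
    {ψ φ : L ≃ₘ^∞⟮𝓡∂ (m + 1), 𝓡∂ (m + 1)⟯ L} (hψ : PreservesBoundaryComponents ψ)
    (hφ : PreservesBoundaryComponents φ) (h : ∀ x, f (ψ x) = f (φ x)) (x : L) : ψ x = φ x := by
  have h1 := hf (φ.symm.trans ψ) (fun y hy z hz => hψ y hy (hφ.symm y hy hz))
    (funext fun y => (h (φ.symm y)).trans (congrArg f (φ.apply_symm_apply y))) (φ x)
  rw [← h1]
  exact (congrArg ψ (φ.symm_apply_apply x)).symm

/-- The diffeomorphisms relating two smooth families of immersions, the first of which is free,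
depend smoothly on the parameter. -/
theorem IsSmoothFamily.contMDiffOn_diffeomorph [FiniteDimensional ℝ P] {f g : P → L → X}
    (hf : IsSmoothFamily S E (𝓡∂ (m + 1)) f) (hg : IsSmoothFamily S E (𝓡∂ (m + 1)) g)
    (hS : UniqueDiffOn ℝ S) (hfi : ∀ p ∈ S, IsSmoothImmersion (𝓡∂ (m + 1)) 𝓘(ℝ, E) (f p))
    (hgi : ∀ p ∈ S, IsSmoothImmersion (𝓡∂ (m + 1)) 𝓘(ℝ, E) (g p))
    (hfree : ∀ p ∈ S, IsFree m (f p)) {ψ : P → L ≃ₘ^∞⟮𝓡∂ (m + 1), 𝓡∂ (m + 1)⟯ L}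
    (hψ : ∀ p ∈ S, PreservesBoundaryComponents (ψ p)) (hfg : ∀ p ∈ S, ∀ x, f p (ψ p x) = g p x) :
    ContMDiffOn (𝓘(ℝ, P).prod (𝓡∂ (m + 1))) (𝓡∂ (m + 1)) ∞ (fun z : P × L => ψ z.1 z.2)
      (S ×ˢ Set.univ) := by
  have : LocallyConnectedSpace L := locallyConnectedSpace_of_modelWithCorners (𝓡∂ (m + 1)) L
  refine hf.contMDiffOn_of_comp_eq hg hS (fun p hp => (hfi p hp).2) ?_ hfg
  rintro ⟨p₀, x₀⟩ ⟨hp₀ : p₀ ∈ S, -⟩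
  have hfinj := exists_injOn_of_immersion (hfi p₀ hp₀)
  have hginj := exists_injOn_of_immersion (hgi p₀ hp₀)
  -- It suffices to treat ultrafilters. Along each, the limit Φ lies in Diff(L) and satisfies f_{p₀}
  -- ∘ Φ = g_{p₀}, so it equals ψ_{p₀} by freeness, whatever the ultrafilter.
  have hlim : Filter.Tendsto (fun p => ψ p x₀) (𝓝[S] p₀) (𝓝 (ψ p₀ x₀)) := by
    rw [Filter.tendsto_iff_ultrafilter]
    intro l hl
    obtain ⟨ψ', η', hψ'c, hη'c, hψη, hηψ, hfψ, hgη, htend⟩ := exists_limit_homeomorph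
      (ψ := fun p => ψ p) (η := fun p => (ψ p).symm)
      (ContMDiffOn.continuousOn hf) (ContMDiffOn.continuousOn hg) hp₀
      (fun p _ => (ψ p).continuous) (fun p _ => (ψ p).symm.continuous)
      (fun p _ => (ψ p).apply_symm_apply) (fun p _ => (ψ p).symm_apply_apply) hfg hfinj hginj l hl
    let Φ : L ≃ₘ^∞⟮𝓡∂ (m + 1), 𝓡∂ (m + 1)⟯ L :=
      { toFun := ψ'
        invFun := η'
        left_inv := hηψ
        right_inv := hψη
        contMDiff_toFun := contMDiff_of_immersion_comp_eq (hfi p₀ hp₀) (hgi p₀ hp₀).1 hψ'c hfψ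
        contMDiff_invFun := contMDiff_of_immersion_comp_eq (hgi p₀ hp₀) (hfi p₀ hp₀).1 hη'c hgη }
    -- The limit of points of a boundary component is in its closure, and in the boundary because Φ
    -- is a diffeomorphism. Adjoining it to the component keeps the set connected, so it belongs to
    -- the component.
    have hΦ : PreservesBoundaryComponents Φ := by
      intro x hx y hy
      have hyb : y ∈ (𝓡∂ (m + 1)).boundary L := connectedComponentIn_subset _ _ hy
      have hΦb : Φ y ∈ (𝓡∂ (m + 1)).boundary L := by
        rw [← Φ.image_boundary (I := 𝓡∂ (m + 1)) (I' := 𝓡∂ (m + 1)) (by simp)]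
        exact ⟨y, hyb, rfl⟩
      have hcl : Φ y ∈ closure (connectedComponentIn ((𝓡∂ (m + 1)).boundary L) x) :=
        mem_closure_of_tendsto (htend y) (Filter.Eventually.mono (hl self_mem_nhdsWithin)
          fun p hp => hψ p hp x hx hy)
      have hpre : IsPreconnected (insert (Φ y)
          (connectedComponentIn ((𝓡∂ (m + 1)).boundary L) x)) :=
        isPreconnected_connectedComponentIn.subset_closure (Set.subset_insert _ _)
          (Set.insert_subset hcl subset_closure)
      exact hpre.subset_connectedComponentIn (Set.mem_insert_of_mem _ (mem_connectedComponentIn hx))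
        (Set.insert_subset hΦb (connectedComponentIn_subset _ _)) (Set.mem_insert _ _)
    have hΦeq : ψ' x₀ = ψ p₀ x₀ := (hfree p₀ hp₀).eq_of_comp_eq (ψ := Φ) hΦ (hψ p₀ hp₀)
      (fun x => (hfψ x).trans (hfg p₀ hp₀ x).symm) x₀
    rw [← hΦeq]
    exact htend x₀
  have h := tendsto_prod_of_tendsto_apply (ψ := fun p => ψ p) (ContMDiffOn.continuousOn hf)
    (ContMDiffOn.continuousOn hg) hp₀ (fun p _ => (ψ p).continuous) hfg hfinj le_rfl
    (hfg p₀ hp₀ x₀) hlim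
  rw [ContinuousWithinAt, nhdsWithin_prod_eq, nhdsWithin_univ]
  exact h

end Reparametrization

/-! ### Flux of reparametrized families -/

section Tangent

variable {E : Type*} [NormedAddCommGroup E] [NormedSpace ℝ E]
  {X : Type*} [TopologicalSpace X] [ChartedSpace E X]
  {V : Type} [NormedAddCommGroup V] [NormedSpace ℝ V]
  {H : Type*} [TopologicalSpace H] {I : ModelWithCorners ℝ V H}
  {L : Type*} [TopologicalSpace L] [ChartedSpace H L] {k : ℕ}
  {P : Type*} [NormedAddCommGroup P] [NormedSpace ℝ P] {S : Set P}

variable (I S) in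
/-- Families of diffeomorphisms of `L` depending smoothly on a parameter in `S`. -/
def IsSmoothDiffeoFamily (ψ : P → L ≃ₘ^∞⟮I, I⟯ L) : Prop :=
  ContMDiffOn (𝓘(ℝ, P).prod I) I ∞ (fun z : P × L => ψ z.1 z.2) (S ×ˢ Set.univ)

theorem IsSmoothDiffeoFamily.comp_param {Q : Type*} [NormedAddCommGroup Q] [NormedSpace ℝ Q]
    {T : Set Q} {ψ : P → L ≃ₘ^∞⟮I, I⟯ L} (hψ : IsSmoothDiffeoFamily I S ψ) {r : Q → P}
    (hr : ContDiffOn ℝ ∞ r T) (hrT : Set.MapsTo r T S) :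
    IsSmoothDiffeoFamily I T (fun q => ψ (r q)) :=
  ContMDiffOn.comp hψ (f := fun z : Q × L => (r z.1, z.2))
    ((hr.contMDiffOn.comp contMDiffOn_fst fun _ hz => hz.1).prodMk contMDiffOn_snd)
    fun _ hz => ⟨hrT hz.1, trivial⟩

theorem IsSmoothDiffeoFamily.trans {ψ φ : P → L ≃ₘ^∞⟮I, I⟯ L} (hψ : IsSmoothDiffeoFamily I S ψ)
    (hφ : IsSmoothDiffeoFamily I S φ) : IsSmoothDiffeoFamily I S fun p => (ψ p).trans (φ p) :=
  ContMDiffOn.comp hφ (f := fun z : P × L => (z.1, ψ z.1 z.2)) (contMDiffOn_fst.prodMk hψ)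
    fun _ hz => ⟨hz.1, trivial⟩

theorem IsSmoothFamily.comp_diffeo {f : P → L → X} (hf : IsSmoothFamily S E I f)
    {ψ : P → L ≃ₘ^∞⟮I, I⟯ L} (hψ : IsSmoothDiffeoFamily I S ψ) :
    IsSmoothFamily S E I fun p => f p ∘ ψ p :=
  ContMDiffOn.comp hf (f := fun z : P × L => (z.1, ψ z.1 z.2)) (contMDiffOn_fst.prodMk hψ)
    fun _ hz => ⟨hz.1, trivial⟩

theorem pullback_comp_eq_zero {α : DiffForm 𝓘(ℝ, E) X k ℝ} {f : L → X}
    (hf : ContMDiff I 𝓘(ℝ, E) ∞ f) (h0 : pullback I 𝓘(ℝ, E) f α = 0) (ψ : L ≃ₘ^∞⟮I, I⟯ L) :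
    pullback I 𝓘(ℝ, E) (f ∘ ψ) α = 0 := by
  funext x
  ext v
  have h1 := mfderiv_comp x ((hf (ψ x)).mdifferentiableAt (by simp))
    ((ψ.contMDiff x).mdifferentiableAt (by simp))
  have h2 := DFunLike.congr_fun (congrFun h0 (ψ x)) fun i => mfderiv I I ψ x (v i)
  refine Eq.trans ?_ h2
  exact congrArg (α (f (ψ x))) (funext fun i => DFunLike.congr_fun h1 (v i))

/-- The velocity is a derivative within [0,1], so agreement there suffices even at the end points.
-/
theorem pathForm_congr (α : DiffForm 𝓘(ℝ, E) X (k + 1) ℝ) {f g : ℝ → L → X}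
    (hfg : ∀ t ∈ Set.Icc (0 : ℝ) 1, f t = g t) : pathForm I α f = pathForm I α g := by
  funext x
  refine intervalIntegral.integral_congr (E := V [⋀^Fin k]→L[ℝ] ℝ) fun t ht => ?_
  rw [Set.uIcc_of_le zero_le_one] at ht
  have h1 : mfderivWithin 𝓘(ℝ, ℝ) 𝓘(ℝ, E) (fun q => f q x) (Set.Icc (0 : ℝ) 1) t =
      mfderivWithin 𝓘(ℝ, ℝ) 𝓘(ℝ, E) (fun q => g q x) (Set.Icc (0 : ℝ) 1) t :=
    mfderivWithin_congr (fun q hq => congrFun (hfg q hq) x) (congrFun (hfg t ht) x)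
  ext v
  refine (congrArg (show E [⋀^Fin (k + 1)]→L[ℝ] ℝ from α (f t x)) (funext fun i =>
    Fin.cases (DFunLike.congr_fun h1 (1 : ℝ)) (fun i => rfl) i :
    _ = Fin.cons (α := fun _ => E)
      (mfderivWithin 𝓘(ℝ, ℝ) 𝓘(ℝ, E) (fun q => g q x) (Set.Icc (0 : ℝ) 1) t (1 : ℝ))
      fun i => mfderiv I 𝓘(ℝ, E) (f t) x (v i))).trans ?_
  rw [hfg t ht]
  rfl

/-- The velocity of F ∘ ψ_s is dF applied to ∂_s ψ_s. Since dψ_s is onto, that vector is dψ_s(w) for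
some w, and the velocity is d(F ∘ ψ_s)(w). -/
theorem isTangentPath_comp_diffeo {F : L → X} (hF : ContMDiff I 𝓘(ℝ, E) ∞ F) {g : ℝ → L → X}
    {ψ : ℝ → L ≃ₘ^∞⟮I, I⟯ L} (hψ : IsSmoothDiffeoFamily I (Set.Icc 0 1) ψ)
    (hg : ∀ s ∈ Set.Icc (0 : ℝ) 1, g s = F ∘ ψ s) : IsTangentPath E I g := by
  intro s hs x
  have hF' := ((hF (ψ s x)).mdifferentiableAt (by simp)).hasMFDerivAt
  have hψ₁ : ContMDiffOn 𝓘(ℝ, ℝ) I ∞ (fun q => ψ q x) (Set.Icc 0 1) :=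
    ContMDiffOn.comp hψ (f := fun q : ℝ => (q, x))
      (contMDiff_id.prodMk contMDiff_const).contMDiffOn fun _ hp => ⟨hp, trivial⟩
  have h1 := (((hψ₁ s hs).mdifferentiableWithinAt (by simp)).hasMFDerivWithinAt)
  have h2 := (hF'.comp_hasMFDerivWithinAt s h1).mfderivWithin
    (uniqueDiffOn_unitInterval s hs).uniqueMDiffWithinAt
  have h3 : mfderivWithin 𝓘(ℝ, ℝ) 𝓘(ℝ, E) (fun q => g q x) (Set.Icc (0 : ℝ) 1) s =
      mfderivWithin 𝓘(ℝ, ℝ) 𝓘(ℝ, E) (F ∘ fun q => ψ q x) (Set.Icc (0 : ℝ) 1) s :=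
    mfderivWithin_congr (fun q hq => congrFun (hg q hq) x) (congrFun (hg s hs) x)
  have h4 := mfderiv_comp x ((hF (ψ s x)).mdifferentiableAt (by simp))
    (((ψ s).contMDiff x).mdifferentiableAt (by simp))
  obtain ⟨w, hw⟩ := ((ψ s).mfderivToContinuousLinearEquiv (by simp) x).surjective
    (mfderivWithin 𝓘(ℝ, ℝ) I (fun q => ψ q x) (Set.Icc 0 1) s (1 : ℝ))
  refine ⟨w, ?_⟩
  rw [h3, h2, hg s hs]
  exact (DFunLike.congr_fun h4 w).trans (congrArg (mfderiv I 𝓘(ℝ, E) F (ψ s x)) hw)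

variable [IsManifold I ∞ L] [IsManifold 𝓘(ℝ, E) ∞ X]

/-- Reparametrizing a path does not change the class of its flux, as long as the initial
reparametrization is kept. -/
theorem pathForm_comp_diffeo_sub_mem_exactForms {α : DiffForm 𝓘(ℝ, E) X (k + 1) ℝ}
    (hα : IsSmoothForm 𝓘(ℝ, E) ∞ α) (hα0 : HasExtDeriv 𝓘(ℝ, E) α 0)
    {f : ℝ → L → X} (hf : IsSmoothFamily (Set.Icc (0 : ℝ) 1) E I f)
    (h0 : ∀ t ∈ Set.Icc (0 : ℝ) 1, pullback I 𝓘(ℝ, E) (f t) α = 0)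
    {ψ : ℝ → L ≃ₘ^∞⟮I, I⟯ L} (hψ : IsSmoothDiffeoFamily I (Set.Icc 0 1) ψ) :
    pathForm I α (fun t => f t ∘ ψ t) - pathForm I α (fun t => f t ∘ ψ 0) ∈
      exactForms I L k := by
  -- The square f_t ∘ ψ_{ut} joins f_t ∘ ψ_0 to f_t ∘ ψ_t. On each horizontal edge t = c it
  -- reparametrizes the fixed map f_c.
  have hK : IsSmoothFamily unitSquare E I fun p => f p.2 ∘ ψ (p.1 * p.2) :=
    IsSmoothFamily.comp_diffeo (hf.comp_param (r := Prod.snd) contDiffOn_snd fun p hp => hp.2)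
      (hψ.comp_param (r := fun p : ℝ × ℝ => p.1 * p.2) (by fun_prop)
        fun p hp => ⟨mul_nonneg hp.1.1 hp.2.1, mul_le_one₀ hp.1.2 hp.2.1 hp.2.2⟩)
  have hedge : ∀ c ∈ Set.Icc (0 : ℝ) 1, IsTangentPath E I fun u => f c ∘ ψ (u * c) := fun c hc =>
    isTangentPath_comp_diffeo (hf.contMDiff hc) (ψ := fun u => ψ (u * c))
      (hψ.comp_param (r := fun u : ℝ => u * c) (by fun_prop)
        fun u hu => ⟨mul_nonneg hu.1 hc.1, mul_le_one₀ hu.2 hc.1 hc.2⟩) fun _ _ => rfl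
  have h := pathForm_sub_mem_exactForms hα hα0 hK
    (fun p hp => pullback_comp_eq_zero (hf.contMDiff hp.2) (h0 p.2 hp.2) _)
    (hedge 0 (by simp)) (hedge 1 (by simp))
  simpa only [one_mul, zero_mul] using h

end Tangent

/-! ### Homotopies modulo reparametrization. -/

section Square

variable {m : ℕ} {E : Type*} [NormedAddCommGroup E] [NormedSpace ℝ E] [FiniteDimensional ℝ E]
  {X : Type*} [TopologicalSpace X] [T2Space X] [ChartedSpace E X] [IsManifold 𝓘(ℝ, E) ∞ X]
  {L : Type*} [TopologicalSpace L] [T2Space L] [CompactSpace L]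
  [ChartedSpace (EuclideanHalfSpace (m + 1)) L] [IsManifold (𝓡∂ (m + 1)) ∞ L]

/-- `g` is obtained from `f` by a reparametrization in `Diff(L)`. -/
def IsReparametrization (m : ℕ) {L : Type*} [TopologicalSpace L]
    [ChartedSpace (EuclideanHalfSpace (m + 1)) L] {X : Type*} (f g : L → X) : Prop :=
  ∃ ψ : L ≃ₘ^∞⟮𝓡∂ (m + 1), 𝓡∂ (m + 1)⟯ L, PreservesBoundaryComponents ψ ∧ g = f ∘ ψ

/-- The diffeomorphisms are chosen parameter by parameter; uniqueness makes this arbitrary choice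
smooth. -/
theorem exists_smoothDiffeoFamily {P : Type*} [NormedAddCommGroup P] [NormedSpace ℝ P]
    [FiniteDimensional ℝ P] {S : Set P} (hS : UniqueDiffOn ℝ S) {f g : P → L → X}
    (hf : IsSmoothFamily S E (𝓡∂ (m + 1)) f) (hg : IsSmoothFamily S E (𝓡∂ (m + 1)) g)
    (hfi : ∀ p ∈ S, IsSmoothImmersion (𝓡∂ (m + 1)) 𝓘(ℝ, E) (f p))
    (hgi : ∀ p ∈ S, IsSmoothImmersion (𝓡∂ (m + 1)) 𝓘(ℝ, E) (g p))
    (hfree : ∀ p ∈ S, IsFree m (f p)) (hfg : ∀ p ∈ S, IsReparametrization m (f p) (g p)) :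
    ∃ ψ : P → L ≃ₘ^∞⟮𝓡∂ (m + 1), 𝓡∂ (m + 1)⟯ L, IsSmoothDiffeoFamily (𝓡∂ (m + 1)) S ψ ∧
      (∀ p ∈ S, PreservesBoundaryComponents (ψ p)) ∧ ∀ p ∈ S, g p = f p ∘ ψ p := by
  have : Nonempty (L ≃ₘ^∞⟮𝓡∂ (m + 1), 𝓡∂ (m + 1)⟯ L) := ⟨Diffeomorph.refl _ L ∞⟩
  choose! ψ hψ hψfg using hfg
  exact ⟨ψ, hf.contMDiffOn_diffeomorph hg hS hfi hgi hfree hψ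
    fun p hp x => (congrFun (hψfg p hp) x).symm, hψ, hψfg⟩

/-- The class of the flux of a path of immersions depends only on the initial immersion and on the
homotopy class of the path modulo reparametrization. -/
theorem pathForm_sub_mem_exactForms_of_homotopy {k : ℕ} {α : DiffForm 𝓘(ℝ, E) X (k + 1) ℝ}
    (hα : IsSmoothForm 𝓘(ℝ, E) ∞ α) (hα0 : HasExtDeriv 𝓘(ℝ, E) α 0) {f f' : ℝ → L → X}
    (hf : IsSmoothFamily (Set.Icc (0 : ℝ) 1) E (𝓡∂ (m + 1)) f)
    (hf' : IsSmoothFamily (Set.Icc (0 : ℝ) 1) E (𝓡∂ (m + 1)) f')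
    (hfi : ∀ t ∈ Set.Icc (0 : ℝ) 1, IsSmoothImmersion (𝓡∂ (m + 1)) 𝓘(ℝ, E) (f t))
    (hfi' : ∀ t ∈ Set.Icc (0 : ℝ) 1, IsSmoothImmersion (𝓡∂ (m + 1)) 𝓘(ℝ, E) (f' t))
    (hff' : f 0 = f' 0) {h : ℝ × ℝ → L → X} (hh : IsSmoothFamily unitSquare E (𝓡∂ (m + 1)) h)
    (hhi : ∀ p ∈ unitSquare, IsSmoothImmersion (𝓡∂ (m + 1)) 𝓘(ℝ, E) (h p))
    (hfree : ∀ p ∈ unitSquare, IsFree m (h p))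
    (h0 : ∀ p ∈ unitSquare, pullback (𝓡∂ (m + 1)) 𝓘(ℝ, E) (h p) α = 0)
    (hleft : ∀ t ∈ Set.Icc (0 : ℝ) 1, IsReparametrization m (h (0, t)) (f t))
    (hright : ∀ t ∈ Set.Icc (0 : ℝ) 1, IsReparametrization m (h (1, t)) (f' t))
    (hbot : ∀ u ∈ Set.Icc (0 : ℝ) 1, IsReparametrization m (h (u, 0)) (f 0))
    (htop : ∀ u ∈ Set.Icc (0 : ℝ) 1, IsReparametrization m (h (0, 1)) (h (u, 1))) :
    pathForm (𝓡∂ (m + 1)) α f' - pathForm (𝓡∂ (m + 1)) α f ∈ exactForms (𝓡∂ (m + 1)) L k := by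
  have h0I : (0 : ℝ) ∈ Set.Icc (0 : ℝ) 1 := by simp
  have h1I : (1 : ℝ) ∈ Set.Icc (0 : ℝ) 1 := by simp
  have hI := uniqueDiffOn_unitInterval
  have hvert : ∀ u ∈ Set.Icc (0 : ℝ) 1,
      IsSmoothFamily (Set.Icc (0 : ℝ) 1) E (𝓡∂ (m + 1)) fun t => h (u, t) :=
    fun u hu => hh.comp_param (by fun_prop) fun t ht => ⟨hu, ht⟩
  have hhor : ∀ t ∈ Set.Icc (0 : ℝ) 1,
      IsSmoothFamily (Set.Icc (0 : ℝ) 1) E (𝓡∂ (m + 1)) fun u => h (u, t) :=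
    fun t ht => hh.comp_param (by fun_prop) fun u hu => ⟨hu, ht⟩
  have hconst : ∀ {a : L → X}, ContMDiff (𝓡∂ (m + 1)) 𝓘(ℝ, E) ∞ a →
      IsSmoothFamily (Set.Icc (0 : ℝ) 1) E (𝓡∂ (m + 1)) fun _ => a :=
    fun ha => (ha.comp contMDiff_snd).contMDiffOn
  obtain ⟨ψ, hψ, hψb, hψf⟩ := exists_smoothDiffeoFamily hI (hvert 0 h0I) hf
    (fun t ht => hhi _ ⟨h0I, ht⟩) hfi (fun t ht => hfree _ ⟨h0I, ht⟩) hleft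
  obtain ⟨ψ', hψ', hψb', hψf'⟩ := exists_smoothDiffeoFamily hI (hvert 1 h1I) hf'
    (fun t ht => hhi _ ⟨h1I, ht⟩) hfi' (fun t ht => hfree _ ⟨h1I, ht⟩) hright
  obtain ⟨χ, hχ, hχb, hχf⟩ := exists_smoothDiffeoFamily hI (hhor 0 h0I) (hconst (hfi 0 h0I).1)
    (fun u hu => hhi _ ⟨hu, h0I⟩) (fun _ _ => hfi 0 h0I) (fun u hu => hfree _ ⟨hu, h0I⟩) hbot
  obtain ⟨ξ, hξ, hξb, hξf⟩ := exists_smoothDiffeoFamily hI (hconst (hhi _ ⟨h0I, h1I⟩).1)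
    (hhor 1 h1I) (fun _ _ => hhi _ ⟨h0I, h1I⟩) (fun u hu => hhi _ ⟨hu, h1I⟩)
    (fun _ _ => hfree _ ⟨h0I, h1I⟩) htop
  -- At the corners of the edge t = 0, both diffeomorphisms carry the same free map to f_0. At u = 1
  -- this uses that the two liftings have the same initial map.
  have hχψ : (χ 0 : L → L) = ψ 0 := funext <|
    (hfree _ ⟨h0I, h0I⟩).eq_of_comp_eq (hχb 0 h0I) (hψb 0 h0I) <| congrFun
      ((hχf 0 h0I).symm.trans (hψf 0 h0I))
  have hχψ' : (χ 1 : L → L) = ψ' 0 := funext <|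
    (hfree _ ⟨h1I, h0I⟩).eq_of_comp_eq (hχb 1 h1I) (hψb' 0 h0I) <| congrFun
      ((hχf 1 h1I).symm.trans (hff'.trans (hψf' 0 h0I)))
  have e1 := pathForm_comp_diffeo_sub_mem_exactForms hα hα0 (hvert 0 h0I)
    (fun t ht => h0 _ ⟨h0I, ht⟩) hψ
  have e2 := pathForm_comp_diffeo_sub_mem_exactForms hα hα0 (hvert 1 h1I)
    (fun t ht => h0 _ ⟨h1I, ht⟩) hψ'
  -- In the corrected square h(u,t) ∘ χ_u the edge t = 0 is constantly f_0, and the edge t = 1 is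
  -- h(0,1) ∘ ξ_u ∘ χ_u; both are tangent paths.
  have e3 := pathForm_sub_mem_exactForms hα hα0 (f := fun p => h p ∘ χ p.1)
    (hh.comp_diffeo (hχ.comp_param (r := Prod.fst) contDiffOn_fst fun p hp => hp.1))
    (fun p hp => pullback_comp_eq_zero (hh.contMDiff hp) (h0 p hp) _)
    (isTangentPath_comp_diffeo (hfi 0 h0I).1 (ψ := fun _ => Diffeomorph.refl _ L ∞)
      contMDiffOn_snd fun u hu => (hχf u hu).symm)
    (isTangentPath_comp_diffeo (hhi _ ⟨h0I, h1I⟩).1 (hχ.trans hξ)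
      fun u hu => congrArg (· ∘ χ u) (hξf u hu))
  simp only [hχψ, hχψ'] at e3
  rw [pathForm_congr α hψf, pathForm_congr α hψf']
  -- The intermediate flux forms, those of h(0,t) ∘ ψ_0 and h(1,t) ∘ ψ'_0, cancel.
  have := add_mem (sub_mem e2 e1) e3
  convert this using 1
  abel

end Square

end

end SLFlux

/-! ### The special Lagrangian flux. -/

theorem mainTheorem4 {m d : ℕ}
    {E : Type*} [NormedAddCommGroup E] [NormedSpace ℂ E]
    {X : Type*} [TopologicalSpace X] [T2Space X] [SecondCountableTopology X]
    [ChartedSpace E X] [IsManifold 𝓘(ℂ, E) ω X]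
    (Y : SLFlux.CalabiYau E (m + 1) X)
    {L : Type*} [TopologicalSpace L] [T2Space L] [CompactSpace L]
    [ChartedSpace (EuclideanHalfSpace (m + 1)) L] [IsManifold (𝓡∂ (m + 1)) ∞ L]
    (C : Fin d → Set L) (hC : SLFlux.IsBoundaryOrdering m C)
    {N : Fin d → Type*} [∀ i, TopologicalSpace (N i)]
    [∀ i, ChartedSpace (EuclideanSpace ℝ (Fin (m + 1))) (N i)]
    [∀ i, IsManifold (𝓡 (m + 1)) ∞ (N i)]
    (j : ∀ i, N i → X) (hj : ∀ i, SLFlux.IsEmbeddedLagrangian Y (j i))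
    (hdisj : Pairwise fun i i' => Disjoint (Set.range (j i)) (Set.range (j i'))) :
    ∃ hclosed : ∀ (Z : ℝ → SLFlux.SLModuli Y C j) (f : ℝ → L → X),
        SLFlux.IsSmoothLift (Set.Icc (0 : ℝ) 1) Z f →
          SLFlux.fluxForm Y f ∈ SLFlux.closedForms (𝓡∂ (m + 1)) L m,
      (∀ (Z : ℝ → SLFlux.SLModuli Y C j) (f : ℝ → L → X),
        SLFlux.IsSmoothLift (Set.Icc (0 : ℝ) 1) Z f →
          ∀ x : L, IntervalIntegrable (fun t => SLFlux.fluxIntegrand Y f t x)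
            MeasureTheory.volume 0 1) ∧
      ∀ (Z Z' : ℝ → SLFlux.SLModuli Y C j) (f f' : ℝ → L → X)
        (hf : SLFlux.IsSmoothLift (Set.Icc (0 : ℝ) 1) Z f)
        (hf' : SLFlux.IsSmoothLift (Set.Icc (0 : ℝ) 1) Z' f'),
        f 0 = f' 0 → SLFlux.SmoothHomotopicRelEnds Z Z' →
          SLFlux.specialFlux Y f (hclosed Z f hf) = SLFlux.specialFlux Y f' (hclosed Z' f' hf') := by
  have hfinC : FiniteDimensional ℂ E :=
    Module.finite_of_finrank_pos (by rw [Y.finrank_eq]; exact m.succ_pos)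
  have hfinR : FiniteDimensional ℝ E := FiniteDimensional.complexToReal E
  have hX : IsManifold 𝓘(ℝ, E) ∞ X := SLFlux.isManifold_real
  have hα := SLFlux.isSmoothForm_imForm Y.vol_holomorphic
  have hα0 := SLFlux.hasExtDeriv_imForm Y.finrank_eq Y.vol_holomorphic
  refine ⟨fun Z f hf => ?_, fun Z f hf x => ?_, fun Z Z' f f' hf hf' hff' hZ => ?_⟩
  -- The flux form is by definition the path form of Im Ω, with velocity the derivative in the
  -- direction 1.
  · exact SLFlux.pathForm_mem_closedForms hα hα0 hf.1 fun t ht => (hf.2 t ht).1.special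
  · have h := SLFlux.IsSmoothFamily.continuousOn_familyForm hα hf.1
      SLFlux.uniqueDiffOn_unitInterval (1 : ℝ) x
    exact ContinuousOn.intervalIntegrable_of_Icc (μ := MeasureTheory.volume) zero_le_one h
  · obtain ⟨H, ⟨h, hh, hhZ⟩, hvert, hhor⟩ := hZ
    -- Equality of classes in the moduli space yields the reparametrizations along the four edges of
    -- the homotopy.
    have hrel : ∀ {a b : L → X} (ha : SLFlux.IsFreeSpecialLagrangian Y C j a)
        (hb : SLFlux.IsFreeSpecialLagrangian Y C j b),
        (Quotient.mk _ ⟨a, ha⟩ : SLFlux.SLModuli Y C j) = Quotient.mk _ ⟨b, hb⟩ →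
        SLFlux.IsReparametrization m a b := fun _ _ hab => Quotient.exact hab
    have h0I : (0 : ℝ) ∈ Set.Icc (0 : ℝ) 1 := by simp
    have h1I : (1 : ℝ) ∈ Set.Icc (0 : ℝ) 1 := by simp
    have hsub := SLFlux.pathForm_sub_mem_exactForms_of_homotopy hα hα0 hf.1 hf'.1
      (fun t ht => (hf.2 t ht).1.immersion) (fun t ht => (hf'.2 t ht).1.immersion) hff' hh
      (fun p hp => (hhZ p hp).1.immersion) (fun p hp => (hhZ p hp).1.free)
      (fun p hp => (hhZ p hp).1.special)
      (fun t ht => by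
        obtain ⟨ha, hHa⟩ := hhZ (0, t) ⟨h0I, ht⟩
        obtain ⟨hb, hZb⟩ := hf.2 t ht
        exact hrel ha hb (by rw [← hHa, ← hZb, (hvert t ht).1]))
      (fun t ht => by
        obtain ⟨ha, hHa⟩ := hhZ (1, t) ⟨h1I, ht⟩
        obtain ⟨hb, hZb⟩ := hf'.2 t ht
        exact hrel ha hb (by rw [← hHa, ← hZb, (hvert t ht).2]))
      (fun u hu => by
        obtain ⟨ha, hHa⟩ := hhZ (u, 0) ⟨hu, h0I⟩
        obtain ⟨hb, hZb⟩ := hf.2 0 h0I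
        exact hrel ha hb (by rw [← hHa, ← hZb, (hhor u hu).1]))
      (fun u hu => by
        obtain ⟨ha, hHa⟩ := hhZ (0, 1) ⟨h0I, h1I⟩
        obtain ⟨hb, hHb⟩ := hhZ (u, 1) ⟨hu, h1I⟩
        exact hrel ha hb (by rw [← hHa, ← hHb, (hhor u hu).2.2.1, (hhor 0 h0I).2.2.1]))
    refine ((Submodule.Quotient.eq _).2 ?_).symm
    exact hsub
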